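/- Let $\Lambda^\vee$ be a lattice (a free abelian group of finite rank), $\mathfrak t=\Lambda^\vee\otimes\mathbb R$, $T=\mathfrak t/\Lambda^\vee=\Lambda^\vee\otimes U(1)$, and let $I$ be an even unimodular symmetric bilinear form on $\Lambda^\vee$, i.e. $I^\sharp:\Lambda^\vee\to\mathrm{Hom}(\Lambda^\vee,\mathbb Z)$ is an isomorphism. Choose an integral bilinear form $J$ with $I(m,n)=J(m,n)+J(n,m)$, extended to $\mathfrak t$. Let $\mathcal T\rtimes\{\pm1\}$ be the strict categorical group of the Lie crossed module $$\theta':\Lambda^\vee\times U(1)\to\mathfrak t\rtimes\{\pm1\},\quad (m,z)\mapsto (m,1),\qquad (m,z)^{(x,\varepsilon)}=(\varepsilon m,\,z\,e^{2\pi iJ(m,x)}).$$ For a Lie crossed module $\psi:G_1\to G_0$ (right action $\alpha^x$), a weak endomorphism is a triple of real analytic maps $f_0:G_0\to G_0$, $f_1:G_1\to G_1$ (both pointed) and $\kappa:G_0\times G_0\to G_1$ such that $f_0\psi=\psi f_1$, $f_0(x)f_0(y)\psi(\kappa_{x,y})=f_0(xy)$, $f_1(\alpha)f_1(\beta)\kappa_{\psi\alpha,\psi\beta}=f_1(\alpha\beta)$,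 $\kappa_{x,y}^{f_0(z)}\kappa_{xy,z}=\kappa_{y,z}\kappa_{x,yz}$ and $f_1(\alpha)^{f_0(x)}\kappa_{\psi\alpha,x}=f_1(\alpha^x)\kappa_{x,\psi(\alpha^x)}$. It is centre-preserving if $f_1$ is the identity on $\ker\psi$. $\mathcal Aut^+$ is the strict categorical group whose objects are the invertible centre-preserving weak endomorphisms, and whose arrows are given by the pointed analytic maps $\eta:G_0\to G_1$ that are invertible for $(\chi_1\circ\chi_2)(x)=\chi_2(x)\chi_1(x\psi(\chi_2(x)))$, via $\delta(\eta)=\big(x\mapsto x\psi(\eta(x)),\ \alpha\mapsto\alpha\eta(\psi\alpha),\ \eta(y)^{-1}(\eta(x)^y)^{-1}\eta(xy)\big)$; so $\pi_0\mathcal Aut^+$ is the group of its objects modulo the image of $\delta$. If $G_0$ acts trivially on $\ker\psi$ (as it does for $\theta'$), conjugation $x\mapsto\big(x(-)x^{-1},(-)^{x^{-1}},1\big)$ induces $\pi_0(\mathcal Ad^+):G_0/\psi(G_1)\to\pi_0\mathcal Aut^+$, and $\mathcal Out^+$ is the cokernel: the same objects, $\varphi$ and $\varphi'$ being isomorphic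 if $\varphi'\cong \mathcal Ad^+(x)\circ\varphi$ in $\mathcal Aut^+$ for some $x\in G_0$. $\mathcal Z$ is the Drinfeld centre, whose objects are the pairs $(x,\xi)$ of $x\in G_0$ and an analytic crossed homomorphism $\xi:G_0\to G_1$ with $x^{-1}zx=z\,\psi(\xi(z))$ and $\alpha^x=\alpha\,\xi(\psi\alpha)$, and whose $\pi_0$ is the group of these, under $(x,\xi)(y,\upsilon)=(xy,\,z\mapsto\upsilon(z)\xi(z)^y)$, modulo the elements $(\psi\alpha,\ z\mapsto(\alpha^{-1})^z\alpha)$, $\alpha\in G_1$. $\mathrm{Cross}$ denotes analytic crossed homomorphisms. Finally $O(\Lambda^\vee,I)$ is the isometry group and $PO(\Lambda^\vee,I)=O(\Lambda^\vee,I)/\{\pm\mathrm{id}\}$. Then, for $\mathcal G=\mathcal T\rtimes\{\pm1\}$: 1. There is an isomorphism of groups $\pi_0(\mathcal Out^+(\mathcal G))\cong PO(\Lambda^\vee,I)$. It sends the class of $(f,\kappa)$ to the class of the isometry $g$ through which $f_1$ acts on the $\Lambda^\vee$-component of $\Lambda^\vee\times U(1)$. 2. The sequence $$1\to(\pi_1\mathcal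 G)^{\pi_0\mathcal G}\to\pi_1\mathcal G\to \mathrm{Cross}(\pi_0\mathcal G,\pi_1\mathcal G)\to\pi_0\mathcal Z(\mathcal G)\to\pi_0\mathcal G\to\pi_0\mathcal Aut^+(\mathcal G)\to\pi_0\mathcal Out^+(\mathcal G)\to1$$ (with maps the inclusion, $\alpha\mapsto(x\mapsto\alpha^x\alpha^{-1})$, $\chi\mapsto[(1,\chi)]$, $[(x,\xi)]\mapsto[x]$, $\pi_0(\mathcal Ad^+)$ and the projection) is exact. Here $(\pi_1\mathcal G)^{\pi_0\mathcal G}=\pi_1\mathcal G\cong U(1)$, $\mathrm{Cross}(\pi_0\mathcal G,\pi_1\mathcal G)\cong\{\pm1\}$ (the homomorphisms $(x,\varepsilon)\mapsto 1$ and $(x,\varepsilon)\mapsto\varepsilon$), and $\pi_0\mathcal G\cong T\rtimes\{\pm1\}$. If $\Lambda^\vee\neq0$, it breaks up into $$1\to U(1)\xrightarrow{\ \cong\ }U(1)\to1,\qquad 1\to\{\pm1\}\xrightarrow{\ \cong\ }\pi_0\mathcal Z(\mathcal G)\to1,$$ $$1\to T\rtimes\{\pm1\}\to\pi_0\mathcal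 Aut^+(\mathcal G)\to PO(\Lambda^\vee,I)\to1 .$$ -/

import Mathlib

open scoped ContDiff Manifold

set_option linter.unusedSectionVars false

/-- A crossed module `ψ : G₁ → G₀`, with `G₀` acting on `G₁` from the right. -/
structure CrossedModule (G₀ G₁ : Type*) [Group G₀] [Group G₁] where
  hom : G₁ →* G₀
  act : G₁ → G₀ → G₁
  act_one : ∀ a, act a 1 = a
  act_mul : ∀ a x y, act a (x * y) = act (act a x) y
  mul_act : ∀ a b x, act (a * b) x = act a x * act b x
  hom_act : ∀ a x, hom (act a x) = x⁻¹ * hom a * x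
  peiffer : ∀ b a, act b (hom a) = a⁻¹ * b * a

namespace CrossedModule

section Discrete

variable {G₀ G₁ : Type*} [Group G₀] [Group G₁] (Ψ : CrossedModule G₀ G₁)

@[simp] theorem one_act (x : G₀) : Ψ.act 1 x = 1 := by
  have h := Ψ.mul_act 1 1 x
  rw [one_mul] at h
  exact (left_eq_mul.mp h)

theorem inv_act (a : G₁) (x : G₀) : Ψ.act a⁻¹ x = (Ψ.act a x)⁻¹ := by
  rw [eq_inv_iff_mul_eq_one, ← Ψ.mul_act, inv_mul_cancel, one_act]

theorem act_inv_act (a : G₁) (x : G₀) : Ψ.act (Ψ.act a x) x⁻¹ = a := by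
  rw [← Ψ.act_mul, mul_inv_cancel, Ψ.act_one]

theorem act_act_inv (a : G₁) (x : G₀) : Ψ.act (Ψ.act a x⁻¹) x = a := by
  rw [← Ψ.act_mul, inv_mul_cancel, Ψ.act_one]

theorem act_injective (x : G₀) : Function.Injective fun a => Ψ.act a x := fun a b h => by
  have := congrArg (fun c => Ψ.act c x⁻¹) h
  simpa only [act_inv_act] using this

/-- The Peiffer identity, in the form used for commuting elements past each other. -/
theorem mul_act_hom (a b : G₁) : a * Ψ.act b (Ψ.hom a) = b * a := by
  rw [Ψ.peiffer]; group

instance normal_range : Ψ.hom.range.Normal where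
  conj_mem := by
    rintro _ ⟨a, rfl⟩ x
    exact ⟨Ψ.act a x⁻¹, by rw [Ψ.hom_act, inv_inv]⟩

/-- `π₀` of the strict categorical group of a crossed module: isomorphism classes of objects,
i.e. the cokernel of the structure map. -/
abbrev Pi0 : Type _ := G₀ ⧸ Ψ.hom.range

/-- `π₁` of the strict categorical group of a crossed module: automorphisms of the unit object,
i.e. the kernel of the structure map. -/
abbrev Pi1 : Type _ := Ψ.hom.ker

/-- The class of an object in `π₀`. -/
def cls (x : G₀) : Ψ.Pi0 := QuotientGroup.mk x

theorem cls_surjective : Function.Surjective Ψ.cls := QuotientGroup.mk_surjective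

theorem ker_mul_comm {a : G₁} (ha : Ψ.hom a = 1) (b : G₁) : a * b = b * a := by
  have := Ψ.peiffer b a
  rw [ha, Ψ.act_one] at this
  calc a * b = a * (a⁻¹ * b * a) := by rw [← this]
    _ = b * a := by group

instance : CommGroup Ψ.Pi1 where
  mul_comm a b := Subtype.ext (Ψ.ker_mul_comm (MonoidHom.mem_ker.mp a.2) b)

/-- The action of `G₀` on `π₁`. -/
def pi1Act (a : Ψ.Pi1) (x : G₀) : Ψ.Pi1 :=
  ⟨Ψ.act a x, by
    rw [MonoidHom.mem_ker, Ψ.hom_act, MonoidHom.mem_ker.mp a.2]; group⟩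

@[simp] theorem coe_pi1Act (a : Ψ.Pi1) (x : G₀) : (Ψ.pi1Act a x : G₁) = Ψ.act a x := rfl

/-- The invariants `(π₁)^{π₀}`. -/
def pi1Invariants : Subgroup Ψ.Pi1 where
  carrier := {a | ∀ x, Ψ.pi1Act a x = a}
  one_mem' x := Subtype.ext (by simp)
  mul_mem' {a b} ha hb x := Subtype.ext (by
    have h1 := congrArg Subtype.val (ha x)
    have h2 := congrArg Subtype.val (hb x)
    simp only [coe_pi1Act] at h1 h2 ⊢
    rw [Subgroup.coe_mul, Ψ.mul_act, h1, h2])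
  inv_mem' {a} ha x := Subtype.ext (by
    have h1 := congrArg Subtype.val (ha x)
    simp only [coe_pi1Act] at h1 ⊢
    rw [Subgroup.coe_inv, Ψ.inv_act, h1])

/-- `π₀` acts trivially on `π₁` (the categorical group is a central extension). -/
class IsCentral : Prop where
  act_eq : ∀ a x, Ψ.hom a = 1 → Ψ.act a x = a

end Discrete

section Lie

variable {E₀ H₀ E₁ H₁ : Type*} [NormedAddCommGroup E₀] [NormedSpace ℝ E₀] [TopologicalSpace H₀]
  [NormedAddCommGroup E₁] [NormedSpace ℝ E₁] [TopologicalSpace H₁]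
  (I₀ : ModelWithCorners ℝ E₀ H₀) (I₁ : ModelWithCorners ℝ E₁ H₁)
  {G₀ G₁ : Type*} [Group G₀] [Group G₁] [TopologicalSpace G₀] [ChartedSpace H₀ G₀]
  [TopologicalSpace G₁] [ChartedSpace H₁ G₁]

/-- A Lie crossed module: `G₀` and `G₁` are real analytic Lie groups, and the structure map and the
action are real analytic. -/
class IsLie (Ψ : CrossedModule G₀ G₁) : Prop where
  lie₀ : LieGroup I₀ ω G₀
  lie₁ : LieGroup I₁ ω G₁
  hom_analytic : ContMDiff I₁ I₀ ω Ψ.hom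
  act_analytic : ContMDiff (I₁.prod I₀) I₁ ω fun p : G₁ × G₀ => Ψ.act p.1 p.2

variable (Ψ : CrossedModule G₀ G₁)

/-- Weak endomorphisms of a Lie crossed module: triples `(p₀, p₁, κ)` of analytic maps, with
`p₀` and `p₁` pointed, satisfying the compatibilities `w1`, ..., `w5`. -/
@[ext] structure WeakEnd where
  map₀ : G₀ → G₀
  map₁ : G₁ → G₁
  κ : G₀ → G₀ → G₁
  analytic₀ : ContMDiff I₀ I₀ ω map₀
  analytic₁ : ContMDiff I₁ I₁ ω map₁
  analyticκ : ContMDiff (I₀.prod I₀) I₁ ω fun p : G₀ × G₀ => κ p.1 p.2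
  one₀ : map₀ 1 = 1
  one₁ : map₁ 1 = 1
  w1 : ∀ a, map₀ (Ψ.hom a) = Ψ.hom (map₁ a)
  w2 : ∀ x y, map₀ x * map₀ y * Ψ.hom (κ x y) = map₀ (x * y)
  w3 : ∀ a b, map₁ a * map₁ b * κ (Ψ.hom a) (Ψ.hom b) = map₁ (a * b)
  w4 : ∀ x y z, Ψ.act (κ x y) (map₀ z) * κ (x * y) z = κ y z * κ x (y * z)
  w5 : ∀ a x, Ψ.act (map₁ a) (map₀ x) * κ (Ψ.hom a) x =
    map₁ (Ψ.act a x) * κ x (Ψ.hom (Ψ.act a x))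

namespace WeakEnd

variable {I₀ I₁ Ψ}

theorem κ_one_one (p : WeakEnd I₀ I₁ Ψ) : p.κ 1 1 = 1 := by
  have := p.w3 1 1
  simpa [p.one₁] using this

theorem κ_one_right (p : WeakEnd I₀ I₁ Ψ) (x : G₀) : p.κ x 1 = 1 := by
  have := p.w4 x 1 1
  simpa [p.one₀, Ψ.act_one, p.κ_one_one] using this

theorem κ_one_left (p : WeakEnd I₀ I₁ Ψ) (x : G₀) : p.κ 1 x = 1 := by
  have := p.w4 1 1 x
  simp only [p.κ_one_one, Ψ.one_act, mul_one, one_mul] at this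
  exact left_eq_mul.mp this

/-- The effect on arrows: the arrow `(y, b)` of the associated groupoid, from `y` to `y * ψ b`, is
sent by the monoidal functor of `p` to the arrow `(p₀ y, p.arrow y b)`. -/
def arrow (p : WeakEnd I₀ I₁ Ψ) (y : G₀) (b : G₁) : G₁ := p.map₁ b * p.κ y (Ψ.hom b)

theorem map₀_mul_hom (p : WeakEnd I₀ I₁ Ψ) (y : G₀) (b : G₁) :
    p.map₀ (y * Ψ.hom b) = p.map₀ y * Ψ.hom (p.arrow y b) := by
  rw [← p.w2, p.w1, arrow, map_mul, mul_assoc]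

@[simp] theorem arrow_one (p : WeakEnd I₀ I₁ Ψ) (y : G₀) : p.arrow y 1 = 1 := by
  simp [arrow, p.one₁, p.κ_one_right]

theorem arrow_mul (p : WeakEnd I₀ I₁ Ψ) (y : G₀) (b c : G₁) :
    p.arrow y (b * c) = p.arrow y b * p.arrow (y * Ψ.hom b) c := by
  have h4 := p.w4 y (Ψ.hom b) (Ψ.hom c)
  rw [p.w1, Ψ.peiffer] at h4
  simp only [arrow, map_mul]
  rw [← p.w3, mul_assoc _ (p.κ (Ψ.hom b) (Ψ.hom c)), ← h4]
  group

theorem κ_mul_arrow_right (p : WeakEnd I₀ I₁ Ψ) (y z : G₀) (c : G₁) :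
    p.κ y z * p.arrow (y * z) c = p.arrow z c * p.κ y (z * Ψ.hom c) := by
  have h4 := p.w4 y z (Ψ.hom c)
  rw [p.w1, Ψ.peiffer] at h4
  simp only [arrow]
  rw [mul_assoc, ← h4]
  group

theorem κ_mul_arrow_left (p : WeakEnd I₀ I₁ Ψ) (y z : G₀) (b : G₁) :
    p.κ y z * p.arrow (y * z) (Ψ.act b z) =
      Ψ.act (p.arrow y b) (p.map₀ z) * p.κ (y * Ψ.hom b) z := by
  have e : z * Ψ.hom (Ψ.act b z) = Ψ.hom b * z := by rw [Ψ.hom_act]; group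
  rw [κ_mul_arrow_right, e]
  simp only [arrow]
  rw [← p.w5, mul_assoc, ← p.w4, Ψ.mul_act]
  group

theorem act_map₁ (p : WeakEnd I₀ I₁ Ψ) (a : G₁) (x : G₀) :
    Ψ.act (p.map₁ a) (p.map₀ x) * p.κ (Ψ.hom a) x = p.arrow x (Ψ.act a x) := p.w5 a x

theorem analytic_mul₁ (I₀ : ModelWithCorners ℝ E₀ H₀) (I₁ : ModelWithCorners ℝ E₁ H₁)
    (Ψ : CrossedModule G₀ G₁) [Ψ.IsLie I₀ I₁] {E H M : Type*} [NormedAddCommGroup E] [NormedSpace ℝ E] [TopologicalSpace H]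
    {I : ModelWithCorners ℝ E H} [TopologicalSpace M] [ChartedSpace H M] {f g : M → G₁}
    (hf : ContMDiff I I₁ ω f) (hg : ContMDiff I I₁ ω g) : ContMDiff I I₁ ω fun x => f x * g x :=
  haveI : LieGroup I₁ ω G₁ := IsLie.lie₁ I₀ Ψ
  hf.mul hg

theorem analytic_inv₁ (I₀ : ModelWithCorners ℝ E₀ H₀) (I₁ : ModelWithCorners ℝ E₁ H₁)
    (Ψ : CrossedModule G₀ G₁) [Ψ.IsLie I₀ I₁] {E H M : Type*} [NormedAddCommGroup E] [NormedSpace ℝ E] [TopologicalSpace H]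
    {I : ModelWithCorners ℝ E H} [TopologicalSpace M] [ChartedSpace H M] {f : M → G₁}
    (hf : ContMDiff I I₁ ω f) : ContMDiff I I₁ ω fun x => (f x)⁻¹ :=
  haveI : LieGroup I₁ ω G₁ := IsLie.lie₁ I₀ Ψ
  hf.inv

theorem analytic_mul₀ (I₀ : ModelWithCorners ℝ E₀ H₀) (I₁ : ModelWithCorners ℝ E₁ H₁)
    (Ψ : CrossedModule G₀ G₁) [Ψ.IsLie I₀ I₁] {E H M : Type*} [NormedAddCommGroup E] [NormedSpace ℝ E] [TopologicalSpace H]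
    {I : ModelWithCorners ℝ E H} [TopologicalSpace M] [ChartedSpace H M] {f g : M → G₀}
    (hf : ContMDiff I I₀ ω f) (hg : ContMDiff I I₀ ω g) : ContMDiff I I₀ ω fun x => f x * g x :=
  haveI : LieGroup I₀ ω G₀ := IsLie.lie₀ I₁ Ψ
  hf.mul hg

theorem analytic_act (I₀ : ModelWithCorners ℝ E₀ H₀) (I₁ : ModelWithCorners ℝ E₁ H₁)
    (Ψ : CrossedModule G₀ G₁) [Ψ.IsLie I₀ I₁] {E H M : Type*} [NormedAddCommGroup E] [NormedSpace ℝ E] [TopologicalSpace H]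
    {I : ModelWithCorners ℝ E H} [TopologicalSpace M] [ChartedSpace H M] {f : M → G₁} {g : M → G₀}
    (hf : ContMDiff I I₁ ω f) (hg : ContMDiff I I₀ ω g) :
    ContMDiff I I₁ ω fun x => Ψ.act (f x) (g x) :=
  (IsLie.act_analytic (I₀ := I₀) (I₁ := I₁) (Ψ := Ψ)).comp (hf.prodMk hg)

theorem analytic_hom (I₀ : ModelWithCorners ℝ E₀ H₀) (I₁ : ModelWithCorners ℝ E₁ H₁)
    (Ψ : CrossedModule G₀ G₁) [Ψ.IsLie I₀ I₁] {E H M : Type*} [NormedAddCommGroup E] [NormedSpace ℝ E] [TopologicalSpace H]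
    {I : ModelWithCorners ℝ E H} [TopologicalSpace M] [ChartedSpace H M] {f : M → G₁}
    (hf : ContMDiff I I₁ ω f) : ContMDiff I I₀ ω fun x => Ψ.hom (f x) :=
  (IsLie.hom_analytic (I₀ := I₀) (I₁ := I₁) (Ψ := Ψ)).comp hf

theorem κ_comp_analytic (p : WeakEnd I₀ I₁ Ψ) {E H M : Type*} [NormedAddCommGroup E]
    [NormedSpace ℝ E] [TopologicalSpace H]
    {I : ModelWithCorners ℝ E H} [TopologicalSpace M] [ChartedSpace H M] {f g : M → G₀}
    (hf : ContMDiff I I₀ ω f) (hg : ContMDiff I I₀ ω g) :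
    ContMDiff I I₁ ω fun x => p.κ (f x) (g x) :=
  p.analyticκ.comp (hf.prodMk hg)

variable [Ψ.IsLie I₀ I₁]

/-- Horizontal composition of weak endomorphisms, `(f, κ)(g, γ) = (f ∘ g, β)` with
`β_{x,y} = f₁(γ_{x,y}) κ_{g₀ x, g₀ y, ψ(γ_{x,y})}`, where `κ_{x,y,z} = κ_{y,z} κ_{x,yz}`. -/
def comp (f g : WeakEnd I₀ I₁ Ψ) : WeakEnd I₀ I₁ Ψ :=
  have key : ∀ x y, f.map₁ (g.κ x y) * (f.κ (g.map₀ y) (Ψ.hom (g.κ x y)) *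
      f.κ (g.map₀ x) (g.map₀ y * Ψ.hom (g.κ x y))) =
      f.κ (g.map₀ x) (g.map₀ y) * f.arrow (g.map₀ x * g.map₀ y) (g.κ x y) := fun x y => by
    rw [f.κ_mul_arrow_right, arrow, mul_assoc]
  { map₀ := fun x => f.map₀ (g.map₀ x)
    map₁ := fun a => f.map₁ (g.map₁ a)
    κ := fun x y => f.map₁ (g.κ x y) * (f.κ (g.map₀ y) (Ψ.hom (g.κ x y)) *
      f.κ (g.map₀ x) (g.map₀ y * Ψ.hom (g.κ x y)))
    analytic₀ := f.analytic₀.comp g.analytic₀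
    analytic₁ := f.analytic₁.comp g.analytic₁
    analyticκ := by
      have h1 : ContMDiff (I₀.prod I₀) I₀ ω fun p : G₀ × G₀ => g.map₀ p.1 :=
        g.analytic₀.comp contMDiff_fst
      have h2 : ContMDiff (I₀.prod I₀) I₀ ω fun p : G₀ × G₀ => g.map₀ p.2 :=
        g.analytic₀.comp contMDiff_snd
      have h3 := analytic_hom I₀ I₁ Ψ g.analyticκ
      exact analytic_mul₁ I₀ I₁ Ψ (f.analytic₁.comp g.analyticκ)
        (analytic_mul₁ I₀ I₁ Ψ (f.κ_comp_analytic h2 h3)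
          (f.κ_comp_analytic h1 (analytic_mul₀ I₀ I₁ Ψ h2 h3)))
    one₀ := by rw [g.one₀, f.one₀]
    one₁ := by rw [g.one₁, f.one₁]
    w1 := fun a => by rw [g.w1, f.w1]
    w2 := fun x y => by
      rw [key, map_mul, ← mul_assoc, f.w2, ← f.map₀_mul_hom, g.w2]
    w3 := fun a b => by
      rw [key, ← g.w3, ← f.w3, ← f.w3, ← mul_assoc, g.w1, g.w1, arrow, map_mul]
      group
    w4 := fun x y z => by
      simp only [key]
      rw [Ψ.mul_act, mul_assoc, ← mul_assoc (Ψ.act (f.arrow _ _) _), ]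
      have e1 := f.κ_mul_arrow_left (g.map₀ x * g.map₀ y) (g.map₀ z) (g.κ x y)
      have e2 := f.κ_mul_arrow_right (g.map₀ x) (g.map₀ y * g.map₀ z) (g.κ y z)
      have a1 := f.arrow_mul (g.map₀ x * g.map₀ y * g.map₀ z) (Ψ.act (g.κ x y) (g.map₀ z))
        (g.κ (x * y) z)
      have a2 := f.arrow_mul (g.map₀ x * (g.map₀ y * g.map₀ z)) (g.κ y z) (g.κ x (y * z))
      have b1 : g.map₀ x * g.map₀ y * g.map₀ z * Ψ.hom (Ψ.act (g.κ x y) (g.map₀ z)) =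
          g.map₀ (x * y) * g.map₀ z := by
        rw [Ψ.hom_act, ← g.w2]; group
      have b2 : g.map₀ x * (g.map₀ y * g.map₀ z) * Ψ.hom (g.κ y z) =
          g.map₀ x * g.map₀ (y * z) := by
        rw [← g.w2 y z]; group
      rw [b1] at a1
      rw [b2] at a2
      rw [g.w2] at e1 e2
      rw [← e1, mul_assoc (f.κ (g.map₀ x * g.map₀ y) _), ← a1, ← mul_assoc, f.w4, g.w4,
        mul_assoc _ _ (f.κ (g.map₀ x) _ * _), ← mul_assoc _ (f.κ (g.map₀ x) _), ← e2,
        mul_assoc (f.κ (g.map₀ x) _), ← a2]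
      simp only [mul_assoc]
    w5 := fun a x => by
      simp only [key]
      have a1 := f.arrow_mul (g.map₀ x) (Ψ.act (g.map₁ a) (g.map₀ x)) (g.κ (Ψ.hom a) x)
      have a2 := f.arrow_mul (g.map₀ x) (g.map₁ (Ψ.act a x)) (g.κ x (Ψ.hom (Ψ.act a x)))
      have b1 : g.map₀ x * Ψ.hom (Ψ.act (g.map₁ a) (g.map₀ x)) = g.map₀ (Ψ.hom a) * g.map₀ x := by
        rw [Ψ.hom_act, g.w1]; group
      have e : ∀ c y, f.map₁ c * (f.κ y (Ψ.hom c)) = f.arrow y c := fun _ _ => rfl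
      rw [b1] at a1
      rw [← mul_assoc, ← mul_assoc, g.w1 (Ψ.act a x), e, ← a2, ← g.w5, a1, ← f.act_map₁, g.w1] }

@[simp] theorem comp_map₀ (f g : WeakEnd I₀ I₁ Ψ) (x : G₀) :
    (comp f g).map₀ x = f.map₀ (g.map₀ x) := rfl

@[simp] theorem comp_map₁ (f g : WeakEnd I₀ I₁ Ψ) (a : G₁) :
    (comp f g).map₁ a = f.map₁ (g.map₁ a) := rfl

theorem comp_κ (f g : WeakEnd I₀ I₁ Ψ) (x y : G₀) :
    (comp f g).κ x y =
      f.κ (g.map₀ x) (g.map₀ y) * f.arrow (g.map₀ x * g.map₀ y) (g.κ x y) := by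
  rw [f.κ_mul_arrow_right, arrow, mul_assoc]; rfl

theorem comp_arrow (f g : WeakEnd I₀ I₁ Ψ) (y : G₀) (b : G₁) :
    (comp f g).arrow y b = f.arrow (g.map₀ y) (g.arrow y b) := by
  have a := f.arrow_mul (g.map₀ y) (g.map₁ b) (g.κ y (Ψ.hom b))
  rw [← g.w1] at a
  have e : g.arrow y b = g.map₁ b * g.κ y (Ψ.hom b) := rfl
  rw [e, a]
  conv_lhs => rw [arrow, comp_κ, comp_map₁, ← mul_assoc]
  congr 1
  rw [arrow, ← g.w1]

variable (I₀ I₁ Ψ) in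
/-- The identity weak endomorphism. -/
protected def id : WeakEnd I₀ I₁ Ψ where
  map₀ x := x
  map₁ a := a
  κ _ _ := 1
  analytic₀ := contMDiff_id
  analytic₁ := contMDiff_id
  analyticκ := contMDiff_const
  one₀ := rfl
  one₁ := rfl
  w1 _ := rfl
  w2 x y := by simp
  w3 a b := by simp
  w4 x y z := by simp
  w5 a x := by simp

/-- Weak endomorphisms form a monoid under horizontal composition. -/
instance : Monoid (WeakEnd I₀ I₁ Ψ) where
  mul := comp
  one := WeakEnd.id I₀ I₁ Ψ
  mul_assoc f g h := by
    refine WeakEnd.ext rfl rfl (funext fun x => funext fun y => ?_)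
    change (comp (comp f g) h).κ x y = (comp f (comp g h)).κ x y
    rw [comp_κ, comp_κ, comp_κ, comp_κ, comp_arrow, arrow_mul, comp_map₀,
      comp_map₀, g.w2, mul_assoc]
  one_mul f := by
    refine WeakEnd.ext rfl rfl (funext fun x => funext fun y => ?_)
    change (comp (WeakEnd.id I₀ I₁ Ψ) f).κ x y = f.κ x y
    rw [comp_κ]
    simp [WeakEnd.id, arrow]
  mul_one f := by
    refine WeakEnd.ext rfl rfl (funext fun x => funext fun y => ?_)
    change (comp f (WeakEnd.id I₀ I₁ Ψ)).κ x y = f.κ x y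
    rw [comp_κ]
    simp [WeakEnd.id]

@[simp] theorem one_map₀ (x : G₀) : (1 : WeakEnd I₀ I₁ Ψ).map₀ x = x := rfl
@[simp] theorem one_map₁ (a : G₁) : (1 : WeakEnd I₀ I₁ Ψ).map₁ a = a := rfl
@[simp] theorem one_κ (x y : G₀) : (1 : WeakEnd I₀ I₁ Ψ).κ x y = 1 := rfl
@[simp] theorem one_arrow (x : G₀) (a : G₁) : (1 : WeakEnd I₀ I₁ Ψ).arrow x a = a := by
  simp [arrow]
@[simp] theorem mul_map₀ (f g : WeakEnd I₀ I₁ Ψ) (x : G₀) :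
    (f * g).map₀ x = f.map₀ (g.map₀ x) := rfl
@[simp] theorem mul_map₁ (f g : WeakEnd I₀ I₁ Ψ) (a : G₁) :
    (f * g).map₁ a = f.map₁ (g.map₁ a) := rfl
theorem mul_κ (f g : WeakEnd I₀ I₁ Ψ) (x y : G₀) :
    (f * g).κ x y = f.κ (g.map₀ x) (g.map₀ y) * f.arrow (g.map₀ x * g.map₀ y) (g.κ x y) :=
  comp_κ f g x y
theorem mul_arrow (f g : WeakEnd I₀ I₁ Ψ) (y : G₀) (b : G₁) :
    (f * g).arrow y b = f.arrow (g.map₀ y) (g.arrow y b) := comp_arrow f g y b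

theorem arrow_analytic (p : WeakEnd I₀ I₁ Ψ) {E H M : Type*} [NormedAddCommGroup E]
    [NormedSpace ℝ E] [TopologicalSpace H]
    {I : ModelWithCorners ℝ E H} [TopologicalSpace M] [ChartedSpace H M] {f : M → G₀} {g : M → G₁}
    (hf : ContMDiff I I₀ ω f) (hg : ContMDiff I I₁ ω g) :
    ContMDiff I I₁ ω fun x => p.arrow (f x) (g x) :=
  analytic_mul₁ I₀ I₁ Ψ (p.analytic₁.comp hg) (p.κ_comp_analytic hf (analytic_hom I₀ I₁ Ψ hg))

section Units

variable (φ : (WeakEnd I₀ I₁ Ψ)ˣ)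

@[simp] theorem inv_map₀_map₀ (x : G₀) : φ⁻¹.val.map₀ (φ.val.map₀ x) = x := by
  rw [← mul_map₀, Units.inv_mul, one_map₀]

@[simp] theorem map₀_inv_map₀ (x : G₀) : φ.val.map₀ (φ⁻¹.val.map₀ x) = x := by
  rw [← mul_map₀, Units.mul_inv, one_map₀]

@[simp] theorem inv_map₁_map₁ (a : G₁) : φ⁻¹.val.map₁ (φ.val.map₁ a) = a := by
  rw [← mul_map₁, Units.inv_mul, one_map₁]

@[simp] theorem map₁_inv_map₁ (a : G₁) : φ.val.map₁ (φ⁻¹.val.map₁ a) = a := by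
  rw [← mul_map₁, Units.mul_inv, one_map₁]

theorem arrow_inv_arrow (y : G₀) (b : G₁) :
    φ.val.arrow y (φ⁻¹.val.arrow (φ.val.map₀ y) b) = b := by
  have := mul_arrow φ.val φ⁻¹.val (φ.val.map₀ y) b
  rw [Units.mul_inv, one_arrow, inv_map₀_map₀] at this
  exact this.symm

end Units

end WeakEnd

/-- Pointed analytic maps `G₀ → G₁`. -/
@[ext] structure PointedMap (Ψ : CrossedModule G₀ G₁) where
  toFun : G₀ → G₁
  analytic : ContMDiff I₀ I₁ ω toFun
  map_one : toFun 1 = 1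

namespace PointedMap

variable {I₀ I₁ Ψ}
variable [Ψ.IsLie I₀ I₁]

/-- The composition rule `(χ₁ ∘ χ₂)(x) = χ₂(x) χ₁(x ψ(χ₂(x)))`. -/
instance : Monoid (PointedMap I₀ I₁ Ψ) where
  mul c d :=
    { toFun := fun x => d.toFun x * c.toFun (x * Ψ.hom (d.toFun x))
      analytic := WeakEnd.analytic_mul₁ I₀ I₁ Ψ d.analytic (c.analytic.comp
        (WeakEnd.analytic_mul₀ I₀ I₁ Ψ contMDiff_id (WeakEnd.analytic_hom I₀ I₁ Ψ d.analytic)))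
      map_one := by simp [c.map_one, d.map_one] }
  one := { toFun := fun _ => 1, analytic := contMDiff_const, map_one := rfl }
  mul_assoc c d e := PointedMap.ext (funext fun x => by
    change e.toFun x * (d.toFun (x * Ψ.hom (e.toFun x)) * c.toFun (x * Ψ.hom (e.toFun x) *
      Ψ.hom (d.toFun (x * Ψ.hom (e.toFun x))))) = e.toFun x * d.toFun (x * Ψ.hom (e.toFun x)) *
      c.toFun (x * Ψ.hom (e.toFun x * d.toFun (x * Ψ.hom (e.toFun x))))
    rw [map_mul]; simp only [mul_assoc])
  one_mul c := PointedMap.ext (funext fun x => mul_one (c.toFun x))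
  mul_one c := PointedMap.ext (funext fun x => by
    change 1 * c.toFun (x * Ψ.hom 1) = c.toFun x
    simp)

theorem mul_apply (c d : PointedMap I₀ I₁ Ψ) (x : G₀) :
    (c * d).toFun x = d.toFun x * c.toFun (x * Ψ.hom (d.toFun x)) := rfl

@[simp] theorem one_apply (x : G₀) : (1 : PointedMap I₀ I₁ Ψ).toFun x = 1 := rfl

/-- The weak endomorphism `δ(η)`. -/
def deltaFun (η : PointedMap I₀ I₁ Ψ) : WeakEnd I₀ I₁ Ψ where
  map₀ x := x * Ψ.hom (η.toFun x)
  map₁ a := a * η.toFun (Ψ.hom a)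
  κ x y := (η.toFun y)⁻¹ * (Ψ.act (η.toFun x) y)⁻¹ * η.toFun (x * y)
  analytic₀ := WeakEnd.analytic_mul₀ I₀ I₁ Ψ contMDiff_id (WeakEnd.analytic_hom I₀ I₁ Ψ η.analytic)
  analytic₁ := WeakEnd.analytic_mul₁ I₀ I₁ Ψ contMDiff_id
    (η.analytic.comp (WeakEnd.analytic_hom I₀ I₁ Ψ contMDiff_id))
  analyticκ := WeakEnd.analytic_mul₁ I₀ I₁ Ψ (WeakEnd.analytic_mul₁ I₀ I₁ Ψ
      (WeakEnd.analytic_inv₁ I₀ I₁ Ψ (η.analytic.comp contMDiff_snd))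
      (WeakEnd.analytic_inv₁ I₀ I₁ Ψ (WeakEnd.analytic_act I₀ I₁ Ψ
        (η.analytic.comp contMDiff_fst) contMDiff_snd)))
    (η.analytic.comp (WeakEnd.analytic_mul₀ I₀ I₁ Ψ contMDiff_fst contMDiff_snd))
  one₀ := by simp [η.map_one]
  one₁ := by simp [η.map_one]
  w1 a := by simp
  w2 x y := by
    simp only [map_mul, map_inv, Ψ.hom_act]; group
  w3 a b := by
    simp only [map_mul, Ψ.peiffer]; group
  w4 x y z := by
    simp only [Ψ.act_mul, Ψ.peiffer, Ψ.mul_act, Ψ.inv_act, mul_assoc]; group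
  w5 a x := by
    have e : x * Ψ.hom (Ψ.act a x) = Ψ.hom a * x := by rw [Ψ.hom_act]; group
    rw [e]
    simp only [Ψ.act_mul, Ψ.peiffer, Ψ.mul_act, mul_assoc]; group

theorem mul_deltaFun_arrow (η : PointedMap I₀ I₁ Ψ) (y : G₀) (b : G₁) :
    η.deltaFun.arrow y b = (η.toFun y)⁻¹ * b * η.toFun (y * Ψ.hom b) := by
  simp only [WeakEnd.arrow, deltaFun, Ψ.peiffer]; group

/-- The components of `δ(η) ∘ g`: it is obtained from `g` by the monoidal transformation
`θ = η ∘ g₀`. -/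
theorem deltaFun_mul_κ (η : PointedMap I₀ I₁ Ψ) (g : WeakEnd I₀ I₁ Ψ) (y z : G₀) :
    (η.deltaFun * g).κ y z = (η.toFun (g.map₀ z))⁻¹ *
      (Ψ.act (η.toFun (g.map₀ y)) (g.map₀ z))⁻¹ * g.κ y z * η.toFun (g.map₀ (y * z)) := by
  rw [WeakEnd.mul_κ, mul_deltaFun_arrow, g.w2]
  simp only [deltaFun]; group

variable (I₀ I₁ Ψ) in
/-- `η ↦ δ(η)` is a homomorphism. -/
def delta : PointedMap I₀ I₁ Ψ →* WeakEnd I₀ I₁ Ψ where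
  toFun := deltaFun
  map_one' := by
    refine WeakEnd.ext ?_ ?_ ?_ <;> funext x <;> simp [deltaFun]
    rfl
  map_mul' c d := by
    refine WeakEnd.ext ?_ ?_ ?_
    · funext x
      simp only [deltaFun, mul_apply, WeakEnd.mul_map₀, map_mul, mul_assoc]
    · funext a
      simp only [deltaFun, mul_apply, WeakEnd.mul_map₁, map_mul, mul_assoc]
    · funext x y
      rw [deltaFun_mul_κ]
      simp only [deltaFun, mul_apply, Ψ.act_mul, Ψ.mul_act, Ψ.peiffer, mul_inv_rev]
      group

/-- The action of an invertible weak endomorphism `φ = (f, κ)` on pointed maps,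
`η^φ(x) = f₁⁻¹(η(f₀ x)) γ_{f₀ x, ψ(η(f₀ x))}` where `φ⁻¹ = (f⁻¹, γ)`. -/
def actHom (φ : (WeakEnd I₀ I₁ Ψ)ˣ) : PointedMap I₀ I₁ Ψ →* PointedMap I₀ I₁ Ψ where
  toFun η :=
    { toFun := fun x => φ⁻¹.val.map₁ (η.toFun (φ.val.map₀ x)) *
        φ⁻¹.val.κ (φ.val.map₀ x) (Ψ.hom (η.toFun (φ.val.map₀ x)))
      analytic := φ⁻¹.val.arrow_analytic φ.val.analytic₀ (η.analytic.comp φ.val.analytic₀)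
      map_one := by simp [φ.val.one₀, η.map_one, φ⁻¹.val.one₁, φ⁻¹.val.κ_one_one] }
  map_one' := PointedMap.ext (funext fun x => φ⁻¹.val.arrow_one _)
  map_mul' c d := PointedMap.ext (funext fun x => by
    change φ⁻¹.val.arrow (φ.val.map₀ x) ((c * d).toFun (φ.val.map₀ x)) =
      φ⁻¹.val.arrow (φ.val.map₀ x) (d.toFun (φ.val.map₀ x)) *
      φ⁻¹.val.arrow (φ.val.map₀ (x * Ψ.hom (φ⁻¹.val.arrow (φ.val.map₀ x) (d.toFun (φ.val.map₀ x)))))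
        (c.toFun (φ.val.map₀ (x * Ψ.hom (φ⁻¹.val.arrow (φ.val.map₀ x) (d.toFun (φ.val.map₀ x))))))
    rw [φ.val.map₀_mul_hom, WeakEnd.arrow_inv_arrow, mul_apply, WeakEnd.arrow_mul])

theorem actHom_apply (φ : (WeakEnd I₀ I₁ Ψ)ˣ) (η : PointedMap I₀ I₁ Ψ) (x : G₀) :
    (actHom φ η).toFun x = φ⁻¹.val.arrow (φ.val.map₀ x) (η.toFun (φ.val.map₀ x)) := rfl

theorem arrow_actHom (φ : (WeakEnd I₀ I₁ Ψ)ˣ) (η : PointedMap I₀ I₁ Ψ) (x : G₀) :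
    φ.val.arrow x ((actHom φ η).toFun x) = η.toFun (φ.val.map₀ x) := by
  rw [actHom_apply, WeakEnd.arrow_inv_arrow]

theorem actHom_one (η : PointedMap I₀ I₁ Ψ) : actHom 1 η = η :=
  PointedMap.ext (funext fun x => by rw [actHom_apply]; simp)

theorem actHom_mul (φ φ' : (WeakEnd I₀ I₁ Ψ)ˣ) (η : PointedMap I₀ I₁ Ψ) :
    actHom (φ * φ') η = actHom φ' (actHom φ η) :=
  PointedMap.ext (funext fun x => by
    simp only [actHom_apply]
    rw [mul_inv_rev, Units.val_mul, Units.val_mul, WeakEnd.mul_arrow, WeakEnd.mul_map₀,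
      WeakEnd.inv_map₀_map₀])

/-- `φ ∘ δ(η^φ) = δ(η) ∘ φ`. -/
theorem mul_delta_actHom (φ : (WeakEnd I₀ I₁ Ψ)ˣ) (η : PointedMap I₀ I₁ Ψ) :
    φ.val * delta I₀ I₁ Ψ (actHom φ η) = delta I₀ I₁ Ψ η * φ.val := by
  set χ := actHom φ η with hχ
  have hθ : ∀ x, φ.val.arrow x (χ.toFun x) = η.toFun (φ.val.map₀ x) := arrow_actHom φ η
  refine WeakEnd.ext ?_ ?_ ?_
  · funext x
    change φ.val.map₀ (x * Ψ.hom (χ.toFun x)) = φ.val.map₀ x * Ψ.hom (η.toFun (φ.val.map₀ x))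
    rw [φ.val.map₀_mul_hom, hθ]
  · funext a
    change φ.val.map₁ (a * χ.toFun (Ψ.hom a)) = φ.val.map₁ a * η.toFun (Ψ.hom (φ.val.map₁ a))
    rw [← φ.val.w1, ← hθ, ← φ.val.w3, WeakEnd.arrow, mul_assoc]
  · funext y z
    change _ = (η.deltaFun * φ.val).κ y z
    rw [deltaFun_mul_κ, ← hθ, ← hθ, ← hθ, WeakEnd.mul_κ]
    change φ.val.κ (y * Ψ.hom (χ.toFun y)) (z * Ψ.hom (χ.toFun z)) *
      φ.val.arrow (y * Ψ.hom (χ.toFun y) * (z * Ψ.hom (χ.toFun z))) (χ.deltaFun.κ y z) = _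
    have hC : χ.toFun (y * z) = Ψ.act (χ.toFun y) z * (χ.toFun z * χ.deltaFun.κ y z) := by
      simp only [deltaFun]; group
    have e1 : y * z * Ψ.hom (Ψ.act (χ.toFun y) z) = y * Ψ.hom (χ.toFun y) * z := by
      rw [Ψ.hom_act]; group
    have h1 := φ.val.κ_mul_arrow_left y z (χ.toFun y)
    have h2 := φ.val.κ_mul_arrow_right (y * Ψ.hom (χ.toFun y)) z (χ.toFun z)
    rw [hC, φ.val.arrow_mul, e1, φ.val.arrow_mul, mul_assoc _ (φ.val.κ y z),
      ← mul_assoc (φ.val.κ y z), h1, mul_assoc _ (φ.val.κ _ z), ← mul_assoc (φ.val.κ _ z), h2,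
      mul_assoc (y * Ψ.hom (χ.toFun y))]
    group

end PointedMap
section WeakActor

variable [Ψ.IsLie I₀ I₁]

/-- The group `wAct⁺(Ψ)₀` of invertible weak endomorphisms whose restriction to `π₁` is the
identity. -/
def wActPlus₀ : Subgroup (WeakEnd I₀ I₁ Ψ)ˣ where
  carrier := {φ | ∀ a, Ψ.hom a = 1 → φ.val.map₁ a = a}
  one_mem' a _ := rfl
  mul_mem' {φ φ'} h h' a ha := by
    rw [Units.val_mul, WeakEnd.mul_map₁, h' a ha, h a ha]
  inv_mem' {φ} h a ha := by
    conv_lhs => rw [← h a ha]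
    exact WeakEnd.inv_map₁_map₁ φ a

variable {I₀ I₁ Ψ} in
theorem delta_mem (η : (PointedMap I₀ I₁ Ψ)ˣ) :
    Units.map (PointedMap.delta I₀ I₁ Ψ) η ∈ wActPlus₀ I₀ I₁ Ψ := fun a ha => by
  change a * η.val.toFun (Ψ.hom a) = a
  rw [ha, η.val.map_one, mul_one]

/-- The crossed module `wAct⁺(Ψ)` of centre-preserving weak automorphisms; the associated strict
categorical group is `𝒜ut⁺(𝒮(Ψ))`. -/
def wActPlus : CrossedModule (wActPlus₀ I₀ I₁ Ψ) (PointedMap I₀ I₁ Ψ)ˣ where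
  hom := (Units.map (PointedMap.delta I₀ I₁ Ψ)).codRestrict _ delta_mem
  act η φ := Units.map (PointedMap.actHom φ.val) η
  act_one η := Units.ext (PointedMap.actHom_one _)
  act_mul η φ φ' := Units.ext (PointedMap.actHom_mul _ _ _)
  mul_act η χ φ := map_mul _ _ _
  hom_act η φ := by
    rw [mul_assoc, eq_inv_mul_iff_mul_eq]
    exact Subtype.ext (Units.ext (PointedMap.mul_delta_actHom φ.val η.val))
  peiffer χ η := by
    rw [mul_assoc, eq_inv_mul_iff_mul_eq]
    refine Units.ext (PointedMap.ext (funext fun x => ?_))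
    have h := PointedMap.arrow_actHom (Units.map (PointedMap.delta I₀ I₁ Ψ) η) χ.val x
    change η.val.deltaFun.arrow x _ = χ.val.toFun (x * Ψ.hom (η.val.toFun x)) at h
    rw [PointedMap.mul_deltaFun_arrow] at h
    change (PointedMap.actHom (Units.map (PointedMap.delta I₀ I₁ Ψ) η) χ.val).toFun x *
      η.val.toFun (x * Ψ.hom
        ((PointedMap.actHom (Units.map (PointedMap.delta I₀ I₁ Ψ) η) χ.val).toFun x)) = η.val.toFun x * χ.val.toFun (x * Ψ.hom (η.val.toFun x))
    rw [← h]; group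

/-- Conjugation by `x`, as a (strict) weak endomorphism: `y ↦ x y x⁻¹` and `a ↦ a ^ (x⁻¹)`. -/
def adFun (x : G₀) : WeakEnd I₀ I₁ Ψ where
  map₀ y := x * y * x⁻¹
  map₁ a := Ψ.act a x⁻¹
  κ _ _ := 1
  analytic₀ := WeakEnd.analytic_mul₀ I₀ I₁ Ψ
    (WeakEnd.analytic_mul₀ I₀ I₁ Ψ contMDiff_const contMDiff_id) contMDiff_const
  analytic₁ := WeakEnd.analytic_act I₀ I₁ Ψ contMDiff_id contMDiff_const
  analyticκ := contMDiff_const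
  one₀ := by group
  one₁ := Ψ.one_act _
  w1 a := by rw [Ψ.hom_act, inv_inv]
  w2 y z := by simp
  w3 a b := by simp [Ψ.mul_act]
  w4 y z w := by simp
  w5 a y := by simp only [mul_one, ← Ψ.act_mul]; group

/-- `x ↦ Ad₀(x)` as a homomorphism to the group of invertible weak endomorphisms. -/
def adHom : G₀ →* (WeakEnd I₀ I₁ Ψ)ˣ :=
  MonoidHom.toHomUnits
    { toFun := adFun I₀ I₁ Ψ
      map_one' := by
        refine WeakEnd.ext (funext fun x => ?_) (funext fun a => ?_) rfl
        · simp [adFun]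
        · simp [adFun, Ψ.act_one]
      map_mul' := fun x y => by
        refine WeakEnd.ext (funext fun z => ?_) (funext fun a => ?_)
          (funext fun z => funext fun w => ?_)
        · simp only [adFun, WeakEnd.mul_map₀]; group
        · simp only [adFun, WeakEnd.mul_map₁, mul_inv_rev, Ψ.act_mul]
        · rw [WeakEnd.mul_κ]
          simp [adFun, WeakEnd.arrow] }

/-- `Ad₁(a)`: the map `x ↦ a ^ x * a⁻¹`. -/
def adPointed : G₁ →* (PointedMap I₀ I₁ Ψ)ˣ :=
  MonoidHom.toHomUnits
    { toFun := fun a =>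
        { toFun := fun x => Ψ.act a x * a⁻¹
          analytic := WeakEnd.analytic_mul₁ I₀ I₁ Ψ
            (WeakEnd.analytic_act I₀ I₁ Ψ contMDiff_const contMDiff_id) contMDiff_const
          map_one := by rw [Ψ.act_one, mul_inv_cancel] }
      map_one' := PointedMap.ext (funext fun x => by simp)
      map_mul' := fun a b => PointedMap.ext (funext fun x => by
        rw [PointedMap.mul_apply]
        have e : x * Ψ.hom (Ψ.act b x * b⁻¹) = Ψ.hom b * x * Ψ.hom b⁻¹ := by
          rw [map_mul, Ψ.hom_act]; group
        simp only [e, Ψ.act_mul, Ψ.peiffer, Ψ.mul_act, Ψ.inv_act]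
        group) }

variable {I₀ I₁ Ψ} in
/-- A pointed map `η` for which `δ(η)` is invertible is itself invertible. -/
def unitOfDelta (η : PointedMap I₀ I₁ Ψ) (φ : (WeakEnd I₀ I₁ Ψ)ˣ) (h : φ.val = η.deltaFun) :
    (PointedMap I₀ I₁ Ψ)ˣ :=
  have h₀ : ∀ y, φ.val.map₀ y = y * Ψ.hom (η.toFun y) := fun y => by rw [h]; rfl
  { val := η
    inv :=
      { toFun := fun x => (η.toFun (φ⁻¹.val.map₀ x))⁻¹
        analytic := WeakEnd.analytic_inv₁ I₀ I₁ Ψ (η.analytic.comp φ⁻¹.val.analytic₀)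
        map_one := by rw [φ⁻¹.val.one₀, η.map_one, inv_one] }
    val_inv := PointedMap.ext (funext fun x => by
      have e : x * Ψ.hom (η.toFun (φ⁻¹.val.map₀ x))⁻¹ = φ⁻¹.val.map₀ x := by
        have := h₀ (φ⁻¹.val.map₀ x)
        rw [WeakEnd.map₀_inv_map₀] at this
        rw [map_inv, mul_inv_eq_iff_eq_mul]
        exact this
      rw [PointedMap.mul_apply]
      simp only [e, inv_mul_cancel, PointedMap.one_apply])
    inv_val := PointedMap.ext (funext fun x => by
      rw [PointedMap.mul_apply]
      simp only [← h₀, WeakEnd.inv_map₀_map₀, mul_inv_cancel, PointedMap.one_apply]) }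

variable {I₀ I₁ Ψ} in
/-- For `φ = (f, κ)` and an object `x`, the pointed map `η` with
`φ ∘ Ad(x) = δ(η) ∘ Ad(f₀ x) ∘ φ`. -/
def adTwist (φ : (WeakEnd I₀ I₁ Ψ)ˣ) (x : G₀) : PointedMap I₀ I₁ Ψ :=
  have hg : ContMDiff I₀ I₀ ω fun y : G₀ =>
      φ⁻¹.val.map₀ ((φ.val.map₀ x)⁻¹ * y * φ.val.map₀ x) :=
    φ⁻¹.val.analytic₀.comp (WeakEnd.analytic_mul₀ I₀ I₁ Ψ
      (WeakEnd.analytic_mul₀ I₀ I₁ Ψ contMDiff_const contMDiff_id) contMDiff_const)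
  { toFun := fun y =>
      Ψ.act (φ.val.κ x (φ⁻¹.val.map₀ ((φ.val.map₀ x)⁻¹ * y * φ.val.map₀ x)) *
        (φ.val.κ (x * φ⁻¹.val.map₀ ((φ.val.map₀ x)⁻¹ * y * φ.val.map₀ x) * x⁻¹) x)⁻¹)
        (φ.val.map₀ x)⁻¹
    analytic := WeakEnd.analytic_act I₀ I₁ Ψ
      (WeakEnd.analytic_mul₁ I₀ I₁ Ψ (φ.val.κ_comp_analytic contMDiff_const hg)
        (WeakEnd.analytic_inv₁ I₀ I₁ Ψ (φ.val.κ_comp_analytic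
          (WeakEnd.analytic_mul₀ I₀ I₁ Ψ
            (WeakEnd.analytic_mul₀ I₀ I₁ Ψ contMDiff_const hg) contMDiff_const)
          contMDiff_const))) contMDiff_const
    map_one := by
      simp [φ⁻¹.val.one₀, φ.val.κ_one_right, φ.val.κ_one_left] }

theorem mul_adHom (φ : (WeakEnd I₀ I₁ Ψ)ˣ) (x : G₀) :
    φ.val * (adHom I₀ I₁ Ψ x).val =
      (adTwist φ x).deltaFun * ((adHom I₀ I₁ Ψ (φ.val.map₀ x)).val * φ.val) := by
  set u := φ.val.map₀ x with hu
  have hθ : ∀ y, (adTwist φ x).toFun (u * φ.val.map₀ y * u⁻¹) =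
      Ψ.act (φ.val.κ x y * (φ.val.κ (x * y * x⁻¹) x)⁻¹) u⁻¹ := fun y => by
    have e : φ⁻¹.val.map₀ (u⁻¹ * (u * φ.val.map₀ y * u⁻¹) * u) = y := by
      have : u⁻¹ * (u * φ.val.map₀ y * u⁻¹) * u = φ.val.map₀ y := by group
      rw [this, WeakEnd.inv_map₀_map₀]
    simp only [adTwist, ← hu, e]
  refine WeakEnd.ext (funext fun y => ?_) (funext fun a => ?_)
    (funext fun y => funext fun z => ?_)
  · change φ.val.map₀ (x * y * x⁻¹) = u * φ.val.map₀ y * u⁻¹ *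
      Ψ.hom ((adTwist φ x).toFun (u * φ.val.map₀ y * u⁻¹))
    have h1 := φ.val.w2 (x * y * x⁻¹) x
    have h2 := φ.val.w2 x y
    rw [inv_mul_cancel_right, ← h2, ← hu] at h1
    rw [hθ, Ψ.hom_act, map_mul, map_inv, inv_inv]
    have h3 : φ.val.map₀ (x * y * x⁻¹) =
      u * φ.val.map₀ y * Ψ.hom (φ.val.κ x y) * (Ψ.hom (φ.val.κ (x * y * x⁻¹) x))⁻¹ * u⁻¹ := by
      rw [← h1]; group
    rw [h3]; group
  · change φ.val.map₁ (Ψ.act a x⁻¹) = Ψ.act (φ.val.map₁ a) u⁻¹ *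
      (adTwist φ x).toFun (Ψ.hom (Ψ.act (φ.val.map₁ a) u⁻¹))
    have e : Ψ.hom (Ψ.act (φ.val.map₁ a) u⁻¹) = u * φ.val.map₀ (Ψ.hom a) * u⁻¹ := by
      rw [Ψ.hom_act, φ.val.w1, inv_inv]
    have h5 := φ.val.w5 (Ψ.act a x⁻¹) x
    rw [Ψ.act_act_inv, Ψ.hom_act, inv_inv, ← hu] at h5
    rw [e, hθ, ← Ψ.mul_act]
    apply Ψ.act_injective u
    simp only
    rw [Ψ.act_act_inv, ← mul_assoc, ← h5]; group
  · rw [PointedMap.deltaFun_mul_κ, WeakEnd.mul_κ]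
    have e1 : φ.val.arrow ((adHom I₀ I₁ Ψ x).val.map₀ y * (adHom I₀ I₁ Ψ x).val.map₀ z)
        ((adHom I₀ I₁ Ψ x).val.κ y z) = 1 := φ.val.arrow_one _
    have e2 : ((adHom I₀ I₁ Ψ u).val * φ.val).κ y z = Ψ.act (φ.val.κ y z) u⁻¹ := by
      rw [WeakEnd.mul_κ]
      change 1 * (Ψ.act (φ.val.κ y z) u⁻¹ * 1) = _
      rw [one_mul, mul_one]
    have e3 : ∀ w, ((adHom I₀ I₁ Ψ u).val * φ.val).map₀ w = u * φ.val.map₀ w * u⁻¹ :=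
      fun _ => rfl
    have e4 : ∀ w, (adHom I₀ I₁ Ψ x).val.map₀ w = x * w * x⁻¹ := fun _ => rfl
    rw [e1, e2, e3, e3, e3, hθ, hθ, hθ, e4, e4, mul_one, ← Ψ.inv_act, ← Ψ.act_mul]
    apply Ψ.act_injective u
    simp only [Ψ.mul_act, Ψ.inv_act, ← Ψ.act_mul]
    have g1 : u⁻¹ * u = 1 := by group
    have g2 : u⁻¹ * (u * φ.val.map₀ z * u⁻¹) * u = φ.val.map₀ z := by group
    rw [g1, g2]
    simp only [Ψ.act_one]
    have w1 := φ.val.w4 x y z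
    have w2 := φ.val.w4 (x * y * x⁻¹) x z
    have w3 := φ.val.w4 (x * y * x⁻¹) (x * z * x⁻¹) x
    have g3 : x * y * x⁻¹ * x = x * y := by group
    have g4 : x * z * x⁻¹ * x = x * z := by group
    have g5 : x * y * x⁻¹ * (x * z * x⁻¹) = x * (y * z) * x⁻¹ := by group
    rw [g3] at w2
    rw [g4, g5, ← hu] at w3
    have w1' := eq_inv_mul_of_mul_eq w1
    have w3' := eq_mul_inv_of_mul_eq w3
    have w2' : φ.val.κ (x * y * x⁻¹) (x * z) = (φ.val.κ x z)⁻¹ *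
        (Ψ.act (φ.val.κ (x * y * x⁻¹) x) (φ.val.map₀ z) * φ.val.κ (x * y) z) := by
      rw [w2]; group
    rw [w3', w2', w1']
    group

variable [Ψ.IsCentral]

/-- `Ad⁺` on objects. -/
def adPlus : G₀ →* wActPlus₀ I₀ I₁ Ψ :=
  (adHom I₀ I₁ Ψ).codRestrict _ fun x a ha => IsCentral.act_eq a x⁻¹ ha

theorem adPlus_hom (a : G₁) :
    adPlus I₀ I₁ Ψ (Ψ.hom a) = (wActPlus I₀ I₁ Ψ).hom (adPointed I₀ I₁ Ψ a) := by
  refine Subtype.ext (Units.ext (WeakEnd.ext (funext fun x => ?_) (funext fun b => ?_)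
    (funext fun x => funext fun y => ?_)))
  · change Ψ.hom a * x * (Ψ.hom a)⁻¹ = x * Ψ.hom (Ψ.act a x * a⁻¹)
    rw [map_mul, Ψ.hom_act, map_inv]; group
  · change Ψ.act b (Ψ.hom a)⁻¹ = b * (Ψ.act a (Ψ.hom b) * a⁻¹)
    rw [← map_inv, Ψ.peiffer, Ψ.peiffer]; group
  · change 1 = (Ψ.act a y * a⁻¹)⁻¹ * (Ψ.act (Ψ.act a x * a⁻¹) y)⁻¹ * (Ψ.act a (x * y) * a⁻¹)
    rw [Ψ.mul_act, Ψ.act_mul, Ψ.inv_act]; group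

/-- `π₀(𝒜d⁺) : π₀(𝒢) → π₀(𝒜ut⁺(𝒢))`. -/
def pi0Ad : Ψ.Pi0 →* (wActPlus I₀ I₁ Ψ).Pi0 :=
  QuotientGroup.map _ _ (adPlus I₀ I₁ Ψ) (by
    rintro _ ⟨a, rfl⟩
    exact ⟨adPointed I₀ I₁ Ψ a, (adPlus_hom I₀ I₁ Ψ a).symm⟩)

instance normal_range_pi0Ad : (pi0Ad I₀ I₁ Ψ).range.Normal where
  conj_mem := by
    rintro _ ⟨c, rfl⟩ d
    obtain ⟨x, rfl⟩ := QuotientGroup.mk_surjective c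
    obtain ⟨φ, rfl⟩ := QuotientGroup.mk_surjective d
    refine ⟨Ψ.cls (φ.val.val.map₀ x), ?_⟩
    have h := mul_adHom I₀ I₁ Ψ φ.val x
    have h' : (φ.val * adHom I₀ I₁ Ψ x * (adHom I₀ I₁ Ψ (φ.val.val.map₀ x) * φ.val)⁻¹).val =
        (adTwist φ.val x).deltaFun := by
      rw [Units.val_mul, Units.val_mul, h, ← Units.val_mul, mul_assoc, ← Units.val_mul,
        mul_inv_cancel, Units.val_one, mul_one]
    have h'' : φ * adPlus I₀ I₁ Ψ x * (adPlus I₀ I₁ Ψ (φ.val.val.map₀ x) * φ)⁻¹ =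
        (wActPlus I₀ I₁ Ψ).hom (unitOfDelta _ _ h') := Subtype.ext (Units.ext h')
    change QuotientGroup.mk (adPlus I₀ I₁ Ψ (φ.val.val.map₀ x)) =
      QuotientGroup.mk' (wActPlus I₀ I₁ Ψ).hom.range (φ * adPlus I₀ I₁ Ψ x * φ⁻¹)
    refine (QuotientGroup.eq_iff_div_mem.mpr ?_).symm
    have e : φ * adPlus I₀ I₁ Ψ x * φ⁻¹ / adPlus I₀ I₁ Ψ (φ.val.val.map₀ x) =
        (wActPlus I₀ I₁ Ψ).hom (unitOfDelta _ _ h') := by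
      rw [← h'', div_eq_mul_inv]; group
    exact ⟨_, e.symm⟩

/-- The centre-preserving weak automorphisms which are isomorphic, as objects of `𝒜ut⁺(𝒢)`, to
`Ad(x)` for some object `x` of `𝒢`. -/
def innPlus : Subgroup (wActPlus₀ I₀ I₁ Ψ) :=
  (pi0Ad I₀ I₁ Ψ).range.comap (QuotientGroup.mk' _)

instance : (innPlus I₀ I₁ Ψ).Normal := Subgroup.Normal.comap inferInstance _

/-- `π₀(𝒪ut⁺(𝒢))`: isomorphism classes of objects of the cokernel of `𝒜d⁺ : 𝒢 → 𝒜ut⁺(𝒢)`. Its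
objects are the centre-preserving weak automorphisms, and `φ`, `φ'` are isomorphic if and only if
`φ'` is isomorphic to `Ad(x) ∘ φ` in `𝒜ut⁺(𝒢)` for some object `x` of `𝒢`. -/
abbrev OutPlusPi0 : Type _ := wActPlus₀ I₀ I₁ Ψ ⧸ innPlus I₀ I₁ Ψ

/-- `π₀(𝒜ut⁺(𝒢)) → π₀(𝒪ut⁺(𝒢))`. -/
def pi0Out : (wActPlus I₀ I₁ Ψ).Pi0 →* OutPlusPi0 I₀ I₁ Ψ :=
  QuotientGroup.map _ _ (MonoidHom.id _) fun φ hφ => by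
    rw [Subgroup.mem_comap, MonoidHom.id_apply, innPlus, Subgroup.mem_comap]
    have : QuotientGroup.mk' (wActPlus I₀ I₁ Ψ).hom.range φ = 1 := by
      rwa [← MonoidHom.mem_ker, QuotientGroup.ker_mk']
    rw [this]
    exact one_mem _

end WeakActor

section Centre

variable [Ψ.IsLie I₀ I₁]

/-- Objects of the centre: pairs `(x, ξ)` of an element of `G₀` and an analytic crossed homomorphism
`ξ : G₀ → G₁` such that `Ad₀(x⁻¹) = δ(ξ)`. -/
@[ext] structure CentreObj where
  pt : G₀
  ξ : G₀ → G₁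
  analytic : ContMDiff I₀ I₁ ω ξ
  crossed : ∀ s t, ξ (s * t) = Ψ.act (ξ s) t * ξ t
  conj₀ : ∀ z, pt⁻¹ * z * pt = z * Ψ.hom (ξ z)
  conj₁ : ∀ a, Ψ.act a pt = a * ξ (Ψ.hom a)

namespace CentreObj

variable {I₀ I₁ Ψ}

/-- `(x, ξ)(y, υ) = (x y, z ↦ υ(z) ξ(z) ^ y)`. -/
instance : Mul (CentreObj I₀ I₁ Ψ) where
  mul p q :=
    { pt := p.pt * q.pt
      ξ := fun z => q.ξ z * Ψ.act (p.ξ z) q.pt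
      analytic := WeakEnd.analytic_mul₁ I₀ I₁ Ψ q.analytic
        (WeakEnd.analytic_act I₀ I₁ Ψ p.analytic contMDiff_const)
      crossed := fun s t => by
        have h := Ψ.peiffer (Ψ.act (p.ξ s) (q.pt * t)) (q.ξ t)
        have e : Ψ.hom (q.ξ t) = t⁻¹ * (q.pt⁻¹ * t * q.pt) := by rw [q.conj₀]; group
        have e' : q.pt * t * (t⁻¹ * (q.pt⁻¹ * t * q.pt)) = t * q.pt := by group
        rw [← Ψ.act_mul, e, e'] at h
        rw [q.crossed, p.crossed, Ψ.mul_act, Ψ.mul_act, ← Ψ.act_mul, ← Ψ.act_mul, h]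
        group
      conj₀ := fun z => by
        rw [map_mul, Ψ.hom_act, ← mul_assoc z, ← q.conj₀]
        have : (p.pt * q.pt)⁻¹ * z * (p.pt * q.pt) = q.pt⁻¹ * (p.pt⁻¹ * z * p.pt) * q.pt := by group
        rw [this, p.conj₀]; group
      conj₁ := fun a => by
        rw [Ψ.act_mul, p.conj₁, Ψ.mul_act, q.conj₁, mul_assoc] }

instance : One (CentreObj I₀ I₁ Ψ) where
  one :=
    { pt := 1
      ξ := fun _ => 1
      analytic := contMDiff_const
      crossed := fun s t => by simp
      conj₀ := fun z => by simp
      conj₁ := fun a => by simp [Ψ.act_one] }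

instance : Inv (CentreObj I₀ I₁ Ψ) where
  inv p :=
    { pt := p.pt⁻¹
      ξ := fun z => (Ψ.act (p.ξ z) p.pt⁻¹)⁻¹
      analytic := WeakEnd.analytic_inv₁ I₀ I₁ Ψ
        (WeakEnd.analytic_act I₀ I₁ Ψ p.analytic contMDiff_const)
      crossed := fun s t => by
        have h := Ψ.peiffer (Ψ.act (p.ξ s) (p.pt⁻¹ * t * p.pt)) ((p.ξ t)⁻¹)
        have e : Ψ.hom ((p.ξ t)⁻¹) = p.pt⁻¹ * t⁻¹ * p.pt * t := by
          rw [map_inv, inv_eq_iff_mul_eq_one]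
          have : Ψ.hom (p.ξ t) = t⁻¹ * (p.pt⁻¹ * t * p.pt) := by rw [p.conj₀]; group
          rw [this]; group
        have e' : p.pt⁻¹ * t * p.pt * (p.pt⁻¹ * t⁻¹ * p.pt * t) = t := by group
        rw [← Ψ.act_mul, e, e', inv_inv] at h
        apply inv_injective
        apply Ψ.act_injective p.pt
        simp only [p.crossed, mul_inv_rev, inv_inv, Ψ.mul_act, Ψ.inv_act, ← Ψ.act_mul]
        rw [inv_mul_cancel_right, inv_mul_cancel, Ψ.act_one, h]
        group
      conj₀ := fun z => by
        rw [map_inv, Ψ.hom_act]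
        have : Ψ.hom (p.ξ z) = z⁻¹ * (p.pt⁻¹ * z * p.pt) := by rw [p.conj₀]; group
        rw [this]; group
      conj₁ := fun a => by
        rw [eq_mul_inv_iff_mul_eq, ← Ψ.mul_act, ← p.conj₁, Ψ.act_inv_act] }

@[simp] theorem mul_pt (p q : CentreObj I₀ I₁ Ψ) : (p * q).pt = p.pt * q.pt := rfl
@[simp] theorem mul_ξ (p q : CentreObj I₀ I₁ Ψ) (z : G₀) :
    (p * q).ξ z = q.ξ z * Ψ.act (p.ξ z) q.pt := rfl
@[simp] theorem one_pt : (1 : CentreObj I₀ I₁ Ψ).pt = 1 := rfl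
@[simp] theorem one_ξ (z : G₀) : (1 : CentreObj I₀ I₁ Ψ).ξ z = 1 := rfl
@[simp] theorem inv_pt (p : CentreObj I₀ I₁ Ψ) : p⁻¹.pt = p.pt⁻¹ := rfl
@[simp] theorem inv_ξ (p : CentreObj I₀ I₁ Ψ) (z : G₀) :
    p⁻¹.ξ z = (Ψ.act (p.ξ z) p.pt⁻¹)⁻¹ := rfl

instance : Group (CentreObj I₀ I₁ Ψ) where
  mul_assoc p q r := CentreObj.ext (mul_assoc _ _ _) (funext fun z => by
    simp only [mul_ξ, mul_pt, Ψ.mul_act, Ψ.act_mul, mul_assoc])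
  one_mul p := CentreObj.ext (one_mul _) (funext fun z => by simp)
  mul_one p := CentreObj.ext (mul_one _) (funext fun z => by simp [Ψ.act_one])
  inv_mul_cancel p := CentreObj.ext (inv_mul_cancel _) (funext fun z => by
    simp [Ψ.inv_act, Ψ.act_act_inv])

end CentreObj

/-- The centre of a crossed module: the crossed module with structure map
`a ↦ (ψ a, z ↦ (a⁻¹) ^ z * a)` and action `a ^ (x, ξ) = a ^ x`; the associated strict categorical
group is the Drinfeld centre `𝒵(𝒮(Ψ))`. -/
def centre : CrossedModule (CentreObj I₀ I₁ Ψ) G₁ where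
  hom :=
    { toFun := fun a =>
        { pt := Ψ.hom a
          ξ := fun z => Ψ.act a⁻¹ z * a
          analytic := WeakEnd.analytic_mul₁ I₀ I₁ Ψ
            (WeakEnd.analytic_act I₀ I₁ Ψ contMDiff_const contMDiff_id) contMDiff_const
          crossed := fun s t => by
            simp only [Ψ.mul_act, Ψ.inv_act, Ψ.act_mul]; group
          conj₀ := fun z => by
            rw [map_mul, Ψ.hom_act, map_inv]; group
          conj₁ := fun b => by
            rw [Ψ.peiffer, Ψ.peiffer]; group }
      map_one' := CentreObj.ext (map_one _) (funext fun z => by simp)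
      map_mul' := fun a b => CentreObj.ext (map_mul _ _ _) (funext fun z => by
        simp only [CentreObj.mul_ξ, Ψ.peiffer, Ψ.mul_act, Ψ.inv_act, mul_inv_rev]; group) }
  act a p := Ψ.act a p.pt
  act_one a := Ψ.act_one a
  act_mul a p q := Ψ.act_mul a _ _
  mul_act a b p := Ψ.mul_act a b _
  hom_act a p := by
    rw [mul_assoc, eq_inv_mul_iff_mul_eq]
    refine CentreObj.ext ?_ (funext fun z => ?_)
    · change p.pt * Ψ.hom (Ψ.act a p.pt) = Ψ.hom a * p.pt
      rw [Ψ.hom_act]; group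
    · change Ψ.act (Ψ.act a p.pt)⁻¹ z * Ψ.act a p.pt *
        Ψ.act (p.ξ z) (Ψ.hom (Ψ.act a p.pt)) = p.ξ z * Ψ.act (Ψ.act a⁻¹ z * a) p.pt
      have h := Ψ.peiffer (Ψ.act a⁻¹ (p.pt * z)) (p.ξ z)
      have e : p.pt * z * Ψ.hom (p.ξ z) = z * p.pt := by
        rw [mul_assoc, ← p.conj₀]; group
      rw [← Ψ.act_mul, e] at h
      rw [Ψ.peiffer, Ψ.mul_act, ← Ψ.act_mul, h]
      simp only [Ψ.inv_act, Ψ.act_mul]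
      group
  peiffer b a := Ψ.peiffer b a

/-- `π₀(𝒵(𝒢)) → π₀(𝒢)`, the class of `(x, ξ)` being sent to the class of `x`. -/
def pi0Forget : (centre I₀ I₁ Ψ).Pi0 →* Ψ.Pi0 :=
  QuotientGroup.map _ _
    { toFun := fun p : CentreObj I₀ I₁ Ψ => p.pt, map_one' := rfl, map_mul' := fun _ _ => rfl } (by
      rintro _ ⟨a, rfl⟩
      exact ⟨a, rfl⟩)

/-- Analytic crossed homomorphisms `π₀ → π₁`, i.e. `χ([x y]) = χ([x]) ^ y χ([y])`. -/
@[ext] structure PiCross where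
  toFun : Ψ.Pi0 → Ψ.Pi1
  analytic : ContMDiff I₀ I₁ ω fun x : G₀ => (toFun (Ψ.cls x) : G₁)
  crossed : ∀ x y, toFun (Ψ.cls (x * y)) = Ψ.pi1Act (toFun (Ψ.cls x)) y * toFun (Ψ.cls y)

namespace PiCross

variable {I₀ I₁ Ψ}

/-- Crossed homomorphisms to the abelian group `π₁` form a group under pointwise multiplication. -/
instance : Mul (PiCross I₀ I₁ Ψ) where
  mul c d :=
    { toFun := fun x => c.toFun x * d.toFun x
      analytic := WeakEnd.analytic_mul₁ I₀ I₁ Ψ c.analytic d.analytic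
      crossed := fun x y => by
        rw [c.crossed, d.crossed]
        have : Ψ.pi1Act (c.toFun (Ψ.cls x) * d.toFun (Ψ.cls x)) y =
          Ψ.pi1Act (c.toFun (Ψ.cls x)) y * Ψ.pi1Act (d.toFun (Ψ.cls x)) y :=
          Subtype.ext (Ψ.mul_act _ _ _)
        rw [this, mul_mul_mul_comm] }

instance : One (PiCross I₀ I₁ Ψ) where
  one :=
    { toFun := fun _ => 1
      analytic := contMDiff_const
      crossed := fun x y => Subtype.ext (by simp) }

instance : Inv (PiCross I₀ I₁ Ψ) where
  inv c :=
    { toFun := fun x => (c.toFun x)⁻¹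
      analytic := WeakEnd.analytic_inv₁ I₀ I₁ Ψ c.analytic
      crossed := fun x y => by
        rw [c.crossed]
        have : Ψ.pi1Act (c.toFun (Ψ.cls x))⁻¹ y = (Ψ.pi1Act (c.toFun (Ψ.cls x)) y)⁻¹ :=
          Subtype.ext (Ψ.inv_act _ _)
        rw [this, mul_inv] }

instance : CommGroup (PiCross I₀ I₁ Ψ) where
  mul_assoc c d e := PiCross.ext (funext fun x => mul_assoc _ _ _)
  one_mul c := PiCross.ext (funext fun x => one_mul _)
  mul_one c := PiCross.ext (funext fun x => mul_one _)
  inv_mul_cancel c := PiCross.ext (funext fun x => inv_mul_cancel _)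
  mul_comm c d := PiCross.ext (funext fun x => mul_comm _ _)

end PiCross

/-- `π₁ → Cross(π₀, π₁)`, `a ↦ (x ↦ a ^ x a⁻¹)`. -/
def pi1ToCross : Ψ.Pi1 →* PiCross I₀ I₁ Ψ where
  toFun a :=
    { toFun := fun c => Quotient.liftOn' c (fun x => Ψ.pi1Act a x * a⁻¹) fun x y h => by
        obtain ⟨b, hb⟩ := QuotientGroup.leftRel_apply.mp h
        have e : y = x * Ψ.hom b := by rw [hb]; group
        refine congrArg (· * a⁻¹) (Subtype.ext ?_)
        rw [coe_pi1Act, coe_pi1Act, e, Ψ.act_mul, Ψ.peiffer]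
        have hk : Ψ.hom (Ψ.act a x) = 1 := MonoidHom.mem_ker.mp (Ψ.pi1Act a x).2
        rw [mul_assoc, Ψ.ker_mul_comm hk]; group
      analytic := WeakEnd.analytic_mul₁ I₀ I₁ Ψ
        (WeakEnd.analytic_act I₀ I₁ Ψ contMDiff_const contMDiff_id) contMDiff_const
      crossed := fun x y => Subtype.ext (by
        change Ψ.act a (x * y) * (a : G₁)⁻¹ =
          Ψ.act (Ψ.act a x * (a : G₁)⁻¹) y * (Ψ.act a y * (a : G₁)⁻¹)
        rw [Ψ.mul_act, Ψ.inv_act, Ψ.act_mul]; group) }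
  map_one' := PiCross.ext (funext fun c => by
    obtain ⟨x, rfl⟩ := Ψ.cls_surjective c
    exact Subtype.ext (show Ψ.act 1 x * (1 : G₁)⁻¹ = 1 by simp))
  map_mul' a b := PiCross.ext (funext fun c => by
    obtain ⟨x, rfl⟩ := Ψ.cls_surjective c
    change Ψ.pi1Act (a * b) x * (a * b)⁻¹ = Ψ.pi1Act a x * a⁻¹ * (Ψ.pi1Act b x * b⁻¹)
    have : Ψ.pi1Act (a * b) x = Ψ.pi1Act a x * Ψ.pi1Act b x := Subtype.ext (Ψ.mul_act _ _ _)
    rw [this, mul_inv, mul_mul_mul_comm])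

/-- `Cross(π₀, π₁) → π₀(𝒵(𝒢))`, sending `χ` to the class of `(1, z ↦ χ([z]))`. -/
def crossToPi0Centre : PiCross I₀ I₁ Ψ →* (centre I₀ I₁ Ψ).Pi0 where
  toFun χ := QuotientGroup.mk
    { pt := 1
      ξ := fun z => χ.toFun (Ψ.cls z)
      analytic := χ.analytic
      crossed := fun s t => congrArg Subtype.val (χ.crossed s t)
      conj₀ := fun z => by
        rw [MonoidHom.mem_ker.mp (χ.toFun (Ψ.cls z)).2]; group
      conj₁ := fun a => by
        have h1 : Ψ.cls (Ψ.hom a) = Ψ.cls 1 :=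
          QuotientGroup.eq.mpr (by simp)
        have h2 : χ.toFun (Ψ.cls 1) = 1 := by
          have := χ.crossed 1 1
          have e : Ψ.pi1Act (χ.toFun (Ψ.cls 1)) 1 = χ.toFun (Ψ.cls 1) :=
            Subtype.ext (Ψ.act_one _)
          rw [mul_one, e] at this
          exact left_eq_mul.mp this
        rw [h1, h2, Ψ.act_one, Subgroup.coe_one, mul_one] }
  map_one' := rfl
  map_mul' χ χ' := by
    rw [← QuotientGroup.mk_mul]
    refine congrArg QuotientGroup.mk (CentreObj.ext (mul_one _).symm (funext fun z => ?_))
    change ((χ.toFun (Ψ.cls z) * χ'.toFun (Ψ.cls z) : Ψ.Pi1) : G₁) =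
      χ'.toFun (Ψ.cls z) * Ψ.act (χ.toFun (Ψ.cls z)) 1
    rw [Ψ.act_one, mul_comm, Subgroup.coe_mul]

end Centre

end Lie
end CrossedModule

/-- The semi-direct product `A ⋊ {±1}` of an abelian group with `{±1}` acting by inversion:
`(x, ε)(y, δ) = (x + ε y, ε δ)`. -/
def PMSemidirect (A : Type*) : Type _ := A × ℤˣ

namespace PMSemidirect

section Group

variable {A : Type*} [AddCommGroup A]

/-- The element `(x, ε)` of `A ⋊ {±1}`. -/
def mk (x : A) (ε : ℤˣ) : PMSemidirect A := (x, ε)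

@[ext] theorem ext {p q : PMSemidirect A} (h₁ : p.1 = q.1) (h₂ : p.2 = q.2) : p = q :=
  Prod.ext h₁ h₂

instance : Mul (PMSemidirect A) := ⟨fun p q => mk (p.1 + p.2 • q.1) (p.2 * q.2)⟩
instance : One (PMSemidirect A) := ⟨mk 0 1⟩
instance : Inv (PMSemidirect A) := ⟨fun p => mk (-(p.2 • p.1)) p.2⟩

@[simp] theorem mk_fst (x : A) (ε : ℤˣ) : (mk x ε).1 = x := rfl
@[simp] theorem mk_snd (x : A) (ε : ℤˣ) : (mk x ε).2 = ε := rfl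
@[simp] theorem mul_fst (p q : PMSemidirect A) : (p * q).1 = p.1 + p.2 • q.1 := rfl
@[simp] theorem mul_snd (p q : PMSemidirect A) : (p * q).2 = p.2 * q.2 := rfl
@[simp] theorem one_fst : (1 : PMSemidirect A).1 = 0 := rfl
@[simp] theorem one_snd : (1 : PMSemidirect A).2 = 1 := rfl
@[simp] theorem inv_fst (p : PMSemidirect A) : p⁻¹.1 = -(p.2 • p.1) := rfl
@[simp] theorem inv_snd (p : PMSemidirect A) : p⁻¹.2 = p.2 := rfl

instance : Group (PMSemidirect A) where
  mul_assoc p q r := PMSemidirect.ext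
    (by simp only [mul_fst, mul_snd, smul_add, mul_smul, add_assoc]) (mul_assoc _ _ _)
  one_mul p := PMSemidirect.ext (by simp) (one_mul _)
  mul_one p := PMSemidirect.ext (by simp) (mul_one _)
  inv_mul_cancel p := PMSemidirect.ext (by simp) (by simp [← sq, Int.units_sq])

end Group

end PMSemidirect

/-- The discrete group of signs, as a zero-dimensional manifold. -/
instance : ChartedSpace PUnit.{1} ℤˣ := ChartedSpace.ofDiscreteTopology

section DiscreteFactor

variable {E H M D F K N : Type*} [NormedAddCommGroup E] [NormedSpace ℝ E] [TopologicalSpace H]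
  {I : ModelWithCorners ℝ E H} [TopologicalSpace M] [ChartedSpace H M]
  [NormedAddCommGroup F] [NormedSpace ℝ F] [TopologicalSpace K]
  {I' : ModelWithCorners ℝ F K} [TopologicalSpace N] [ChartedSpace K N]
  [TopologicalSpace D] [DiscreteTopology D]

/-- Analyticity may be checked on the slices of a locally constant function. -/
theorem contMDiff_of_slices {f : M → N} (d : M → D) (hd : Continuous d)
    (h : ∀ c : D, ∃ g : M → N, ContMDiff I I' ω g ∧ ∀ x, d x = c → f x = g x) :
    ContMDiff I I' ω f := fun x => by
  obtain ⟨g, hg, hfg⟩ := h (d x)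
  refine (hg x).congr_of_eventuallyEq ?_
  have : d ⁻¹' {d x} ∈ nhds x := hd.continuousAt.preimage_mem_nhds
    ((isOpen_discrete _).mem_nhds rfl)
  filter_upwards [this] with y hy using hfg y hy

/-- Continuous maps to a discrete manifold are analytic. -/
theorem contMDiff_to_discrete {L : Type*} [TopologicalSpace L] [DiscreteTopology L]
    [ChartedSpace PUnit.{1} L] {f : M → L} (hf : Continuous f) :
    ContMDiff I 𝓘(ℝ, PUnit.{1}) ω f :=
  contMDiff_of_slices f hf fun c => ⟨fun _ => c, contMDiff_const, fun _ h => h⟩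

end DiscreteFactor

namespace PMSemidirect

variable {E : Type*} [NormedAddCommGroup E] [NormedSpace ℝ E]

instance : TopologicalSpace (PMSemidirect E) := inferInstanceAs (TopologicalSpace (E × ℤˣ))

instance : ChartedSpace (ModelProd E PUnit.{1}) (PMSemidirect E) :=
  inferInstanceAs (ChartedSpace (ModelProd E PUnit.{1}) (E × ℤˣ))

variable (E) in
/-- The manifold structure on `E ⋊ {±1}`, the disjoint union of two copies of `E`. -/
noncomputable abbrev model : ModelWithCorners ℝ (E × PUnit.{1}) (ModelProd E PUnit.{1}) := 𝓘(ℝ, E).prod 𝓘(ℝ, PUnit.{1})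

instance : IsManifold (model E) ω (PMSemidirect E) :=
  haveI : IsManifold 𝓘(ℝ, PUnit.{1}) ω ℤˣ := IsManifold.of_discreteTopology _
  inferInstanceAs (IsManifold (𝓘(ℝ, E).prod 𝓘(ℝ, PUnit.{1})) ω (E × ℤˣ))

theorem contMDiff_fst : ContMDiff (model E) 𝓘(ℝ, E) ω fun p : PMSemidirect E => p.1 :=
  _root_.contMDiff_fst (I := 𝓘(ℝ, E)) (J := 𝓘(ℝ, PUnit.{1})) (M := E) (N := ℤˣ)

theorem continuous_snd : Continuous fun p : PMSemidirect E => p.2 :=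
  _root_.continuous_snd (X := E) (Y := ℤˣ)

theorem contMDiff_mk {F K M : Type*} [NormedAddCommGroup F] [NormedSpace ℝ F] [TopologicalSpace K]
    {I : ModelWithCorners ℝ F K} [TopologicalSpace M] [ChartedSpace K M] {f : M → E} {g : M → ℤˣ}
    (hf : ContMDiff I 𝓘(ℝ, E) ω f) (hg : Continuous g) :
    ContMDiff I (model E) ω fun x => (mk (f x) (g x) : PMSemidirect E) :=
  ContMDiff.prodMk (I' := 𝓘(ℝ, E)) (J' := 𝓘(ℝ, PUnit.{1})) (M' := E) (N' := ℤˣ) hf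
    (contMDiff_to_discrete hg)

theorem contMDiff_smul {F K M : Type*} [NormedAddCommGroup F] [NormedSpace ℝ F]
    [TopologicalSpace K]
    {I : ModelWithCorners ℝ F K} [TopologicalSpace M] [ChartedSpace K M] {f : M → E} {g : M → ℤˣ}
    (hf : ContMDiff I 𝓘(ℝ, E) ω f) (hg : Continuous g) :
    ContMDiff I 𝓘(ℝ, E) ω fun x => g x • f x :=
  contMDiff_of_slices g hg fun c => by
    rcases Int.units_eq_one_or c with rfl | rfl
    · exact ⟨f, hf, fun x h => by rw [h, one_smul]⟩
    · exact ⟨fun x => -f x, hf.neg, fun x h => by rw [h, Units.neg_smul, one_smul]⟩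

instance : LieGroup (model E) ω (PMSemidirect E) where
  contMDiff_mul := by
    have h1 : Continuous fun p : PMSemidirect E × PMSemidirect E => p.1.2 :=
      continuous_snd.comp _root_.continuous_fst
    have h2 : Continuous fun p : PMSemidirect E × PMSemidirect E => p.2.2 :=
      continuous_snd.comp _root_.continuous_snd
    exact contMDiff_mk ((contMDiff_fst.comp _root_.contMDiff_fst).add
      (contMDiff_smul (contMDiff_fst.comp _root_.contMDiff_snd) h1)) (h1.mul h2)
  contMDiff_inv := contMDiff_mk (contMDiff_smul contMDiff_fst continuous_snd).neg continuous_snd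

end PMSemidirect

namespace CategoricalTorus

variable {E : Type*} [NormedAddCommGroup E] [NormedSpace ℝ E] [FiniteDimensional ℝ E]
  (L : Submodule ℤ E) [DiscreteTopology L] [IsZLattice ℝ L]

/-- The extension `J_ℝ = J ⊗ ℝ` of an integral bilinear form on a full lattice `L` in `E` to
`E = L ⊗ ℝ`. -/
noncomputable def extend (J : L →ₗ[ℤ] L →ₗ[ℤ] ℤ) : E →ₗ[ℝ] E →ₗ[ℝ] ℝ :=
  haveI := ZLattice.module_free ℝ L
  haveI := ZLattice.module_finite ℝ L
  let b := Module.Free.chooseBasis ℤ L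
  let B := b.ofZLatticeBasis ℝ L
  B.constr ℝ fun i => B.constr ℝ fun j => (J (b i) (b j) : ℝ)

theorem extend_apply (J : L →ₗ[ℤ] L →ₗ[ℤ] ℤ) (m n : L) :
    extend L J (m : E) (n : E) = (J m n : ℝ) := by
  have := ZLattice.module_free ℝ L
  have := ZLattice.module_finite ℝ L
  let b := Module.Free.chooseBasis ℤ L
  have hB : ∀ i, b.ofZLatticeBasis ℝ L i = b i := b.ofZLatticeBasis_apply ℝ L
  have hm : (m : E) = ∑ i, (b.repr m i) • (b i : E) := by
    conv_lhs => rw [← b.sum_repr m]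
    simp only [Submodule.coe_sum, Submodule.coe_smul]
  have hn : (n : E) = ∑ i, (b.repr n i) • (b i : E) := by
    conv_lhs => rw [← b.sum_repr n]
    simp only [Submodule.coe_sum, Submodule.coe_smul]
  have hbb : ∀ i j, extend L J (b i : E) (b j : E) = (J (b i) (b j) : ℝ) := fun i j => by
    simp only [extend]
    rw [← hB i, Module.Basis.constr_basis, ← hB j, Module.Basis.constr_basis]
  rw [hm, hn]
  conv_rhs => rw [← b.sum_repr m, ← b.sum_repr n]
  simp only [map_sum, map_zsmul, LinearMap.sum_apply, LinearMap.smul_apply, hbb]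
  push_cast
  simp

instance : ChartedSpace PUnit.{1} (Multiplicative L) :=
  ChartedSpace.ofDiscreteTopology

/-- The group `L × U(1)` of morphisms out of the unit object. -/
abbrev Arrows : Type _ := Multiplicative L × Circle

/-- The manifold structure on `L × U(1)`, with `L` discrete. -/
noncomputable abbrev arrowsModel :
    ModelWithCorners ℝ (PUnit.{1} × EuclideanSpace ℝ (Fin 1))
      (ModelProd PUnit.{1} (EuclideanSpace ℝ (Fin 1))) :=
  𝓘(ℝ, PUnit.{1}).prod (𝓡 1)

/-- The crossed module of `𝒯 ⋊ {±1}`: the structure map is `(m, z) ↦ (m, 1)`, and `(x, ε)` acts by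
`(m, z) ↦ (ε m, z exp(2πi J(m, x)))`. -/
noncomputable def thetaPrime (J : L →ₗ[ℤ] L →ₗ[ℤ] ℤ) :
    CrossedModule (PMSemidirect E) (Arrows L) where
  hom :=
    { toFun := fun a => PMSemidirect.mk ((Multiplicative.toAdd a.1 : L) : E) 1
      map_one' := rfl
      map_mul' := fun a b => PMSemidirect.ext (by simp) (by simp) }
  act a x := (Multiplicative.ofAdd (x.2 • Multiplicative.toAdd a.1),
    a.2 * Circle.exp (2 * Real.pi * extend L J (Multiplicative.toAdd a.1 : L) x.1))
  act_one a := by simp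
  act_mul a x y := by
    refine Prod.ext ?_ ?_
    · simp [mul_comm x.2, mul_smul]
    · rcases Int.units_eq_one_or x.2 with h | h <;>
        simp [h, mul_add, Circle.exp_add, mul_assoc]
  mul_act a b x := by
    refine Prod.ext ?_ ?_
    · simp
    · simp [mul_add, Circle.exp_add]
      exact mul_mul_mul_comm _ _ _ _
  hom_act a x := by
    refine PMSemidirect.ext ?_ ?_
    · simp
    · simp [← sq]
  peiffer b a := by
    refine Prod.ext ?_ ?_
    · simp
    · have h : Circle.exp (2 * Real.pi * (J (Multiplicative.toAdd b.1) (Multiplicative.toAdd a.1) : ℝ))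
          = 1 := Circle.exp_two_pi_mul_int _
      simp only [MonoidHom.coe_mk, OneHom.coe_mk, PMSemidirect.mk_fst, extend_apply, h, mul_one]
      exact (inv_mul_cancel_comm _ _).symm

instance (J : L →ₗ[ℤ] L →ₗ[ℤ] ℤ) :
    (thetaPrime L J).IsLie (PMSemidirect.model E) arrowsModel where
  lie₀ := inferInstance
  lie₁ :=
    have : LieGroup 𝓘(ℝ, PUnit.{1}) ω (Multiplicative L) :=
      { toIsManifold := IsManifold.of_discreteTopology _
        contMDiff_mul := contMDiff_to_discrete continuous_mul
        contMDiff_inv := contMDiff_to_discrete continuous_inv }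
    inferInstance
  hom_analytic := by
    refine PMSemidirect.contMDiff_mk (contMDiff_of_slices (D := Multiplicative L) Prod.fst
      continuous_fst fun c => ⟨fun _ => ((Multiplicative.toAdd c : L) : E), contMDiff_const,
        fun x h => by rw [h]⟩) continuous_const
  act_analytic := by
    have c1 : Continuous fun p : Arrows L × PMSemidirect E => p.2.2 :=
      PMSemidirect.continuous_snd.comp continuous_snd
    have c2 : Continuous fun p : Arrows L × PMSemidirect E => p.1.1 :=
      continuous_fst.comp continuous_fst
    refine ContMDiff.prodMk (contMDiff_to_discrete ?_) ?_
    · exact (continuous_of_discreteTopology (f := fun q : ℤˣ × Multiplicative L =>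
        Multiplicative.ofAdd (q.1 • Multiplicative.toAdd q.2))).comp (c1.prodMk c2)
    · refine ContMDiff.mul (contMDiff_snd.comp contMDiff_fst) ?_
      refine contMDiff_of_slices _ c2 fun m => ⟨fun p => Circle.exp (2 * Real.pi *
        extend L J (Multiplicative.toAdd m : L) p.2.1), ?_, fun x h => by rw [h]⟩
      have h1 : ContMDiff 𝓘(ℝ, E) 𝓘(ℝ, ℝ) ω fun x : E => 2 * Real.pi *
          extend L J (Multiplicative.toAdd m : L) x :=
        ((contDiff_const.mul (extend L J (Multiplicative.toAdd m : L)).toContinuousLinearMap.contDiff)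
          ).contMDiff
      exact contMDiff_circleExp.comp (h1.comp (PMSemidirect.contMDiff_fst.comp contMDiff_snd))

instance (J : L →ₗ[ℤ] L →ₗ[ℤ] ℤ) : (thetaPrime L J).IsCentral where
  act_eq a x ha := by
    have h : ((Multiplicative.toAdd a.1 : L) : E) = 0 := congrArg Prod.fst ha
    have h' : a.1 = 1 := by
      have : Multiplicative.toAdd a.1 = 0 := Subtype.ext h
      exact this
    refine Prod.ext ?_ ?_
    · simp [thetaPrime, h']
    · simp [thetaPrime, h']

section Isometries

variable {M : Type*} [AddCommGroup M]

/-- The isometry group `O(M, I)` of a bilinear form. -/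
def isometryGroup (I : M →ₗ[ℤ] M →ₗ[ℤ] ℤ) : Subgroup (M ≃ₗ[ℤ] M) where
  carrier := {g | ∀ m n, I (g m) (g n) = I m n}
  one_mem' _ _ := rfl
  mul_mem' {g h} hg hh m n := by
    rw [LinearEquiv.mul_apply, LinearEquiv.mul_apply, hg, hh]
  inv_mem' {g} hg m n := by
    have h : ∀ m, g (g⁻¹ m) = m := fun m => g.apply_symm_apply m
    rw [← hg, h, h]

/-- The subgroup `{±id}` of `O(M, I)`. -/
def plusMinus (I : M →ₗ[ℤ] M →ₗ[ℤ] ℤ) : Subgroup (isometryGroup I) where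
  carrier := {g | (∀ m, g.1 m = m) ∨ ∀ m, g.1 m = -m}
  one_mem' := Or.inl fun _ => rfl
  mul_mem' {g h} hg hh := by
    rcases hg with hg | hg <;> rcases hh with hh | hh
    · exact Or.inl fun m => by simp [hg, hh]
    · exact Or.inr fun m => by simp [hg, hh]
    · exact Or.inr fun m => by simp [hg, hh]
    · exact Or.inl fun m => by simp [hg, hh]
  inv_mem' {g} hg := by
    have h : ∀ m, g.1⁻¹ (g.1 m) = m := fun m => g.1.symm_apply_apply m
    rcases hg with hg | hg
    · exact Or.inl fun m => by
        conv_lhs => rw [← hg m]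
        exact h m
    · exact Or.inr fun m => by
        have := h (-m)
        rwa [hg, neg_neg] at this

instance (I : M →ₗ[ℤ] M →ₗ[ℤ] ℤ) : (plusMinus I).Normal where
  conj_mem g hg h := by
    have hh : ∀ m, h.1 (h.1⁻¹ m) = m := fun m => h.1.apply_symm_apply m
    rcases hg with hg | hg
    · exact Or.inl fun m => by simp [hg]
    · exact Or.inr fun m => by simp [hg]

/-- `PO(M, I) = O(M, I) / {±id}`. -/
abbrev projIsometryGroup (I : M →ₗ[ℤ] M →ₗ[ℤ] ℤ) : Type _ := isometryGroup I ⧸ plusMinus I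

end Isometries

section Sequence

variable (J : L →ₗ[ℤ] L →ₗ[ℤ] ℤ)

/-- Centre-preserving weak automorphisms of `𝒯 ⋊ {±1}`. -/
noncomputable abbrev AutPlus : Subgroup (CrossedModule.WeakEnd (PMSemidirect.model E)
    arrowsModel (thetaPrime L J))ˣ :=
  CrossedModule.wActPlus₀ (PMSemidirect.model E) arrowsModel (thetaPrime L J)

/-- `π₀(𝒯 ⋊ {±1})`. -/
abbrev TorusPi0 : Type _ := (thetaPrime L J).Pi0

/-- `π₁(𝒯 ⋊ {±1})`. -/
abbrev TorusPi1 : Type _ := (thetaPrime L J).Pi1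

/-- `π₀(𝒜ut⁺(𝒯 ⋊ {±1}))`. -/
abbrev AutPlusPi0 : Type _ :=
  (CrossedModule.wActPlus (PMSemidirect.model E) arrowsModel (thetaPrime L J)).Pi0

/-- `π₀(𝒪ut⁺(𝒯 ⋊ {±1}))`. -/
abbrev OutPlusPi0 : Type _ :=
  CrossedModule.OutPlusPi0 (PMSemidirect.model E) arrowsModel (thetaPrime L J)

/-- `π₀(𝒵(𝒯 ⋊ {±1}))`. -/
abbrev CentrePi0 : Type _ :=
  (CrossedModule.centre (PMSemidirect.model E) arrowsModel (thetaPrime L J)).Pi0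

/-- `Cross(π₀, π₁)` for `𝒯 ⋊ {±1}`. -/
abbrev Cross : Type _ :=
  CrossedModule.PiCross (PMSemidirect.model E) arrowsModel (thetaPrime L J)

/-- `π₁ → Cross(π₀, π₁)`. -/
noncomputable abbrev pi1ToCross : TorusPi1 L J →* Cross L J :=
  CrossedModule.pi1ToCross (PMSemidirect.model E) arrowsModel (thetaPrime L J)

/-- `Cross(π₀, π₁) → π₀(𝒵)`. -/
noncomputable abbrev crossToCentre : Cross L J →* CentrePi0 L J :=
  CrossedModule.crossToPi0Centre (PMSemidirect.model E) arrowsModel (thetaPrime L J)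

/-- `π₀(𝒵) → π₀(𝒯 ⋊ {±1})`. -/
noncomputable abbrev centreToTorus : CentrePi0 L J →* TorusPi0 L J :=
  CrossedModule.pi0Forget (PMSemidirect.model E) arrowsModel (thetaPrime L J)

/-- `π₀(𝒯 ⋊ {±1}) → π₀(𝒜ut⁺)`. -/
noncomputable abbrev torusToAut : TorusPi0 L J →* AutPlusPi0 L J :=
  CrossedModule.pi0Ad (PMSemidirect.model E) arrowsModel (thetaPrime L J)

/-- `π₀(𝒜ut⁺) → π₀(𝒪ut⁺)`. -/
noncomputable abbrev autToOut : AutPlusPi0 L J →* OutPlusPi0 L J :=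
  CrossedModule.pi0Out (PMSemidirect.model E) arrowsModel (thetaPrime L J)

end Sequence

end CategoricalTorus

open CategoricalTorus

/-! ### Exactness of the sequence for a central Lie crossed module -/

namespace CrossedModule

variable {E₀ H₀ E₁ H₁ : Type*} [NormedAddCommGroup E₀] [NormedSpace ℝ E₀] [TopologicalSpace H₀]
  [NormedAddCommGroup E₁] [NormedSpace ℝ E₁] [TopologicalSpace H₁]
  (I₀ : ModelWithCorners ℝ E₀ H₀) (I₁ : ModelWithCorners ℝ E₁ H₁)
  {G₀ G₁ : Type*} [Group G₀] [Group G₁] [TopologicalSpace G₀] [ChartedSpace H₀ G₀]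
  [TopologicalSpace G₁] [ChartedSpace H₁ G₁] (Ψ : CrossedModule G₀ G₁) [Ψ.IsLie I₀ I₁]

section Centre

/-! Exactness is formal: the axioms of an object `(x, ξ)` of the centre say exactly that Ad(x⁻¹) =
δ(ξ), and 𝒪ut⁺ is a cokernel by construction. The content lies in computing the kernel and image of
the action of 𝒜ut⁺ on the lattice, and in showing that π₀(𝒵) → π₀(𝒢) is trivial in positive rank.

Write e(t) = exp(2πit) and s = (0, -1). The lattice is discrete, so on each of the two connected
components of E ⋊ {±1} the lattice component of an analytic map is constant. A centre-preserving
weak endomorphism therefore restricts to a linear map A on the identity component, extending an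
endomorphism g of L, together with a circle-valued two-cocycle k on E. For m in L, the axiom `w5`
becomes e(J(gm, Ax)) k(m, x) = e(J(m, x)) k(x, m). A cocycle is symmetric on the multiples of a
single vector. Taking x = m/(n+1), (J(gm, gm) - J(m, m))/(n+1) is an integer for every n, so J(gm,
gm) = J(m, m), and polarisation shows that g preserves I (`isometry_diag`, `isometry`). Conversely,
if g is an isometry then J - g*J is alternating, hence of the form K - Kᵗ with K integral, and e(K)
is a monoidal constraint lifting g (`autToIsometry_surjective`).

Suppose g = id and the weak endomorphism is invertible. Then k is symmetric against L, hence on all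
of E (`cocycle_symmetric_of_lattice`), hence an analytic coboundary
(`exists_coboundary_of_symmetric`); on E ⋊ {±1} only a character e(l) of E survives
(`exists_normal_form`). The circle part of f₁ differs from the primitive by a character e(a) of L,
and f₀(s) = (F, -1). Axiom `w5` at s makes 2a + l + J(·, F) integral on L, so unimodularity writes
it as I(q, ·); with u = (F - q)/2 the automorphism is isomorphic to Ad(u, 1). Since Ad(x, ε) acts on
L by ε and δ(η) acts trivially, the inner automorphisms are exactly those with g = ±id
(`comap_plusMinus_eq_innPlus`).

For an object `(x, ξ)` of the centre in positive rank, conjugation on E rules out the sign -1. On E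
the map `ξ` is a character, and comparing its values on (y, 1)s = s(-y, 1) expresses this character
through J(x, ·). The remaining axiom then says that I(x, ·) is integral on L, so the translation
part lies in L (`centre_pt_mem_range`). As π₁ is central, the sequence breaks up. -/

theorem pi1Invariants_eq_ker : Ψ.pi1Invariants = (pi1ToCross I₀ I₁ Ψ).ker := by
  ext a
  rw [MonoidHom.mem_ker]
  constructor
  · intro h
    refine PiCross.ext (funext fun c => ?_)
    obtain ⟨x, rfl⟩ := Ψ.cls_surjective c
    change Ψ.pi1Act a x * a⁻¹ = 1
    rw [h x, mul_inv_cancel]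
  · intro h x
    have := congrFun (congrArg PiCross.toFun h) (Ψ.cls x)
    change Ψ.pi1Act a x * a⁻¹ = 1 at this
    exact mul_inv_eq_one.mp this

/-- The image of `a` in the centre is (ψ a, z ↦ (a⁻¹)^z a). Over the unit object this forces `a`
into π₁, and the second component is the crossed homomorphism attached to `a⁻¹`; hence the inverses
in both directions. -/
theorem range_pi1ToCross : (pi1ToCross I₀ I₁ Ψ).range = (crossToPi0Centre I₀ I₁ Ψ).ker := by
  ext χ
  rw [MonoidHom.mem_ker]
  constructor
  · rintro ⟨a, rfl⟩
    refine (QuotientGroup.eq_one_iff _).mpr ⟨(a⁻¹ : Ψ.Pi1), CentreObj.ext ?_ (funext fun z => ?_)⟩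
    · exact MonoidHom.mem_ker.mp (a⁻¹ : Ψ.Pi1).2
    · change Ψ.act ((a : G₁)⁻¹)⁻¹ z * (a : G₁)⁻¹ = Ψ.act a z * (a : G₁)⁻¹
      rw [inv_inv]
  · intro h
    obtain ⟨a, ha⟩ := (QuotientGroup.eq_one_iff _).mp h
    have h0 : Ψ.hom a = 1 := congrArg CentreObj.pt ha
    refine ⟨⟨a⁻¹, by rw [MonoidHom.mem_ker, map_inv, h0, inv_one]⟩,
      PiCross.ext (funext fun c => ?_)⟩
    obtain ⟨x, rfl⟩ := Ψ.cls_surjective c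
    have h1 := congrFun (congrArg CentreObj.ξ ha) x
    refine Subtype.ext ?_
    change Ψ.act a⁻¹ x * (a⁻¹)⁻¹ = _
    rw [inv_inv]
    exact h1

variable {I₀ I₁ Ψ} in
theorem CentreObj.ξ_one (p : CentreObj I₀ I₁ Ψ) : p.ξ 1 = 1 := by
  have := p.crossed 1 1
  rw [Ψ.act_one, mul_one] at this
  exact left_eq_mul.mp this

variable {I₀ I₁ Ψ} in
/-- The crossed homomorphism of an object of the centre over the unit object. -/
def CentreObj.toCross (p : CentreObj I₀ I₁ Ψ) (hp : p.pt = 1) : PiCross I₀ I₁ Ψ :=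
  -- Over the unit object, `conj₀` puts the values of `ξ` in π₁ and `conj₁` makes `ξ` trivial on the
  -- image of the structure map; together they let `ξ` descend to π₀.
  have hom_ξ : ∀ z, Ψ.hom (p.ξ z) = 1 := fun z => by
    have := p.conj₀ z
    rw [hp, inv_one, one_mul, mul_one] at this
    exact left_eq_mul.mp this
  have ξ_hom : ∀ a, p.ξ (Ψ.hom a) = 1 := fun a => by
    have := p.conj₁ a
    rw [hp, Ψ.act_one] at this
    exact left_eq_mul.mp this
  { toFun := fun c => Quotient.liftOn' c (fun z => ⟨p.ξ z, hom_ξ z⟩) fun x y h => by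
      obtain ⟨b, hb⟩ := QuotientGroup.leftRel_apply.mp h
      have e : y = x * Ψ.hom b := by rw [hb]; group
      refine Subtype.ext ?_
      change p.ξ x = p.ξ y
      rw [e, p.crossed, ξ_hom, mul_one, Ψ.peiffer, mul_assoc, Ψ.ker_mul_comm (hom_ξ x)]
      group
    analytic := p.analytic
    crossed := fun x y => Subtype.ext (p.crossed x y) }

/-- An object over ψ(a) becomes an object over 1 after multiplication by the image of `a⁻¹`, without
changing its class. -/
theorem range_crossToPi0Centre :
    (crossToPi0Centre I₀ I₁ Ψ).range = (pi0Forget I₀ I₁ Ψ).ker := by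
  ext c
  rw [MonoidHom.mem_ker]
  constructor
  · rintro ⟨χ, rfl⟩
    rfl
  · intro h
    obtain ⟨p, rfl⟩ := QuotientGroup.mk_surjective c
    obtain ⟨a, ha⟩ := (QuotientGroup.eq_one_iff _).mp h
    have ha' : Ψ.hom a = p.pt := ha
    have hq : (p * (centre I₀ I₁ Ψ).hom a⁻¹).pt = 1 := by
      change p.pt * Ψ.hom a⁻¹ = 1
      rw [map_inv, ha', mul_inv_cancel]
    refine ⟨(p * (centre I₀ I₁ Ψ).hom a⁻¹).toCross hq, ?_⟩
    have e : (crossToPi0Centre I₀ I₁ Ψ) ((p * (centre I₀ I₁ Ψ).hom a⁻¹).toCross hq) =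
        QuotientGroup.mk (p * (centre I₀ I₁ Ψ).hom a⁻¹) :=
      congrArg QuotientGroup.mk (CentreObj.ext hq.symm rfl)
    rw [e, QuotientGroup.eq]
    exact ⟨a, by rw [map_inv]; group⟩

end Centre

section Ad

variable [Ψ.IsCentral]

/-- The three axioms of `(x, ξ)` are, component by component, the equation Ad(x⁻¹) = δ(ξ). The
inverse accounts for the passage to `p.pt⁻¹` and `η⁻¹` below. -/
theorem range_pi0Forget : (pi0Forget I₀ I₁ Ψ).range = (pi0Ad I₀ I₁ Ψ).ker := by
  ext c
  obtain ⟨x, rfl⟩ := Ψ.cls_surjective c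
  rw [MonoidHom.mem_ker]
  constructor
  · rintro ⟨d, hd⟩
    obtain ⟨p, rfl⟩ := QuotientGroup.mk_surjective d
    rw [← hd]
    let η : PointedMap I₀ I₁ Ψ := ⟨p.ξ, p.analytic, p.ξ_one⟩
    have h : (adHom I₀ I₁ Ψ p.pt⁻¹).val = η.deltaFun := by
      refine WeakEnd.ext (funext fun z => ?_) (funext fun a => ?_)
        (funext fun y => funext fun z => ?_)
      · change p.pt⁻¹ * z * (p.pt⁻¹)⁻¹ = z * Ψ.hom (p.ξ z)
        rw [inv_inv, p.conj₀]
      · change Ψ.act a (p.pt⁻¹)⁻¹ = a * p.ξ (Ψ.hom a)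
        rw [inv_inv, p.conj₁]
      · change 1 = (p.ξ z)⁻¹ * (Ψ.act (p.ξ y) z)⁻¹ * p.ξ (y * z)
        rw [p.crossed]; group
    change QuotientGroup.mk (adPlus I₀ I₁ Ψ p.pt) = 1
    rw [← inv_eq_one]
    refine (QuotientGroup.eq_one_iff _).mpr ?_
    rw [← map_inv]
    exact ⟨unitOfDelta η _ h, Subtype.ext (Units.ext h.symm)⟩
  · intro h
    obtain ⟨η, hη⟩ := (QuotientGroup.eq_one_iff _).mp h
    have h' : (η⁻¹).val.deltaFun = (adHom I₀ I₁ Ψ x⁻¹).val := by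
      have h1 : (wActPlus I₀ I₁ Ψ).hom η⁻¹ = adPlus I₀ I₁ Ψ x⁻¹ := by
        rw [map_inv, map_inv]
        exact congrArg Inv.inv hη
      exact congrArg (fun φ : wActPlus₀ I₀ I₁ Ψ => φ.val.val) h1
    have h₀ := fun z => congrFun (congrArg WeakEnd.map₀ h') z
    have h₁ := fun a => congrFun (congrArg WeakEnd.map₁ h') a
    have h₂ := fun y z => congrFun (congrFun (congrArg WeakEnd.κ h') y) z
    refine ⟨QuotientGroup.mk
      { pt := x
        ξ := (η⁻¹).val.toFun
        analytic := (η⁻¹).val.analytic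
        crossed := fun s t => ?_
        conj₀ := fun z => ?_
        conj₁ := fun a => ?_ }, rfl⟩
    · have := h₂ s t
      change ((η⁻¹).val.toFun t)⁻¹ * (Ψ.act ((η⁻¹).val.toFun s) t)⁻¹ * (η⁻¹).val.toFun (s * t) = 1
        at this
      rw [← mul_inv_rev, inv_mul_eq_one] at this
      exact this.symm
    · have := h₀ z
      change _ = x⁻¹ * z * (x⁻¹)⁻¹ at this
      rw [inv_inv] at this
      exact this.symm
    · have := h₁ a
      change _ = Ψ.act a (x⁻¹)⁻¹ at this
      rw [inv_inv] at this
      exact this.symm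

theorem range_pi0Ad : (pi0Ad I₀ I₁ Ψ).range = (pi0Out I₀ I₁ Ψ).ker := by
  ext c
  obtain ⟨φ, rfl⟩ := QuotientGroup.mk_surjective c
  rw [MonoidHom.mem_ker]
  exact (QuotientGroup.eq_one_iff (N := innPlus I₀ I₁ Ψ) φ).symm

theorem pi0Out_surjective : Function.Surjective (pi0Out I₀ I₁ Ψ) := fun c => by
  obtain ⟨φ, rfl⟩ := QuotientGroup.mk_surjective c
  exact ⟨QuotientGroup.mk φ, rfl⟩

/-- No invertibility of `η` has to be supplied: δ(η) = φ ∘ Ad(x)⁻¹ is invertible, and `unitOfDelta`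
then inverts `η` itself. -/
theorem mem_innPlus_iff {φ : wActPlus₀ I₀ I₁ Ψ} :
    φ ∈ innPlus I₀ I₁ Ψ ↔ ∃ x, ∃ η : PointedMap I₀ I₁ Ψ,
      φ.val.val = η.deltaFun * (adHom I₀ I₁ Ψ x).val := by
  constructor
  · rintro ⟨c, hc⟩
    obtain ⟨x, rfl⟩ := Ψ.cls_surjective c
    have hc' : (QuotientGroup.mk (adPlus I₀ I₁ Ψ x) : (wActPlus I₀ I₁ Ψ).Pi0) =
      QuotientGroup.mk φ := hc
    have h2 : φ / adPlus I₀ I₁ Ψ x ∈ (wActPlus I₀ I₁ Ψ).hom.range :=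
      QuotientGroup.eq_iff_div_mem.mp hc'.symm
    obtain ⟨η, hη⟩ := h2
    refine ⟨x, η.val, ?_⟩
    have h3 : φ = (wActPlus I₀ I₁ Ψ).hom η * adPlus I₀ I₁ Ψ x := by rw [hη, div_mul_cancel]
    exact congrArg (fun φ : wActPlus₀ I₀ I₁ Ψ => φ.val.val) h3
  · rintro ⟨x, η, h⟩
    have h1 : (φ.val * (adHom I₀ I₁ Ψ x)⁻¹).val = η.deltaFun := by
      rw [Units.val_mul, h, mul_assoc, Units.mul_inv, mul_one]
    refine ⟨Ψ.cls x, ?_⟩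
    change QuotientGroup.mk (adPlus I₀ I₁ Ψ x) = QuotientGroup.mk φ
    have h2 : φ / adPlus I₀ I₁ Ψ x ∈ (wActPlus I₀ I₁ Ψ).hom.range :=
      ⟨unitOfDelta η _ h1, by rw [div_eq_mul_inv]; exact Subtype.ext (Units.ext h1.symm)⟩
    exact (QuotientGroup.eq_iff_div_mem.mpr h2).symm

end Ad

end CrossedModule

/-! ### Doubling equations and symmetric cocycles with values in the circle -/

section CircleValued

open Filter Topology

variable {V : Type*} [NormedAddCommGroup V] [NormedSpace ℝ V]

/-- The argument of a circle-valued analytic map is analytic where the map takes the value `1`. -/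
theorem contDiffAt_arg_circle {F : V → Circle} {v : V} (hF : ContMDiffAt 𝓘(ℝ, V) (𝓡 1) ω F v)
    (h1 : F v = 1) : ContDiffAt ℝ ω (fun w => Complex.arg (F w)) v := by
  have := finrank_real_complex_fact'
  have h2 : ContMDiffAt 𝓘(ℝ, V) 𝓘(ℝ, ℂ) ω (fun w => (F w : ℂ)) v :=
    ((contMDiff_coe_sphere (E := ℂ) (n := 1) (m := ω)) (F v)).comp v hF
  have h3 : ContDiffAt ℝ ω (fun w => (F w : ℂ)) v := h2.contDiffAt
  have h4 : ContDiffAt ℝ ω Complex.log (F v : ℂ) := by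
    rw [h1]
    exact ((Complex.contDiffAt_log (by simp)).restrict_scalars ℝ)
  have h5 := Complex.imCLM.contDiff.contDiffAt.comp v (h4.comp v h3)
  refine h5.congr_of_eventuallyEq (Filter.Eventually.of_forall fun w => ?_)
  simp [Complex.log_im]

/-- A circle-valued map with `F (2 v) = F v ^ 2` which is differentiable at the origin is the
exponential of a linear functional. -/
theorem exists_linear_of_map_two_smul {F : V → Circle}
    (hF : ContMDiffAt 𝓘(ℝ, V) (𝓡 1) ω F 0) (h2 : ∀ v, F ((2 : ℝ) • v) = F v ^ 2) :
    ∃ l : V →L[ℝ] ℝ, ∀ v, F v = Circle.exp (l v) := by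
  have h0 : F 0 = 1 := by
    have := h2 0
    rw [smul_zero, sq] at this
    exact (left_eq_mul.mp this)
  have hd := (contDiffAt_arg_circle hF h0).differentiableAt (by simp)
  refine ⟨fderiv ℝ (fun w => Complex.arg (F w)) 0, fun v => ?_⟩
  have hc : Tendsto (fun n : ℕ => ‖(2 : ℝ) ^ n‖) atTop atTop := by
    simpa using tendsto_pow_atTop_atTop_of_one_lt (one_lt_two (α := ℝ))
  -- Difference quotients along 2⁻ⁿ v: the numbers 2ⁿ arg F(2⁻ⁿ v) tend to the derivative at `v`,
  -- while their exponentials all equal F(v) by repeated doubling.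
  have hl := hd.hasFDerivAt.lim v hc
  simp only [h0, zero_add, Circle.coe_one, Complex.arg_one, sub_zero, smul_eq_mul] at hl
  have hp : ∀ n : ℕ, F v = Circle.exp ((2 : ℝ) ^ n * Complex.arg (F (((2 : ℝ) ^ n)⁻¹ • v))) := by
    intro n
    induction n with
    | zero => simp
    | succ n ih =>
      have e : F (((2 : ℝ) ^ n)⁻¹ • v) = F (((2 : ℝ) ^ (n + 1))⁻¹ • v) ^ 2 := by
        rw [← h2, smul_smul]
        congr 2
        rw [pow_succ]; field_simp
      have e' : ∀ (m : ℕ) (z : Circle), Circle.exp ((2 : ℝ) ^ m * Complex.arg z) = z ^ (2 ^ m) := by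
        intro m z
        have := Circle.exp_nsmul (Complex.arg z) (2 ^ m)
        rw [Circle.exp_arg, nsmul_eq_mul] at this
        rw [← this]; push_cast; rfl
      rw [e'] at ih ⊢
      rw [ih, e, ← pow_mul, ← pow_succ']
  have hl' := (Circle.exp.continuous.tendsto _).comp hl
  exact tendsto_nhds_unique (tendsto_const_nhds.congr hp) hl'

/-- Near the origin, the equation `h (2 v) = 2 h v + q v` has an analytic solution if `q` is
analytic and vanishes to second order. -/
theorem exists_analyticAt_two_smul {q : V → ℝ} (hq : AnalyticAt ℝ q 0) (h0 : q 0 = 0)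
    (h1 : HasFDerivAt q (0 : V →L[ℝ] ℝ) 0) :
    ∃ h : V → ℝ, AnalyticAt ℝ h 0 ∧ h 0 = 0 ∧ ∀ᶠ v in 𝓝 (0 : V), h ((2 : ℝ) • v) = 2 * h v + q v := by
  obtain ⟨p, r, hp⟩ := hq
  have hp1 : ∀ w : Fin 1 → V, p 1 w = 0 := fun w => by
    have := hp.hasFPowerSeriesAt.hasFDerivAt.unique h1
    have e := congrArg (fun f : V →L[ℝ] ℝ => f (w 0)) this
    simp only [continuousMultilinearCurryFin1_apply, zero_apply] at e
    rw [← e]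
    congr 1
    funext i
    fin_cases i
    rfl
  have hp0 : ∀ w : Fin 0 → V, p 0 w = 0 := fun w => by
    rw [hp.coeff_zero, h0]
  -- In degree n the equation reads (2ⁿ - 2) hₙ = qₙ. Degree one is resonant, which is why `q` must
  -- vanish to second order; there the convention 0⁻¹ = 0 gives the solution 0.
  let c : ℕ → ℝ := fun n => ((2 : ℝ) ^ n - 2)⁻¹
  have hc : ∀ n, ‖c n‖ ≤ 1 := fun n => by
    match n with
    | 0 => norm_num [c]
    | 1 => norm_num [c]
    | n + 2 =>
      have : (1 : ℝ) ≤ 2 ^ n := one_le_pow₀ one_le_two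
      rw [norm_inv]
      apply inv_le_one_of_one_le₀
      rw [Real.norm_eq_abs, pow_add]
      apply le_trans _ (le_abs_self _)
      linarith
  let p' : FormalMultilinearSeries ℝ V ℝ := fun n => c n • p n
  -- The factors `c n` have absolute value at most 1, so the formal solution converges wherever the
  -- series of `q` does.
  have hle : p.radius ≤ p'.radius := by
    refine ENNReal.le_of_forall_nnreal_lt fun s hs => ?_
    obtain ⟨C, -, hC⟩ := p.norm_mul_pow_le_of_lt_radius hs
    refine p'.le_radius_of_bound C fun n => ?_
    refine le_trans ?_ (hC n)
    gcongr
    calc ‖p' n‖ = ‖c n‖ * ‖p n‖ := norm_smul _ _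
      _ ≤ 1 * ‖p n‖ := by gcongr; exact hc n
      _ = _ := one_mul _
  have hr' : 0 < p'.radius := lt_of_lt_of_le (lt_of_lt_of_le hp.r_pos hp.r_le) hle
  have hs := p'.hasFPowerSeriesOnBall hr'
  refine ⟨p'.sum, hs.analyticAt, ?_, ?_⟩
  · have := hs.coeff_zero (fun _ => 0)
    rw [← this]
    change c 0 • p 0 _ = 0
    rw [hp0, smul_zero]
  · have hb : ∀ᶠ v in 𝓝 (0 : V), v ∈ Metric.eball (0 : V) r ∧ (2 : ℝ) • v ∈ Metric.eball (0 : V) r := by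
      have h1 : Metric.eball (0 : V) r ∈ 𝓝 (0 : V) := Metric.eball_mem_nhds _ hp.r_pos
      refine Filter.Eventually.and h1 ?_
      have : Continuous fun v : V => (2 : ℝ) • v := continuous_const_smul _
      have h2 := this.tendsto 0
      rw [smul_zero] at h2
      exact h2 h1
    filter_upwards [hb] with v ⟨hv, hv2⟩
    have sub : Metric.eball (0 : V) r ⊆ Metric.eball (0 : V) p'.radius :=
      Metric.eball_subset_eball (hp.r_le.trans hle)
    have s1 := hs.hasSum (sub hv)
    have s2 := hs.hasSum (sub hv2)
    have s3 := hp.hasSum hv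
    simp only [zero_add] at s1 s2 s3
    refine s2.unique ?_
    refine ((s1.mul_left 2).add s3).congr_fun fun n => ?_
    change c n • p n (fun _ => (2 : ℝ) • v) = 2 * (c n • p n fun _ => v) + p n fun _ => v
    have e : p n (fun _ => (2 : ℝ) • v) = (2 : ℝ) ^ n * p n (fun _ => v) := by
      have := (p n).map_smul_univ (fun _ => (2 : ℝ)) (fun _ => v)
      simpa using this
    rw [e]
    match n with
    | 0 => simp [hp0]
    | 1 => simp [hp1]
    | n + 2 =>
      have : (1 : ℝ) ≤ 2 ^ n := one_le_pow₀ one_le_two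
      have h3 : ((2 : ℝ) ^ (n + 2) - 2) ≠ 0 := by
        rw [pow_add]
        have : (0 : ℝ) < 2 ^ n * 2 ^ 2 - 2 := by linarith
        exact this.ne'
      simp only [c, smul_eq_mul]
      field_simp
      ring

/-- The equation `η (2 v) = η v ^ 2 * k v` has an analytic circle-valued solution if `k` is
analytic and trivial to first order at the origin. -/
theorem exists_circle_two_smul {k : V → Circle} (hk : ContMDiff 𝓘(ℝ, V) (𝓡 1) ω k) (h0 : k 0 = 1)
    (h1 : HasFDerivAt (fun v => Complex.arg (k v)) (0 : V →L[ℝ] ℝ) 0) :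
    ∃ η : V → Circle, ContMDiff 𝓘(ℝ, V) (𝓡 1) ω η ∧ η 0 = 1 ∧
      ∀ v, η ((2 : ℝ) • v) = η v ^ 2 * k v := by
  obtain ⟨h, ha, hh0, hh⟩ := exists_analyticAt_two_smul
    (contDiffAt_arg_circle (hk 0) h0).analyticAt (by simp [h0]) h1
  obtain ⟨r, hr, hb⟩ := Metric.eventually_nhds_iff_ball.mp (hh.and ha.eventually_analyticAt)
  -- The functional equation itself extends the local solution: `σ n` starts from exp(h) and applies
  -- η(v) = η(v/2)² k(v/2) n times, so it is analytic on the ball of radius 2ⁿ r and agrees there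
  -- with all later stages.
  let σ : ℕ → V → Circle := fun n => Nat.rec (fun v => Circle.exp (h v))
    (fun _ f v => f ((2 : ℝ)⁻¹ • v) ^ 2 * k ((2 : ℝ)⁻¹ • v)) n
  have σs : ∀ n v, σ (n + 1) v = σ n ((2 : ℝ)⁻¹ • v) ^ 2 * k ((2 : ℝ)⁻¹ • v) := fun _ _ => rfl
  have half : ∀ (n : ℕ) (v : V), ‖v‖ < 2 ^ (n + 1) * r → ‖(2 : ℝ)⁻¹ • v‖ < 2 ^ n * r := by
    intro n v hv
    rw [norm_smul, norm_inv, Real.norm_ofNat]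
    rw [pow_succ] at hv
    linarith
  have σe : ∀ n v, ‖v‖ < 2 ^ n * r → σ (n + 1) v = σ n v := by
    intro n
    induction n with
    | zero =>
      intro v hv
      have hv' : (2 : ℝ)⁻¹ • v ∈ Metric.ball (0 : V) r := by
        rw [mem_ball_zero_iff, norm_smul, norm_inv, Real.norm_ofNat]
        have := norm_nonneg v
        rw [pow_zero] at hv
        linarith
      have := (hb _ hv').1
      rw [smul_smul, mul_inv_cancel₀ two_ne_zero, one_smul] at this
      change Circle.exp (h ((2 : ℝ)⁻¹ • v)) ^ 2 * k ((2 : ℝ)⁻¹ • v) = Circle.exp (h v)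
      rw [this, Circle.exp_add, Circle.exp_arg, two_mul, Circle.exp_add, sq]
    | succ n ih =>
      intro v hv
      rw [σs (n + 1), ih _ (half n v hv), ← σs]
  have σm : ∀ m n v, n ≤ m → ‖v‖ < 2 ^ n * r → σ m v = σ n v := by
    intro m n v hnm hv
    induction m, hnm using Nat.le_induction with
    | base => rfl
    | succ m hm ih =>
      rw [σe m v (hv.trans_le (by gcongr; exact one_le_two)), ih]
  have half' : ContMDiff 𝓘(ℝ, V) 𝓘(ℝ, V) ω fun v : V => (2 : ℝ)⁻¹ • v :=
    (contDiff_const_smul _).contMDiff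
  have σa : ∀ n v, ‖v‖ < 2 ^ n * r → ContMDiffAt 𝓘(ℝ, V) (𝓡 1) ω (σ n) v := by
    intro n
    induction n with
    | zero =>
      intro v hv
      have hv' : v ∈ Metric.ball (0 : V) r := by
        rw [mem_ball_zero_iff]; simpa using hv
      exact contMDiff_circleExp.contMDiffAt.comp v ((hb v hv').2.contDiffAt).contMDiffAt
    | succ n ih =>
      intro v hv
      have := ((ih _ (half n v hv)).comp v half'.contMDiffAt)
      exact (this.pow 2).mul ((hk.comp half').contMDiffAt)
  -- Any stage whose ball contains `v` would do; m < 2ᵐ shows that the ceiling of ‖v‖/r is large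
  -- enough.
  let N : V → ℕ := fun v => ⌈‖v‖ / r⌉₊
  have hN : ∀ v, ‖v‖ < 2 ^ N v * r := fun v => by
    rw [← div_lt_iff₀ hr]
    calc ‖v‖ / r ≤ N v := Nat.le_ceil _
      _ < 2 ^ N v := by exact_mod_cast Nat.lt_two_pow_self
  have key : ∀ n v, ‖v‖ < 2 ^ n * r → σ (N v) v = σ n v := fun n v hv => by
    rcases le_total n (N v) with h | h
    · exact σm _ _ v h hv
    · exact (σm _ _ v h (hN v)).symm
  refine ⟨fun v => σ (N v) v, fun v => ?_, ?_, fun v => ?_⟩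
  · refine (σa _ v (hN v)).congr_of_eventuallyEq ?_
    have : ∀ᶠ w in 𝓝 v, ‖w‖ < 2 ^ N v * r :=
      continuous_norm.continuousAt.eventually_lt continuousAt_const (hN v)
    filter_upwards [this] with w hw using key _ w hw
  · have : σ (N 0) 0 = σ 0 0 := key 0 0 (by simpa using hr)
    change σ (N 0) 0 = 1
    rw [this]
    change Circle.exp (h 0) = 1
    rw [hh0, Circle.exp_zero]
  · change σ (N _) _ = σ (N v) v ^ 2 * k v
    have e : ‖(2 : ℝ) • v‖ < 2 ^ (N v + 1) * r := by
      rw [norm_smul, Real.norm_ofNat, pow_succ]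
      linarith [hN v]
    rw [key _ _ e, σs, smul_smul, inv_mul_cancel₀ two_ne_zero, one_smul]

/-- Two-cocycles of an abelian group with values in the circle, for the trivial action. -/
theorem symmetric_cocycle_double {A : Type*} [AddCommGroup A] {k : A → A → Circle}
    (hk : ∀ x y z, k x y * k (x + y) z = k y z * k x (y + z)) (hs : ∀ x y, k x y = k y x) (x y : A) :
    k (x + x) (y + y) * k x x * k y y = k x y ^ 2 * k (x + y) (x + y) := by
  -- The outcome says that k(2x, 2y) and k(x, y)² differ by the coboundary of the diagonal x ↦ k(x,
  -- x).
  have h1 := hk x x (y + y)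
  have h2 := hk x y y
  have h3 := hk x y (x + y)
  rw [hs y (x + y), ← add_assoc y x y, add_comm y x, add_assoc x y y] at h3
  calc k (x + x) (y + y) * k x x * k y y = (k x x * k (x + x) (y + y)) * k y y := by
        rw [mul_comm (k x x)]
    _ = (k y y * k x (y + y)) * k x (x + (y + y)) := by
        rw [h1, mul_comm _ (k y y), ← mul_assoc]
    _ = k x y * (k (x + y) y * k x (x + (y + y))) := by rw [← h2, mul_assoc]
    _ = _ := by rw [← h3, sq, mul_assoc]

/-- A symmetric analytic two-cocycle of a vector space with values in the circle is the coboundary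
of an analytic function. -/
theorem exists_coboundary_of_symmetric {k : V → V → Circle}
    (ha : ContMDiff 𝓘(ℝ, V × V) (𝓡 1) ω fun p : V × V => k p.1 p.2)
    (hk : ∀ x y z, k x y * k (x + y) z = k y z * k x (y + z)) (hs : ∀ x y, k x y = k y x)
    (h0 : ∀ x, k x 0 = 1) :
    ∃ η : V → Circle, ContMDiff 𝓘(ℝ, V) (𝓡 1) ω η ∧ η 0 = 1 ∧
      ∀ x y, η x * η y * k x y = η (x + y) := by
  have h0' : ∀ x, k 0 x = 1 := fun x => by rw [hs, h0]
  -- A normalised cocycle is 1 on both axes of V × V, so its derivative at the origin vanishes, in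
  -- particular along the diagonal. This is the second-order condition for the doubling equation.
  have hd : HasFDerivAt (fun v : V => Complex.arg (k v v)) (0 : V →L[ℝ] ℝ) 0 := by
    have hD := ((contDiffAt_arg_circle (ha (0 : V × V)) (h0 0)).differentiableAt
      (by simp)).hasFDerivAt
    set M := fderiv ℝ (fun w : V × V => Complex.arg (k w.1 w.2)) 0 with hM
    have hl : M.comp (ContinuousLinearMap.inl ℝ V V) = 0 := by
      have h1 : HasFDerivAt ((fun w : V × V => Complex.arg (k w.1 w.2)) ∘
          (ContinuousLinearMap.inl ℝ V V)) (M.comp (ContinuousLinearMap.inl ℝ V V)) 0 :=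
        HasFDerivAt.comp (0 : V) hD (ContinuousLinearMap.hasFDerivAt _)
      refine h1.unique ?_
      have : ((fun w : V × V => Complex.arg (k w.1 w.2)) ∘
          (ContinuousLinearMap.inl ℝ V V)) = fun _ => 0 := by
        funext x; simp [h0]
      rw [this]
      exact hasFDerivAt_const _ _
    have hr : M.comp (ContinuousLinearMap.inr ℝ V V) = 0 := by
      have h1 : HasFDerivAt ((fun w : V × V => Complex.arg (k w.1 w.2)) ∘
          (ContinuousLinearMap.inr ℝ V V)) (M.comp (ContinuousLinearMap.inr ℝ V V)) 0 :=
        HasFDerivAt.comp (0 : V) hD (ContinuousLinearMap.hasFDerivAt _)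
      refine h1.unique ?_
      have : ((fun w : V × V => Complex.arg (k w.1 w.2)) ∘
          (ContinuousLinearMap.inr ℝ V V)) = fun _ => 0 := by
        funext x; simp [h0']
      rw [this]
      exact hasFDerivAt_const _ _
    have hM0 : M = 0 := by
      refine ContinuousLinearMap.ext fun ⟨x, y⟩ => ?_
      have e1 := congrArg (fun f : V →L[ℝ] ℝ => f x) hl
      have e2 := congrArg (fun f : V →L[ℝ] ℝ => f y) hr
      simp only [ContinuousLinearMap.comp_apply, ContinuousLinearMap.inl_apply,
        ContinuousLinearMap.inr_apply, zero_apply] at e1 e2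
      have : ((x, y) : V × V) = (x, 0) + (0, y) := by simp
      rw [this, map_add, e1, e2]; simp
    have h2 : HasFDerivAt ((fun w : V × V => Complex.arg (k w.1 w.2)) ∘
        ((ContinuousLinearMap.id ℝ V).prod (ContinuousLinearMap.id ℝ V)))
        (M.comp ((ContinuousLinearMap.id ℝ V).prod (ContinuousLinearMap.id ℝ V))) 0 :=
      HasFDerivAt.comp (0 : V) hD (ContinuousLinearMap.hasFDerivAt _)
    rw [hM0, ContinuousLinearMap.zero_comp] at h2
    exact h2
  have diag : ContMDiff 𝓘(ℝ, V) 𝓘(ℝ, V × V) ω fun v : V => (v, v) :=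
    (contDiff_id.prodMk contDiff_id).contMDiff
  obtain ⟨η, hη, hη0, h2⟩ := exists_circle_two_smul (ha.comp diag) (h0 0) hd
  simp only [Function.comp_apply] at h2
  -- `F` is the cocycle corrected by the coboundary of the candidate primitive. Since η(2v) = η(v)²
  -- k(v, v), the identity for doubled cocycles turns into F(2p) = F(p)², so `F` is the exponential
  -- of a linear functional.
  let F : V × V → Circle := fun p => k p.1 p.2 * η p.1 * η p.2 * (η (p.1 + p.2))⁻¹
  have c1 : ContMDiff 𝓘(ℝ, V × V) 𝓘(ℝ, V) ω fun p : V × V => p.1 := contDiff_fst.contMDiff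
  have c2 : ContMDiff 𝓘(ℝ, V × V) 𝓘(ℝ, V) ω fun p : V × V => p.2 := contDiff_snd.contMDiff
  have hF : ContMDiff 𝓘(ℝ, V × V) (𝓡 1) ω F :=
    ((ha.mul (hη.comp c1)).mul (hη.comp c2)).mul (hη.comp (c1.add c2)).inv
  obtain ⟨l, hl⟩ := exists_linear_of_map_two_smul (hF 0) fun p => by
    have e := symmetric_cocycle_double hk hs p.1 p.2
    simp only [← two_smul ℝ] at e
    simp only [F, Prod.smul_fst, Prod.smul_snd, h2, ← smul_add]
    simp only [mul_pow, mul_inv, inv_pow]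
    calc k ((2 : ℝ) • p.1) ((2 : ℝ) • p.2) * (η p.1 ^ 2 * k p.1 p.1) * (η p.2 ^ 2 * k p.2 p.2) *
          ((η (p.1 + p.2) ^ 2)⁻¹ * (k (p.1 + p.2) (p.1 + p.2))⁻¹)
        = (k ((2 : ℝ) • p.1) ((2 : ℝ) • p.2) * k p.1 p.1 * k p.2 p.2) * η p.1 ^ 2 * η p.2 ^ 2 *
          ((η (p.1 + p.2) ^ 2)⁻¹ * (k (p.1 + p.2) (p.1 + p.2))⁻¹) := by
            simp only [mul_assoc, mul_left_comm, mul_comm]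
      _ = k p.1 p.2 ^ 2 * η p.1 ^ 2 * η p.2 ^ 2 * (η (p.1 + p.2) ^ 2)⁻¹ := by
            rw [e]
            rw [← mul_inv_cancel_right (k p.1 p.2 ^ 2) (k (p.1 + p.2) (p.1 + p.2))]
            simp only [mul_assoc, mul_left_comm, mul_comm, mul_inv_cancel_left]
  refine ⟨η, hη, hη0, fun x y => ?_⟩
  -- Triviality on both axes is enough, as the exponential of a linear functional is multiplicative
  -- on (x, 0) + (0, y).
  have ex : F (x, 0) = 1 := by simp [F, h0, hη0]
  have ey : F (0, y) = 1 := by simp [F, h0', hη0]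
  have exy : F (x, y) = 1 := by
    have : ((x, y) : V × V) = (x, 0) + (0, y) := by simp
    rw [hl] at ex ey
    rw [hl, this, map_add, Circle.exp_add, ex, ey, one_mul]
  have := mul_inv_eq_one.mp exy
  simp only at this
  rw [← this]
  simp only [mul_comm, mul_left_comm]

end CircleValued

/-! ### Normal form of cocycles on E ⋊ {±1} -/

theorem mul_coboundary_aux {B : Type*} [CommGroup B] {a b c ab bc abc k₁ k₂ k₃ k₄ : B}
    (h : k₁ * k₂ = k₃ * k₄) : a * b * k₁ * ab⁻¹ * (ab * c * k₂ * abc⁻¹) =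
      b * c * k₃ * bc⁻¹ * (a * bc * k₄ * abc⁻¹) := by
  have h' := congrArg Additive.ofMul h
  apply Additive.ofMul.injective
  simp only [ofMul_mul, ofMul_inv] at h' ⊢
  linear_combination (norm := abel) h'

theorem exists_circle_sq (z : Circle) : ∃ w : Circle, w * w = z :=
  ⟨Circle.exp (Complex.arg z / 2), by rw [← Circle.exp_add, add_halves, Circle.exp_arg]⟩

namespace PMSemidirect

section Cocycle

variable {A B : Type*} [AddCommGroup A] [CommGroup B]

theorem mk_mul_mk (x y : A) (ε δ : ℤˣ) : mk x ε * mk y δ = mk (x + ε • y) (ε * δ) := rfl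

@[simp] theorem mk_one_mul_mk (x y : A) (δ : ℤˣ) : mk x 1 * mk y δ = mk (x + y) δ := by
  simp [mk_mul_mk]

@[simp] theorem mk_neg_one_mul_mk (x y : A) (δ : ℤˣ) : mk x (-1) * mk y δ = mk (x - y) (-δ) := by
  simp [mk_mul_mk, sub_eq_add_neg]

@[simp] theorem mk_zero_one : mk (0 : A) 1 = 1 := rfl

theorem eq_mk_or (p : PMSemidirect A) : p = mk p.1 1 ∨ p = mk p.1 (-1) := by
  rcases Int.units_eq_one_or p.2 with h | h
  · exact Or.inl (PMSemidirect.ext rfl h)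
  · exact Or.inr (PMSemidirect.ext rfl h)

variable {k : PMSemidirect A → PMSemidirect A → B}

/-- A two-cocycle of `A ⋊ {±1}` which is trivial on `A`, on `A × (0, -1)` and at `(0, -1)` is given
by a character of `A`. -/
theorem cocycle_normal_form (hk : ∀ x y z, k x y * k (x * y) z = k y z * k x (y * z))
    (h1 : ∀ x y, k (mk x 1) (mk y 1) = 1) (h2 : ∀ x, k (mk x 1) (mk 0 (-1)) = 1)
    (h3 : k (mk 0 (-1)) (mk 0 (-1)) = 1) :
    (∀ x y, k (mk 0 (-1)) (mk (x + y) 1) = k (mk 0 (-1)) (mk x 1) * k (mk 0 (-1)) (mk y 1)) ∧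
    ∀ p q, k p q = if p.2 = 1 then 1 else k (mk 0 (-1)) (mk q.1 1) := by
  -- Writing (x, -1) = (x, 1)(0, -1) and applying the cocycle identity to such factorisations
  -- reduces every value to one at (0, -1) against A.
  have e1 : ∀ x y, k (mk x 1) (mk y (-1)) = 1 := fun x y => by
    have := hk (mk x 1) (mk y 1) (mk 0 (-1))
    simp only [mk_one_mul_mk, h1, h2, one_mul, add_zero] at this
    exact this.symm
  have e2 : ∀ x y, k (mk x (-1)) (mk y 1) = k (mk 0 (-1)) (mk y 1) := fun x y => by
    have := hk (mk x 1) (mk 0 (-1)) (mk y 1)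
    simpa only [mk_one_mul_mk, mk_neg_one_mul_mk, e1, h2, one_mul, mul_one, add_zero] using this
  have e3 : ∀ x, k (mk x (-1)) (mk 0 (-1)) = 1 := fun x => by
    have := hk (mk x 1) (mk 0 (-1)) (mk 0 (-1))
    simpa only [mk_one_mul_mk, mk_neg_one_mul_mk, neg_neg, sub_zero, h1, h2, h3, one_mul, mul_one,
      add_zero] using this
  have e4 : ∀ y, k (mk 0 (-1)) (mk y (-1)) = k (mk 0 (-1)) (mk y 1) := fun y => by
    have := hk (mk 0 (-1)) (mk y 1) (mk 0 (-1))
    simp only [mk_one_mul_mk, mk_neg_one_mul_mk, h2, e3, one_mul, mul_one, add_zero] at this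
    exact this.symm
  have e5 : ∀ x y, k (mk x (-1)) (mk y (-1)) = k (mk 0 (-1)) (mk y 1) := fun x y => by
    have := hk (mk x 1) (mk 0 (-1)) (mk y (-1))
    simpa only [mk_one_mul_mk, mk_neg_one_mul_mk, neg_neg, h1, h2, e4, one_mul, mul_one,
      add_zero] using this
  refine ⟨fun x y => ?_, fun p q => ?_⟩
  · have := hk (mk 0 (-1)) (mk x 1) (mk y 1)
    simp only [mk_one_mul_mk, mk_neg_one_mul_mk, h1, one_mul] at this
    rw [← this, e2 (0 - x)]
  · rcases eq_mk_or p with hp | hp <;> rcases eq_mk_or q with hq | hq <;> rw [hp, hq] <;>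
      simp [h1, e1, e2, e5]

end Cocycle

section Analytic

variable {E : Type*} [NormedAddCommGroup E] [NormedSpace ℝ E]

theorem contMDiff_mk_const (ε : ℤˣ) : ContMDiff 𝓘(ℝ, E) (model E) ω fun x : E => mk x ε :=
  contMDiff_mk (contMDiff_id (I := 𝓘(ℝ, E)) (M := E)) continuous_const

/-- Analytic two-cocycles of `E ⋊ {±1}` with values in the circle which are symmetric on `E`, up to
coboundaries. -/
theorem exists_normal_form {k : PMSemidirect E → PMSemidirect E → Circle}
    (ha : ContMDiff ((model E).prod (model E)) (𝓡 1) ω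
      fun p : PMSemidirect E × PMSemidirect E => k p.1 p.2)
    (hk : ∀ x y z, k x y * k (x * y) z = k y z * k x (y * z)) (h1 : ∀ x, k x 1 = 1)
    (hs : ∀ x y, k (mk x 1) (mk y 1) = k (mk y 1) (mk x 1)) :
    ∃ (η : PMSemidirect E → Circle) (l : E →L[ℝ] ℝ), ContMDiff (model E) (𝓡 1) ω η ∧ η 1 = 1 ∧
      ∀ p q, η p * η q * k p q = η (p * q) * if p.2 = 1 then 1 else Circle.exp (l q.1) := by
  have hE : ContMDiff 𝓘(ℝ, E × E) (𝓡 1) ω fun p : E × E => k (mk p.1 1) (mk p.2 1) :=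
    ha.comp (((contMDiff_mk_const 1).comp contDiff_fst.contMDiff).prodMk
      ((contMDiff_mk_const 1).comp contDiff_snd.contMDiff))
  obtain ⟨η₀, hη₀, hη₀0, hη₀k⟩ := exists_coboundary_of_symmetric
    (k := fun x y => k (mk x 1) (mk y 1)) hE
    (fun x y z => by simpa only [mk_one_mul_mk] using hk (mk x 1) (mk y 1) (mk z 1)) hs
    (fun x => h1 _)
  -- The corrected cocycle at (s, s), with s = (0, -1), is w² k(s, s), so `w` must be a square root
  -- of k(s, s)⁻¹.
  obtain ⟨w, hw⟩ := exists_circle_sq (k (mk 0 (-1)) (mk 0 (-1)))⁻¹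
  -- On the second component the value of `η` is forced by requiring the corrected cocycle to be
  -- trivial on pairs ((x, 1), s).
  let η : PMSemidirect E → Circle := fun p =>
    if p.2 = 1 then η₀ p.1 else w * (η₀ p.1 * k (mk p.1 1) (mk 0 (-1)))
  have η1 : ∀ x, η (mk x 1) = η₀ x := fun x => if_pos rfl
  have η2 : ∀ x, η (mk x (-1)) = w * (η₀ x * k (mk x 1) (mk 0 (-1))) := fun x =>
    if_neg (show ¬((-1 : ℤˣ) = 1) by decide)
  have k1 : ∀ x, k (mk 0 1) x = 1 := fun x => by
    have := hk 1 1 x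
    simp only [h1, one_mul] at this
    rw [mk_zero_one]
    exact (left_eq_mul.mp this)
  have ηs : η (mk 0 (-1)) = w := by rw [η2, hη₀0, k1, one_mul, mul_one]
  have hη : ContMDiff (model E) (𝓡 1) ω η := by
    refine contMDiff_of_slices (fun p : PMSemidirect E => p.2) continuous_snd fun c => ?_
    rcases Int.units_eq_one_or c with rfl | rfl
    · exact ⟨fun p => η₀ p.1, hη₀.comp contMDiff_fst, fun x hx => if_pos hx⟩
    · refine ⟨fun p => w * (η₀ p.1 * k (mk p.1 1) (mk 0 (-1))), ?_,
        fun x hx => if_neg (by rw [hx]; decide)⟩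
      exact contMDiff_const.mul ((hη₀.comp contMDiff_fst).mul (ha.comp
        ((contMDiff_mk contMDiff_fst continuous_const).prodMk contMDiff_const)))
  let k' : PMSemidirect E → PMSemidirect E → Circle := fun p q => η p * η q * k p q * (η (p * q))⁻¹
  obtain ⟨hadd, hnf⟩ := cocycle_normal_form (k := k')
    (fun x y z => by
      simp only [k']
      rw [← mul_assoc x y z]
      exact mul_coboundary_aux (hk x y z))
    (fun x y => by
      simp only [k', mk_one_mul_mk, η1]
      rw [hη₀k, mul_inv_cancel])
    (fun x => by
      simp only [k', mk_one_mul_mk, η1, ηs, add_zero, η2]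
      rw [mul_inv_eq_one, mul_comm _ w, mul_assoc])
    (by
      simp only [k', mk_neg_one_mul_mk, η1, ηs, sub_zero, neg_neg, hη₀0, inv_one, mul_one]
      rw [hw, inv_mul_cancel])
  have hT : ContMDiff 𝓘(ℝ, E) (𝓡 1) ω fun x : E => k' (mk 0 (-1)) (mk x 1) := by
    have hm : ContMDiff 𝓘(ℝ, E) (model E) ω fun x : E => mk x 1 := contMDiff_mk_const 1
    have hc : ContMDiff 𝓘(ℝ, E) (model E) ω fun _ : E => (mk 0 (-1) : PMSemidirect E) :=
      contMDiff_const
    exact (((hη.comp hc).mul (hη.comp hm)).mul (ha.comp (hc.prodMk hm))).mul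
      (hη.comp (hc.mul hm)).inv
  -- The surviving obstruction x ↦ k'(s, (x, 1)) is an analytic character of E, hence exponential.
  obtain ⟨l, hl⟩ := exists_linear_of_map_two_smul (hT 0) fun v => by
    rw [two_smul, hadd, sq]
  refine ⟨η, l, hη, hη₀0, fun p q => ?_⟩
  have := hnf p q
  rw [hl] at this
  rw [← this]
  simp only [k']
  rw [mul_comm (η (p * q)), inv_mul_cancel_right]

end Analytic

end PMSemidirect

/-! ### Characters of the lattice and unimodularity -/

namespace CategoricalTorus

/-- The character `t ↦ exp (2 π i t)` of the real line. -/
noncomputable def expTwoPi (t : ℝ) : Circle := Circle.exp (2 * Real.pi * t)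

@[simp] theorem expTwoPi_zero : expTwoPi 0 = 1 := by simp [expTwoPi]

theorem expTwoPi_add (s t : ℝ) : expTwoPi (s + t) = expTwoPi s * expTwoPi t := by
  rw [expTwoPi, mul_add, Circle.exp_add]; rfl

theorem expTwoPi_neg (t : ℝ) : expTwoPi (-t) = (expTwoPi t)⁻¹ := by
  rw [expTwoPi, mul_neg, Circle.exp_neg]; rfl

theorem expTwoPi_sub (s t : ℝ) : expTwoPi (s - t) = expTwoPi s * (expTwoPi t)⁻¹ := by
  rw [sub_eq_add_neg, expTwoPi_add, expTwoPi_neg]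

@[simp] theorem expTwoPi_intCast (n : ℤ) : expTwoPi n = 1 := Circle.exp_two_pi_mul_int n

theorem expTwoPi_eq_one_iff {t : ℝ} : expTwoPi t = 1 ↔ ∃ n : ℤ, t = n := by
  rw [expTwoPi, Circle.exp_eq_one]
  refine exists_congr fun n => ?_
  rw [mul_comm (2 * Real.pi)]
  exact mul_left_inj' (by positivity)

theorem expTwoPi_surjective : Function.Surjective expTwoPi := fun z =>
  ⟨Complex.arg z / (2 * Real.pi), by
    rw [expTwoPi, mul_div_cancel₀ _ (by positivity), Circle.exp_arg]⟩

theorem exp_eq_expTwoPi (t : ℝ) : Circle.exp t = expTwoPi ((2 * Real.pi)⁻¹ * t) := by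
  rw [expTwoPi, mul_inv_cancel_left₀ (by positivity)]

theorem contMDiff_expTwoPi_comp {V : Type*} [NormedAddCommGroup V] [NormedSpace ℝ V] {f : V → ℝ}
    (hf : ContDiff ℝ ω f) : ContMDiff 𝓘(ℝ, V) (𝓡 1) ω fun v => expTwoPi (f v) :=
  contMDiff_circleExp.comp (contDiff_const.mul hf).contMDiff

/-- A real number all of whose quotients by positive integers are integers vanishes. -/
theorem eq_zero_of_forall_div {t : ℝ} (h : ∀ n : ℕ, ∃ k : ℤ, t / (n + 1) = k) : t = 0 := by
  obtain ⟨n, hn⟩ := exists_nat_gt |t|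
  obtain ⟨k, hk⟩ := h n
  have hpos : (0 : ℝ) < n + 1 := by positivity
  have h1 : |(k : ℝ)| < 1 := by
    rw [← hk, abs_div, abs_of_pos hpos, div_lt_one hpos]
    linarith
  have h2 : k = 0 := by
    rw [← Int.abs_lt_one_iff]
    exact_mod_cast h1
  rw [h2, Int.cast_zero, div_eq_zero_iff] at hk
  exact hk.resolve_right hpos.ne'

section Lattice

variable {E : Type*} [NormedAddCommGroup E] [NormedSpace ℝ E] [FiniteDimensional ℝ E]
  (L : Submodule ℤ E) [DiscreteTopology L] [IsZLattice ℝ L]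

theorem linearMap_ext_lattice {F : Type*} [AddCommGroup F] [Module ℝ F] {f g : E →ₗ[ℝ] F}
    (h : ∀ m : L, f m = g m) : f = g :=
  LinearMap.ext_on (IsZLattice.span_top (K := ℝ) (L := L)) fun x hx => h ⟨x, hx⟩

theorem bilin_ext_lattice {F : Type*} [AddCommGroup F] [Module ℝ F] {f g : E →ₗ[ℝ] E →ₗ[ℝ] F}
    (h : ∀ m n : L, f m n = g m n) : f = g :=
  linearMap_ext_lattice L fun m => linearMap_ext_lattice L fun n => h m n

theorem exists_linear_extension {F : Type*} [AddCommGroup F] [Module ℝ F] (g : L →ₗ[ℤ] F) :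
    ∃ A : E →ₗ[ℝ] F, ∀ m : L, A m = g m := by
  have := ZLattice.module_free ℝ L
  have := ZLattice.module_finite ℝ L
  let b := Module.Free.chooseBasis ℤ L
  let B := b.ofZLatticeBasis ℝ L
  have hB : ∀ i, B i = b i := b.ofZLatticeBasis_apply ℝ L
  refine ⟨B.constr ℝ fun i => g (b i), fun m => ?_⟩
  have hb : ∀ i, B.constr ℝ (fun i => g (b i)) (b i : E) = g (b i) := fun i => by
    rw [← hB i, Module.Basis.constr_basis]
  conv_lhs => rw [← b.sum_repr m]
  conv_rhs => rw [← b.sum_repr m]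
  simp only [Submodule.coe_sum, Submodule.coe_smul, map_sum, map_zsmul, hb]

/-- Characters of a lattice are restrictions of exponentials of linear functionals. -/
theorem exists_linear_of_character (χ : L → Circle) (h : ∀ m n, χ (m + n) = χ m * χ n) :
    ∃ a : E →ₗ[ℝ] ℝ, ∀ m : L, χ m = expTwoPi (a m) := by
  have := ZLattice.module_free ℝ L
  have := ZLattice.module_finite ℝ L
  let b := Module.Free.chooseBasis ℤ L
  -- Logarithms are chosen on a ℤ-basis only; they are extended linearly, and two characters
  -- agreeing on a basis coincide.
  choose t ht using fun i => expTwoPi_surjective (χ (b i))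
  obtain ⟨a, ha⟩ := exists_linear_extension L (b.constr ℤ t)
  refine ⟨a, fun m => ?_⟩
  let f : L →+ Additive Circle := AddMonoidHom.mk' (fun m => Additive.ofMul (χ m)) fun m n => by
    rw [h, ofMul_mul]
  let g : L →+ Additive Circle := AddMonoidHom.mk'
    (fun m => Additive.ofMul (expTwoPi (a m))) fun m n => by
    rw [Submodule.coe_add, map_add, expTwoPi_add, ofMul_mul]
  have hfg : f.toIntLinearMap = g.toIntLinearMap := b.ext fun i => by
    change Additive.ofMul (χ (b i)) = Additive.ofMul (expTwoPi (a (b i)))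
    rw [ha, Module.Basis.constr_basis, ht]
  exact Additive.ofMul.injective (LinearMap.congr_fun hfg m)

variable {L}
variable {I J : L →ₗ[ℤ] L →ₗ[ℤ] ℤ}

theorem extend_eq_add_flip (hIJ : ∀ m n, I m n = J m n + J n m) (x y : E) :
    extend L I x y = extend L J x y + extend L J y x := by
  have : extend L I = extend L J + (extend L J).flip := bilin_ext_lattice L fun m n => by
    rw [LinearMap.add_apply, LinearMap.add_apply, LinearMap.flip_apply, extend_apply, extend_apply,
      extend_apply, hIJ, Int.cast_add]
  rw [this]; rfl

/-- Functionals which are integral on a unimodular lattice are represented by lattice vectors. -/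
theorem exists_eq_extend_of_integral (hI : Function.Bijective I) (b : E →ₗ[ℝ] ℝ)
    (h : ∀ m : L, ∃ n : ℤ, b m = n) : ∃ p : L, ∀ x, b x = extend L I (p : E) x := by
  choose n hn using h
  let f : L →ₗ[ℤ] ℤ := AddMonoidHom.toIntLinearMap (AddMonoidHom.mk' n fun m m' => by
    have := hn (m + m')
    rw [Submodule.coe_add, map_add, hn, hn] at this
    exact_mod_cast this.symm)
  obtain ⟨p, hp⟩ := hI.2 f
  refine ⟨p, fun x => ?_⟩
  have : b = extend L I (p : E) := linearMap_ext_lattice L fun m => by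
    rw [extend_apply, hp, hn]; rfl
  rw [this]

/-- A unimodular lattice is its own dual: I(x, ·) is represented by some lattice vector `p`, and
nondegeneracy over ℝ forces x = p. -/
theorem mem_lattice_of_integral (hI : Function.Bijective I) (hs : ∀ m n, I m n = I n m) (x : E)
    (h : ∀ m : L, ∃ n : ℤ, extend L I x m = n) : x ∈ L := by
  obtain ⟨p, hp⟩ := exists_eq_extend_of_integral hI (extend L I x) h
  -- nondegeneracy of `I` over the reals
  have flip : ∀ y z, extend L I y z = extend L I z y := fun y z => by
    have : extend L I = (extend L I).flip := bilin_ext_lattice L fun m n => by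
      rw [LinearMap.flip_apply, extend_apply, extend_apply, hs]
    conv_lhs => rw [this]
    rfl
  have sep : ∀ y, (∀ z, extend L I y z = 0) → y = 0 := by
    intro y hy
    have := ZLattice.module_free ℝ L
    have := ZLattice.module_finite ℝ L
    let b := Module.Free.chooseBasis ℤ L
    let B := b.ofZLatticeBasis ℝ L
    have hB : ∀ i, B i = b i := b.ofZLatticeBasis_apply ℝ L
    refine B.repr.map_eq_zero_iff.mp (Finsupp.ext fun i => ?_)
    -- Each coordinate functional is itself of the form I(q, ·), so a vector orthogonal to
    -- everything has all coordinates zero.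
    obtain ⟨q, hq⟩ := hI.2 (b.coord i)
    have e : B.coord i = extend L I (q : E) := linearMap_ext_lattice L fun m => by
      rw [extend_apply, hq]
      change B.repr (m : E) i = _
      rw [Module.Basis.coord_apply]
      exact b.ofZLatticeBasis_repr_apply ℝ L m i
    change B.coord i y = 0
    rw [e, flip, hy]
  have : x - p = 0 := sep _ fun z => by
    rw [map_sub, LinearMap.sub_apply, hp, sub_self]
  rw [sub_eq_zero.mp this]
  exact p.2

end Lattice

/-! ### The groups π₀ and π₁ of 𝒯 ⋊ {±1} -/

section Torus

variable {E : Type*} [NormedAddCommGroup E] [NormedSpace ℝ E] [FiniteDimensional ℝ E]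
  {L : Submodule ℤ E} [DiscreteTopology L] [IsZLattice ℝ L] {I J : L →ₗ[ℤ] L →ₗ[ℤ] ℤ}

open PMSemidirect

theorem thetaPrime_hom (a : Arrows L) :
    (thetaPrime L J).hom a = mk ((Multiplicative.toAdd a.1 : L) : E) 1 := rfl

theorem thetaPrime_act (a : Arrows L) (x : PMSemidirect E) : (thetaPrime L J).act a x =
    (Multiplicative.ofAdd (x.2 • Multiplicative.toAdd a.1),
      a.2 * expTwoPi (extend L J (Multiplicative.toAdd a.1 : L) x.1)) := rfl

theorem thetaPrime_hom_eq_one {a : Arrows L} : (thetaPrime L J).hom a = 1 ↔ a.1 = 1 := by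
  constructor
  · intro h
    have h' : ((Multiplicative.toAdd a.1 : L) : E) = 0 := congrArg Prod.fst h
    have : Multiplicative.toAdd a.1 = 0 := Subtype.ext h'
    exact this
  · intro h
    rw [thetaPrime_hom, h]; rfl

theorem thetaPrime_act_central (z : Circle) (x : PMSemidirect E) :
    (thetaPrime L J).act (1, z) x = (1, z) :=
  CrossedModule.IsCentral.act_eq _ _ (thetaPrime_hom_eq_one.mpr rfl)

/-- A continuous map to the lattice from a connected space is constant. -/
theorem continuous_lattice_const {X : Type*} [TopologicalSpace X] [PreconnectedSpace X]
    {f : X → Multiplicative L} (hf : Continuous f) (x y : X) : f x = f y :=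
  PreconnectedSpace.constant (Y := Multiplicative L) inferInstance hf

variable (L J) in
/-- `π₁(𝒯 ⋊ {±1}) ≅ U(1)`. -/
noncomputable def circleEquivPi1 : Circle ≃* TorusPi1 L J where
  toFun z := ⟨(1, z), MonoidHom.mem_ker.mpr (thetaPrime_hom_eq_one.mpr rfl)⟩
  invFun a := a.1.2
  left_inv _ := rfl
  right_inv a := Subtype.ext (Prod.ext (thetaPrime_hom_eq_one.mp (MonoidHom.mem_ker.mp a.2)).symm rfl)
  map_mul' _ _ := Subtype.ext (Prod.ext (mul_one _).symm rfl)

theorem pi1Invariants_eq_top : (thetaPrime L J).pi1Invariants = ⊤ :=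
  eq_top_iff.mpr fun a _ _ => Subtype.ext
    (CrossedModule.IsCentral.act_eq _ _ (MonoidHom.mem_ker.mp a.2))

variable (L J) in
/-- `π₀(𝒯 ⋊ {±1}) ≅ T ⋊ {±1}`. -/
noncomputable def pi0EquivTorus : TorusPi0 L J ≃* PMSemidirect (E ⧸ L) :=
  let f : PMSemidirect E →* PMSemidirect (E ⧸ L) :=
    { toFun := fun p => mk (Submodule.Quotient.mk p.1) p.2
      map_one' := rfl
      map_mul' := fun p q => PMSemidirect.ext (by
        rcases Int.units_eq_one_or p.2 with h | h <;> simp [h, sub_eq_add_neg]) rfl }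
  have hf : f.ker = (thetaPrime L J).hom.range := by
    ext p
    rw [MonoidHom.mem_ker]
    constructor
    · intro h
      have h1 : (Submodule.Quotient.mk p.1 : E ⧸ L) = 0 := congrArg Prod.fst h
      have h2 : p.2 = 1 := congrArg Prod.snd h
      exact ⟨(Multiplicative.ofAdd ⟨p.1, (Submodule.Quotient.mk_eq_zero L).mp h1⟩, 1),
        PMSemidirect.ext rfl h2.symm⟩
    · rintro ⟨a, rfl⟩
      exact PMSemidirect.ext ((Submodule.Quotient.mk_eq_zero L).mpr
        (Multiplicative.toAdd a.1 : L).2) rfl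
  (QuotientGroup.quotientMulEquivOfEq hf.symm).trans
    (QuotientGroup.quotientKerEquivOfSurjective f fun p => by
      obtain ⟨x, hx⟩ := Submodule.Quotient.mk_surjective L p.1
      exact ⟨mk x p.2, PMSemidirect.ext hx rfl⟩)

theorem pi0EquivTorus_cls (x : E) (ε : ℤˣ) :
    pi0EquivTorus L J ((thetaPrime L J).cls (mk x ε)) = mk (Submodule.Quotient.mk x) ε := rfl

end Torus

end CategoricalTorus

namespace CategoricalTorus

open PMSemidirect

variable {E : Type*} [NormedAddCommGroup E] [NormedSpace ℝ E] [FiniteDimensional ℝ E]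
  {L : Submodule ℤ E} [DiscreteTopology L] [IsZLattice ℝ L] {I J : L →ₗ[ℤ] L →ₗ[ℤ] ℤ}

/-! ### Crossed homomorphisms from π₀ to π₁ -/

section CrossedHoms

/-- The inclusion of the group of signs into the circle. -/
noncomputable def signCircle : ℤˣ →* Circle where
  toFun δ := ⟨((δ : ℤ) : ℂ), by
    rcases Int.units_eq_one_or δ with rfl | rfl <;>
      exact mem_sphere_zero_iff_norm.mpr (by simp)⟩
  map_one' := Circle.ext (by simp)
  map_mul' δ ε := Circle.ext (by
    change (((δ * ε : ℤˣ) : ℤ) : ℂ) = ((δ : ℤ) : ℂ) * ((ε : ℤ) : ℂ)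
    push_cast
    rfl)

theorem coe_signCircle (δ : ℤˣ) : (signCircle δ : ℂ) = ((δ : ℤ) : ℂ) := rfl

theorem pi1Act_eq (a : TorusPi1 L J) (x : PMSemidirect E) : (thetaPrime L J).pi1Act a x = a :=
  Subtype.ext (CrossedModule.IsCentral.act_eq _ _ (MonoidHom.mem_ker.mp a.2))

variable (L J) in
/-- The homomorphism `(x, ε) ↦ 1` or `(x, ε) ↦ ε`. -/
noncomputable def signCross : ℤˣ →* Cross L J where
  toFun δ :=
    { toFun := fun c => circleEquivPi1 L J
        (signCircle (if (pi0EquivTorus L J c).2 = 1 then 1 else δ))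
      analytic := by
        refine contMDiff_of_slices (fun p : PMSemidirect E => p.2) PMSemidirect.continuous_snd fun c => ?_
        refine ⟨fun _ => (1, signCircle (if c = 1 then 1 else δ)), contMDiff_const, fun x hx => ?_⟩
        rw [← hx]; rfl
      crossed := fun x y => by
        have e : ∀ z, (pi0EquivTorus L J ((thetaPrime L J).cls z)).2 = z.2 := fun _ => rfl
        rw [pi1Act_eq, ← map_mul, ← map_mul, e, e, e, mul_snd]
        congr 2
        rcases Int.units_eq_one_or x.2 with hx | hx <;>
          rcases Int.units_eq_one_or y.2 with hy | hy <;> simp [hx, hy] }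
  map_one' := CrossedModule.PiCross.ext (funext fun c => by
    change circleEquivPi1 L J (signCircle (if (pi0EquivTorus L J c).2 = 1 then 1 else 1)) = 1
    simp)
  map_mul' δ ε := CrossedModule.PiCross.ext (funext fun c => by
    change circleEquivPi1 L J (signCircle (if (pi0EquivTorus L J c).2 = 1 then 1 else δ * ε)) =
      circleEquivPi1 L J (signCircle (if (pi0EquivTorus L J c).2 = 1 then 1 else δ)) *
      circleEquivPi1 L J (signCircle (if (pi0EquivTorus L J c).2 = 1 then 1 else ε))
    split_ifs <;> simp)

theorem signCross_apply (δ : ℤˣ) (x : E) (ε : ℤˣ) :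
    ((signCross L J δ).toFun ((thetaPrime L J).cls (mk x ε)) : Arrows L) =
      (1, signCircle (if ε = 1 then 1 else δ)) := rfl

/-- With π₁ central, crossed homomorphisms are characters of E ⋊ {±1}. Conjugation by (0, -1)
inverts E, so a character squares to 1 on E; E is divisible by 2, so it is trivial there, and its
value at the involution (0, -1) is a sign. -/
theorem signCross_bijective : Function.Bijective (signCross L J) := by
  constructor
  · intro δ ε h
    have h1 := congrArg (fun χ : Cross L J =>
      ((χ.toFun ((thetaPrime L J).cls (mk 0 (-1))) : Arrows L).2 : ℂ)) h
    simp only [signCross_apply, coe_signCircle] at h1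
    rw [if_neg (by decide), if_neg (by decide)] at h1
    exact Units.ext (by exact_mod_cast h1)
  · intro χ
    let v : PMSemidirect E → Circle := fun p =>
      (χ.toFun ((thetaPrime L J).cls p) : Arrows L).2
    have hv : ∀ p q, v (p * q) = v p * v q := fun p q => by
      have h1 := χ.crossed p q
      rw [pi1Act_eq] at h1
      exact congrArg (fun a : TorusPi1 L J => (a : Arrows L).2) h1
    have v0 : v (mk 0 1) = 1 := by
      have := hv 1 1
      rw [mul_one] at this
      exact left_eq_mul.mp this
    have v1 : ∀ x, v (mk x 1) = 1 := fun x => by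
      have hs : ∀ y, v (mk y 1) * v (mk y 1) = 1 := fun y => by
        have e1 := hv (mk 0 (-1)) (mk y 1)
        have e2 := hv (mk (-y) 1) (mk 0 (-1))
        have e3 := hv (mk y 1) (mk (-y) 1)
        rw [mk_neg_one_mul_mk, zero_sub] at e1
        rw [mk_one_mul_mk, add_zero, e1, mul_comm] at e2
        rw [mk_one_mul_mk, add_neg_cancel, v0, ← mul_right_cancel e2] at e3
        exact e3.symm
      -- Divisibility: x is twice x/2, so the value at x is a square, already known to be 1.
      have := hs ((2 : ℝ)⁻¹ • x)
      rw [← hv, mk_one_mul_mk, ← two_smul ℝ, smul_smul, mul_inv_cancel₀ two_ne_zero, one_smul] at this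
      exact this
    have vs : v (mk 0 (-1)) * v (mk 0 (-1)) = 1 := by
      rw [← hv, mk_neg_one_mul_mk, sub_zero, neg_neg, v0]
    have vs' : ∃ δ : ℤˣ, signCircle δ = v (mk 0 (-1)) := by
      have : (v (mk 0 (-1)) : ℂ) * v (mk 0 (-1)) = 1 := by
        rw [← Circle.coe_mul, vs, Circle.coe_one]
      rcases mul_self_eq_one_iff.mp this with h | h
      · exact ⟨1, Circle.ext (by rw [coe_signCircle, h]; simp)⟩
      · exact ⟨-1, Circle.ext (by rw [coe_signCircle, h]; simp)⟩
    obtain ⟨δ, hδ⟩ := vs'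
    refine ⟨δ, CrossedModule.PiCross.ext (funext fun c => ?_)⟩
    obtain ⟨p, rfl⟩ := (thetaPrime L J).cls_surjective c
    refine Subtype.ext (Prod.ext ?_ ?_)
    · exact (thetaPrime_hom_eq_one.mp (MonoidHom.mem_ker.mp (Subtype.property _))).symm
    · change _ = v p
      rcases eq_mk_or p with hp | hp <;> rw [hp, signCross_apply]
      · simp [v1]
      · have e : mk p.1 (-1) = mk p.1 1 * mk 0 (-1) := by simp
        rw [e, hv, v1, one_mul, ← hδ]
        rfl

end CrossedHoms

/-! ### The Drinfeld centre in positive rank -/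

section Centre

/-- In positive rank every object of the Drinfeld centre lies over an object isomorphic to the
unit object. -/
theorem centre_pt_mem_range [Nontrivial E] (hIJ : ∀ m n, I m n = J m n + J n m)
    (hI : Function.Bijective I) (p : CrossedModule.CentreObj (model E) arrowsModel (thetaPrime L J)) :
    p.pt ∈ (thetaPrime L J).hom.range := by
  have hξ1 : p.ξ 1 = 1 := p.ξ_one
  have hc : ∀ y : E, (p.ξ (mk y 1)).1 = 1 := fun y => by
    have hcont : Continuous fun y : E => (p.ξ (mk y 1)).1 :=
      _root_.continuous_fst.comp (p.analytic.comp (contMDiff_mk_const 1)).continuous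
    rw [continuous_lattice_const hcont y 0, mk_zero_one, hξ1]; rfl
  obtain ⟨x, ε, hpt⟩ : ∃ x ε, p.pt = mk x ε := ⟨p.pt.1, p.pt.2, rfl⟩
  -- For the sign -1, `conj₀` on E would read -y = y, because `ξ` has no lattice component there; a
  -- nonzero `y` excludes this.
  have hε : ε = 1 := by
    rcases Int.units_eq_one_or ε with h | h
    · exact h
    · exfalso
      obtain ⟨y, hy⟩ := exists_ne (0 : E)
      have h1 := congrArg Prod.fst (p.conj₀ (mk y 1))
      rw [hpt, h, thetaPrime_hom, hc] at h1
      have h2 : -((-1 : ℤˣ) • x) + (-1 : ℤˣ) • y + ((-1 : ℤˣ) * 1) • x = y + (1 : ℤˣ) • (0 : E) := h1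
      simp only [Units.neg_smul, one_smul, neg_neg, mul_one, add_zero] at h2
      have h3 : (2 : ℝ) • y = 0 := by
        rw [two_smul]
        nth_rewrite 1 [← h2]
        abel
      exact hy ((smul_eq_zero.mp h3).resolve_left two_ne_zero)
  subst hε
  let h : E → Circle := fun y => (p.ξ (mk y 1)).2
  have hξ : ∀ y, p.ξ (mk y 1) = (1, h y) := fun y => Prod.ext (hc y) rfl
  have hadd : ∀ y z, h (y + z) = h y * h z := fun y z => by
    have := p.crossed (mk y 1) (mk z 1)
    rw [hξ, hξ, thetaPrime_act_central, mk_one_mul_mk, hξ] at this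
    exact congrArg Prod.snd this
  have h0 : h 0 = 1 := by
    have := hadd 0 0
    rw [add_zero] at this
    exact left_eq_mul.mp this
  -- `conj₀` at (0, -1) identifies the lattice component of ξ(0, -1) as 2x, so `x` is at least half
  -- a lattice vector.
  set n : L := Multiplicative.toAdd (p.ξ (mk 0 (-1))).1 with hn
  have hn2 : (n : E) = x + x := by
    have h1 := congrArg Prod.fst (p.conj₀ (mk 0 (-1)))
    rw [hpt, thetaPrime_hom, ← hn] at h1
    have h2 : -((1 : ℤˣ) • x) + (1 : ℤˣ) • (0 : E) + ((1 : ℤˣ) * (-1)) • x =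
      0 + (-1 : ℤˣ) • (n : E) := h1
    simp only [one_smul, one_mul, Units.neg_smul, add_zero, zero_add] at h2
    rw [← neg_inj, ← h2]; abel
  -- The element (y, -1) is both (y, 1)(0, -1) and (0, -1)(-y, 1). Equating the two values of `ξ`
  -- gives h(y) = e(-J(n, y)) h(-y), and multiplying by h(y) gives the formula.
  have hdouble : ∀ y, h (y + y) = expTwoPi (-extend L J n y) := fun y => by
    have e1 := p.crossed (mk y 1) (mk 0 (-1))
    have e2 := p.crossed (mk 0 (-1)) (mk (-y) 1)
    rw [mk_one_mul_mk, add_zero] at e1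
    rw [mk_neg_one_mul_mk, zero_sub, neg_neg, e1, hξ, thetaPrime_act_central] at e2
    have e3 : h y * (p.ξ (mk 0 (-1))).2 =
      (p.ξ (mk 0 (-1))).2 * expTwoPi (extend L J n (-y)) * (p.ξ (mk (-y) 1)).2 :=
        congrArg Prod.snd e2
    rw [mul_comm, mul_assoc] at e3
    have e4 : h y = expTwoPi (extend L J n (-y)) * h (-y) := mul_left_cancel e3
    rw [hadd]
    nth_rewrite 1 [e4]
    rw [mul_assoc, ← hadd, neg_add_cancel, h0, mul_one, map_neg]
  -- `conj₁` gives e(J(m, x)) = h(m). Evaluating h(m) by doubling m/2, with n = 2x, yields e(-J(x,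
  -- m)), so I(x, m) is an integer and self-duality applies.
  have hx : x ∈ L := by
    refine mem_lattice_of_integral hI (fun m n => by rw [hIJ, hIJ, add_comm]) x fun m => ?_
    rw [extend_eq_add_flip hIJ]
    refine expTwoPi_eq_one_iff.mp ?_
    have e1 := congrArg Prod.snd (p.conj₁ (Multiplicative.ofAdd m, 1))
    rw [hpt, thetaPrime_hom] at e1
    have e2 : 1 * expTwoPi (extend L J m x) = 1 * h m := e1
    have e3 : ((2 : ℝ)⁻¹ • (m : E)) + (2 : ℝ)⁻¹ • (m : E) = m := by
      rw [← add_smul]; norm_num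
    rw [one_mul, one_mul, ← e3, hdouble, e3, hn2] at e2
    rw [expTwoPi_add, e2, ← expTwoPi_add]
    rw [map_add, LinearMap.add_apply, map_smul, smul_eq_mul, expTwoPi_eq_one_iff]
    exact ⟨0, by push_cast; ring⟩
  exact ⟨(Multiplicative.ofAdd ⟨x, hx⟩, 1), hpt.symm⟩

theorem centreToTorus_eq_one [Nontrivial E] (hIJ : ∀ m n, I m n = J m n + J n m)
    (hI : Function.Bijective I) (c : CentrePi0 L J) : centreToTorus L J c = 1 := by
  obtain ⟨p, rfl⟩ := QuotientGroup.mk_surjective c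
  exact (QuotientGroup.eq_one_iff _).mpr (centre_pt_mem_range hIJ hI p)

/-- By exactness, injectivity is the invariance of π₁ and surjectivity is the triviality of the map
from π₀ of the centre to π₀. -/
theorem crossToCentre_bijective [Nontrivial E] (hIJ : ∀ m n, I m n = J m n + J n m)
    (hI : Function.Bijective I) : Function.Bijective (crossToCentre L J) := by
  constructor
  · rw [← MonoidHom.ker_eq_bot_iff, ← CrossedModule.range_pi1ToCross, MonoidHom.range_eq_bot_iff,
      ← MonoidHom.ker_eq_top_iff, ← CrossedModule.pi1Invariants_eq_ker, pi1Invariants_eq_top]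
  · rw [← MonoidHom.range_eq_top, CrossedModule.range_crossToPi0Centre, MonoidHom.ker_eq_top_iff]
    exact MonoidHom.ext (centreToTorus_eq_one hIJ hI)

theorem torusToAut_injective [Nontrivial E] (hIJ : ∀ m n, I m n = J m n + J n m)
    (hI : Function.Bijective I) : Function.Injective (torusToAut L J) := by
  rw [← MonoidHom.ker_eq_bot_iff, ← CrossedModule.range_pi0Forget, MonoidHom.range_eq_bot_iff]
  exact MonoidHom.ext (centreToTorus_eq_one hIJ hI)

end Centre

end CategoricalTorus

/-! ### The isometry underlying a weak automorphism -/

namespace CategoricalTorus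

open PMSemidirect

variable {E : Type*} [NormedAddCommGroup E] [NormedSpace ℝ E] [FiniteDimensional ℝ E]
  {L : Submodule ℤ E} [DiscreteTopology L] [IsZLattice ℝ L] {I J : L →ₗ[ℤ] L →ₗ[ℤ] ℤ}

/-- Weak endomorphisms of `𝒯 ⋊ {±1}`. -/
noncomputable abbrev TorusEnd (J : L →ₗ[ℤ] L →ₗ[ℤ] ℤ) : Type _ :=
  CrossedModule.WeakEnd (model E) arrowsModel (thetaPrime L J)

namespace TorusEnd

variable (f : TorusEnd J)

theorem continuous_map₀ (ε : ℤˣ) : Continuous fun x : E => f.map₀ (mk x ε) :=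
  (f.analytic₀.comp (contMDiff_mk_const ε)).continuous

theorem contMDiff_κ (ε δ : ℤˣ) : ContMDiff 𝓘(ℝ, E × E) arrowsModel ω
    fun p : E × E => f.κ (mk p.1 ε) (mk p.2 δ) :=
  f.κ_comp_analytic ((contMDiff_mk_const ε).comp contDiff_fst.contMDiff)
    ((contMDiff_mk_const δ).comp contDiff_snd.contMDiff)

/-- A lattice-valued continuous function on the connected space E × E is constant, so on each pair
of components one value decides. -/
theorem κ_fst_const (ε δ : ℤˣ) (x y : E) :
    (f.κ (mk x ε) (mk y δ)).1 = (f.κ (mk 0 ε) (mk 0 δ)).1 :=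
  continuous_lattice_const (f := fun p : E × E => (f.κ (mk p.1 ε) (mk p.2 δ)).1)
    (_root_.continuous_fst.comp (f.contMDiff_κ ε δ).continuous) (x, y) (0, 0)

theorem κ_fst (x y : E) : (f.κ (mk x 1) (mk y 1)).1 = 1 := by
  rw [κ_fst_const, mk_zero_one, f.κ_one_one]; rfl

theorem map₀_snd (x : E) : (f.map₀ (mk x 1)).2 = 1 := by
  have := PreconnectedSpace.constant (α := E) (Y := ℤˣ) inferInstance
    (PMSemidirect.continuous_snd.comp (f.continuous_map₀ 1)) (x := x) (y := 0)
  simp only [Function.comp_apply, mk_zero_one, f.one₀] at this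
  exact this

/-- The linear map by which a weak endomorphism acts on the component of the unit object. -/
noncomputable def linearPart : E →ₗ[ℝ] E :=
  (AddMonoidHom.toRealLinearMap (AddMonoidHom.mk' (fun x => (f.map₀ (mk x 1)).1) fun x y => by
    have h := congrArg Prod.fst (f.w2 (mk x 1) (mk y 1))
    have hk : (thetaPrime L J).hom (f.κ (mk x 1) (mk y 1)) = 1 :=
      thetaPrime_hom_eq_one.mpr (f.κ_fst x y)
    rw [hk, mul_one, mk_one_mul_mk] at h
    change (f.map₀ (mk x 1)).1 + (f.map₀ (mk x 1)).2 • (f.map₀ (mk y 1)).1 = _ at h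
    rw [map₀_snd, one_smul] at h
    exact h.symm)
    (PMSemidirect.contMDiff_fst.continuous.comp (f.continuous_map₀ 1))).toLinearMap

theorem map₀_mk_one (x : E) : f.map₀ (mk x 1) = mk (f.linearPart x) 1 :=
  PMSemidirect.ext rfl (f.map₀_snd x)

theorem linearPart_apply (m : L) (z : Circle) :
    f.linearPart m = (Multiplicative.toAdd (f.map₁ (Multiplicative.ofAdd m, z)).1 : L) :=
  congrArg Prod.fst (f.w1 (Multiplicative.ofAdd m, z))

/-- The endomorphism of the lattice underlying a weak endomorphism. -/
noncomputable def latticePart : L →ₗ[ℤ] L :=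
  (AddMonoidHom.mk' (fun m => (Multiplicative.toAdd (f.map₁ (Multiplicative.ofAdd m, 1)).1 : L))
    fun m n => Subtype.ext (by
      rw [Submodule.coe_add, ← linearPart_apply, ← linearPart_apply, ← linearPart_apply,
        Submodule.coe_add, map_add])).toIntLinearMap

theorem linearPart_coe (m : L) : f.linearPart m = f.latticePart m := f.linearPart_apply m 1

theorem map₁_fst (a : Arrows L) :
    (f.map₁ a).1 = Multiplicative.ofAdd (f.latticePart (Multiplicative.toAdd a.1)) := by
  have h : (Multiplicative.toAdd (f.map₁ a).1 : L) = f.latticePart (Multiplicative.toAdd a.1) :=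
    Subtype.ext (by rw [← linearPart_coe]; exact (f.linearPart_apply _ a.2).symm)
  exact h

theorem latticePart_mul (g : TorusEnd J) (m : L) :
    (f * g : TorusEnd J).latticePart m = f.latticePart (g.latticePart m) := by
  exact congrArg Multiplicative.toAdd (f.map₁_fst (g.map₁ (Multiplicative.ofAdd m, 1)))

theorem latticePart_one (m : L) : (1 : TorusEnd J).latticePart m = m := rfl

/-- The circle component of `f₁`. -/
noncomputable def phase (m : L) : Circle := (f.map₁ (Multiplicative.ofAdd m, 1)).2

variable {f} in
-- Centre preservation enters through the factorisation (m, z) = (m, 1)(1, z), on which the monoidal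
-- constraint is trivial.
theorem map₁_eq (hf : ∀ a, (thetaPrime L J).hom a = 1 → f.map₁ a = a) (m : L) (z : Circle) :
    f.map₁ (Multiplicative.ofAdd m, z) =
      (Multiplicative.ofAdd (f.latticePart m), f.phase m * z) := by
  refine Prod.ext (f.map₁_fst _) ?_
  have h := f.w3 (Multiplicative.ofAdd m, 1) (1, z)
  have h1 : (thetaPrime L J).hom ((1, z) : Arrows L) = 1 := thetaPrime_hom_eq_one.mpr rfl
  rw [h1, f.κ_one_right, hf _ h1, mul_one] at h
  have h2 : ((Multiplicative.ofAdd m, 1) * (1, z) : Arrows L) = (Multiplicative.ofAdd m, z) :=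
    Prod.ext (mul_one _) (one_mul _)
  rw [h2] at h
  exact (congrArg Prod.snd h).symm

variable {f} in
-- This is `w5` for a lattice arrow against an object of the identity component: the failure of `f`
-- to preserve J is the commutator of the cocycle.
theorem exp_mul_κ (hf : ∀ a, (thetaPrime L J).hom a = 1 → f.map₁ a = a) (m : L) (x : E) :
    expTwoPi (extend L J (f.latticePart m : L) (f.linearPart x)) * (f.κ (mk (m : E) 1) (mk x 1)).2 =
      expTwoPi (extend L J m x) * (f.κ (mk x 1) (mk (m : E) 1)).2 := by
  have h := f.w5 (Multiplicative.ofAdd m, 1) (mk x 1)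
  have e : (thetaPrime L J).act (Multiplicative.ofAdd m, 1) (mk x 1) =
      (Multiplicative.ofAdd m, expTwoPi (extend L J m x)) :=
    Prod.ext (by simp [thetaPrime_act]) (by simp [thetaPrime_act])
  rw [e, map₁_eq hf, map₁_eq hf, map₀_mk_one] at h
  have h2 : f.phase m * 1 * expTwoPi (extend L J (f.latticePart m : L) (f.linearPart x)) *
      (f.κ (mk (m : E) 1) (mk x 1)).2 = f.phase m * expTwoPi (extend L J m x) *
      (f.κ (mk x 1) (mk (m : E) 1)).2 := congrArg Prod.snd h
  rw [mul_one, mul_assoc, mul_assoc] at h2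
  exact mul_left_cancel h2

theorem κ_cocycle (x y z : E) :
    (f.κ (mk x 1) (mk y 1)).2 * (f.κ (mk (x + y) 1) (mk z 1)).2 =
      (f.κ (mk y 1) (mk z 1)).2 * (f.κ (mk x 1) (mk (y + z) 1)).2 := by
  have h := f.w4 (mk x 1) (mk y 1) (mk z 1)
  rw [CrossedModule.IsCentral.act_eq _ _ (thetaPrime_hom_eq_one.mpr (f.κ_fst x y)), mk_one_mul_mk,
    mk_one_mul_mk] at h
  exact congrArg Prod.snd h

/-- The restriction of the extension to the cyclic group generated by `x` is commutative;
inductively, the cocycle identity at (x, nx, x) carries the symmetry from n to n + 1. -/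
theorem κ_comm_nsmul (x : E) (n : ℕ) :
    (f.κ (mk x 1) (mk (n • x) 1)).2 = (f.κ (mk (n • x) 1) (mk x 1)).2 := by
  induction n with
  | zero => rw [zero_smul, mk_zero_one, f.κ_one_left, f.κ_one_right]
  | succ n ih =>
    have h := f.κ_cocycle x (n • x) x
    rw [ih, add_comm x, ← succ_nsmul] at h
    exact (mul_left_cancel h).symm

/-- At x = m/(n+1) the vector m is a multiple of x, so the two cocycle values in `exp_mul_κ` cancel.
What remains says that the defect of J at (m, m), divided by n + 1, is an integer, for every n. -/
theorem isometry_diag (hf : ∀ a, (thetaPrime L J).hom a = 1 → f.map₁ a = a) (m : L) :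
    J (f.latticePart m) (f.latticePart m) = J m m := by
  have key : (J (f.latticePart m) (f.latticePart m) : ℝ) - J m m = 0 := by
    refine eq_zero_of_forall_div fun n => ?_
    have hn : ((n : ℝ) + 1) ≠ 0 := by positivity
    have e : (n + 1) • (((n : ℝ) + 1)⁻¹ • (m : E)) = m := by
      rw [← Nat.cast_smul_eq_nsmul ℝ, smul_smul]
      push_cast
      rw [mul_inv_cancel₀ hn, one_smul]
    have h := exp_mul_κ hf m (((n : ℝ) + 1)⁻¹ • (m : E))
    have h2 := f.κ_comm_nsmul (((n : ℝ) + 1)⁻¹ • (m : E)) (n + 1)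
    rw [e] at h2
    rw [h2] at h
    have h3 := mul_right_cancel h
    rw [map_smul, map_smul, map_smul, linearPart_coe, extend_apply, extend_apply, smul_eq_mul,
      smul_eq_mul, ← mul_inv_eq_one, ← expTwoPi_sub, expTwoPi_eq_one_iff] at h3
    obtain ⟨k, hk⟩ := h3
    exact ⟨k, by rw [← hk]; field_simp⟩
  exact_mod_cast sub_eq_zero.mp key

/-- Polarisation: I is the polar form of the quadratic form m ↦ J(m, m). -/
theorem isometry (hIJ : ∀ m n, I m n = J m n + J n m)
    (hf : ∀ a, (thetaPrime L J).hom a = 1 → f.map₁ a = a) (m n : L) :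
    I (f.latticePart m) (f.latticePart n) = I m n := by
  have h1 := f.isometry_diag hf (m + n)
  have h2 := f.isometry_diag hf m
  have h3 := f.isometry_diag hf n
  simp only [map_add, LinearMap.add_apply] at h1
  rw [hIJ, hIJ]
  linarith

end TorusEnd

/-- The homomorphism to the isometry group given by the action on the lattice. -/
noncomputable def autToIsometry (hIJ : ∀ m n, I m n = J m n + J n m) :
    AutPlus L J →* isometryGroup I where
  toFun φ := ⟨LinearEquiv.ofLinearMap (TorusEnd.latticePart φ.1.val)
      (TorusEnd.latticePart φ.1⁻¹.val)
      (LinearMap.ext fun m => by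
        rw [LinearMap.comp_apply, ← TorusEnd.latticePart_mul, Units.mul_inv,
          TorusEnd.latticePart_one, LinearMap.id_apply])
      (LinearMap.ext fun m => by
        rw [LinearMap.comp_apply, ← TorusEnd.latticePart_mul, Units.inv_mul,
          TorusEnd.latticePart_one, LinearMap.id_apply]), TorusEnd.isometry _ hIJ φ.2⟩
  map_one' := Subtype.ext (LinearEquiv.ext fun _ => rfl)
  map_mul' φ ψ := Subtype.ext (LinearEquiv.ext fun m =>
    TorusEnd.latticePart_mul φ.1.val ψ.1.val m)

theorem autToIsometry_apply (hIJ : ∀ m n, I m n = J m n + J n m) (φ : AutPlus L J) (m : L) :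
    (autToIsometry hIJ φ).1 m = TorusEnd.latticePart φ.1.val m := rfl

end CategoricalTorus

/-! ### Lifting isometries to weak automorphisms -/

namespace CategoricalTorus

open PMSemidirect

variable {E : Type*} [NormedAddCommGroup E] [NormedSpace ℝ E] [FiniteDimensional ℝ E]
  {L : Submodule ℤ E} [DiscreteTopology L] [IsZLattice ℝ L] {I J : L →ₗ[ℤ] L →ₗ[ℤ] ℤ}

/-- An alternating form on a free module of finite rank is the antisymmetrisation of a bilinear
form. -/
theorem exists_antisymmetrization {M : Type*} [AddCommGroup M] [Module.Free ℤ M]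
    [Module.Finite ℤ M] (B : M →ₗ[ℤ] M →ₗ[ℤ] ℤ) (hB : ∀ m, B m m = 0) :
    ∃ K : M →ₗ[ℤ] M →ₗ[ℤ] ℤ, ∀ m n, K m n - K n m = B m n := by
  let b := Module.finBasis ℤ M
  -- The strictly upper triangular part of `B`; since `B` is alternating, no division by 2 is
  -- needed.
  let K : M →ₗ[ℤ] M →ₗ[ℤ] ℤ :=
    b.constr ℤ fun i => b.constr ℤ fun j => if i < j then B (b i) (b j) else 0
  have hK : ∀ i j, K (b i) (b j) = if i < j then B (b i) (b j) else 0 := fun i j => by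
    simp only [K]
    rw [Module.Basis.constr_basis, Module.Basis.constr_basis]
  have hneg : ∀ m n, B n m = -B m n := fun m n => by
    have := hB (m + n)
    simp only [map_add, LinearMap.add_apply, hB] at this
    linarith
  have e : K - K.flip = B := b.ext fun i => b.ext fun j => by
    rw [LinearMap.sub_apply, LinearMap.sub_apply, LinearMap.flip_apply, hK, hK]
    rcases lt_trichotomy i j with h | h | h
    · simp [h, h.not_gt]
    · simp [h, hB]
    · simp [h, h.not_gt, hneg (b i) (b j)]
  exact ⟨K, fun m n => by rw [← e]; rfl⟩

theorem contMDiff_twisted_bilin (B : E →ₗ[ℝ] E →ₗ[ℝ] ℝ) :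
    ContMDiff ((model E).prod (model E)) (𝓡 1) ω
      fun p : PMSemidirect E × PMSemidirect E => expTwoPi (B p.1.1 (p.1.2 • p.2.1)) := by
  have h1 : ContDiff ℝ ω fun v : E × E => B v.1 v.2 :=
    B.toContinuousBilinearMap.isBoundedBilinearMap.contDiff
  have hf : ContMDiff ((model E).prod (model E)) 𝓘(ℝ, E) ω
      fun p : PMSemidirect E × PMSemidirect E => p.1.1 :=
    PMSemidirect.contMDiff_fst.comp _root_.contMDiff_fst
  have hs : ContMDiff ((model E).prod (model E)) 𝓘(ℝ, E) ω
      fun p : PMSemidirect E × PMSemidirect E => p.1.2 • p.2.1 :=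
    contMDiff_smul (PMSemidirect.contMDiff_fst.comp _root_.contMDiff_snd)
      (PMSemidirect.continuous_snd.comp _root_.continuous_fst)
  exact (contMDiff_expTwoPi_comp h1).comp (hf.prodMk_space hs)

namespace isometryEnd

variable (g : L →ₗ[ℤ] L) (A : E →ₗ[ℝ] E) (K : L →ₗ[ℤ] L →ₗ[ℤ] ℤ)

/-- The map on objects of `isometryEnd`. -/
def map₀ (p : PMSemidirect E) : PMSemidirect E := mk (A p.1) p.2

/-- The map on arrows of `isometryEnd`. -/
def map₁ (a : Arrows L) : Arrows L := (Multiplicative.ofAdd (g (Multiplicative.toAdd a.1)), a.2)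

/-- The monoidal constraint of `isometryEnd`. -/
noncomputable def κ (p q : PMSemidirect E) : Arrows L :=
  (1, expTwoPi (extend L K p.1 (p.2 • q.1)))

theorem contMDiff_map₀ : ContMDiff (model E) (model E) ω (map₀ A) :=
  contMDiff_mk
    ((LinearMap.toContinuousLinearMap A).contDiff.contMDiff.comp PMSemidirect.contMDiff_fst)
    PMSemidirect.continuous_snd

theorem contMDiff_map₁ : ContMDiff arrowsModel arrowsModel ω (map₁ g) :=
  ContMDiff.prodMk (contMDiff_to_discrete
    ((continuous_of_discreteTopology (f := fun m : Multiplicative L =>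
      Multiplicative.ofAdd (g (Multiplicative.toAdd m)))).comp _root_.continuous_fst))
    _root_.contMDiff_snd

theorem contMDiff_κ : ContMDiff ((model E).prod (model E)) arrowsModel ω
    fun p : PMSemidirect E × PMSemidirect E => κ K p.1 p.2 :=
  ContMDiff.prodMk contMDiff_const (contMDiff_twisted_bilin (extend L K))

theorem hom_κ (p q : PMSemidirect E) : (thetaPrime L J).hom (κ K p q) = 1 :=
  thetaPrime_hom_eq_one.mpr rfl

theorem map₀_mul (p q : PMSemidirect E) : map₀ A p * map₀ A q = map₀ A (p * q) := by
  refine PMSemidirect.ext ?_ rfl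
  change A p.1 + p.2 • A q.1 = A (p.1 + p.2 • q.1)
  rcases Int.units_eq_one_or p.2 with hp | hp <;> simp [hp]

/-- Integrality of `K` on the lattice is what lets the map on arrows be a homomorphism with no phase
correction. -/
theorem κ_hom_hom (a b : Arrows L) :
    κ K ((thetaPrime L J).hom a) ((thetaPrime L J).hom b) = 1 := by
  refine Prod.ext rfl ?_
  change expTwoPi (extend L K (Multiplicative.toAdd a.1 : L)
    ((1 : ℤˣ) • ((Multiplicative.toAdd b.1 : L) : E))) = 1
  rw [one_smul, extend_apply, expTwoPi_intCast]

theorem map₁_mul (a b : Arrows L) : map₁ g a * map₁ g b = map₁ g (a * b) :=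
  Prod.ext (congrArg Multiplicative.ofAdd (map_add g _ _).symm) rfl

theorem κ_cocycle (x y z : PMSemidirect E) :
    κ K x y * κ K (x * y) z = κ K y z * κ K x (y * z) := by
  have h : extend L K x.1 (x.2 • y.1) + extend L K (x.1 + x.2 • y.1) ((x.2 * y.2) • z.1) =
      extend L K y.1 (y.2 • z.1) + extend L K x.1 (x.2 • (y.1 + y.2 • z.1)) := by
    rcases Int.units_eq_one_or x.2 with hx | hx <;>
      rcases Int.units_eq_one_or y.2 with hy | hy <;> simp [hx, hy] <;> ring
  simp only [κ, Prod.mk_mul_mk, mul_fst, mul_snd, ← expTwoPi_add, h]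

variable {g A K}

/-- The antisymmetric part of `K` cancels the change in J. The sign of `x` enters twice on the
right, once through the action and once through the twist in `κ`, and disappears. -/
theorem equivariance (hA : ∀ m : L, A m = g m)
    (hK : ∀ x y, extend L K x y - extend L K y x = extend L J x y - extend L J (A x) (A y))
    (a : Arrows L) (x : PMSemidirect E) :
    (thetaPrime L J).act (map₁ g a) (map₀ A x) * κ K ((thetaPrime L J).hom a) x =
      map₁ g ((thetaPrime L J).act a x) *
        κ K x ((thetaPrime L J).hom ((thetaPrime L J).act a x)) := by
  refine Prod.ext ?_ ?_
  · change Multiplicative.ofAdd (x.2 • g (Multiplicative.toAdd a.1)) * 1 =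
      Multiplicative.ofAdd (g (x.2 • Multiplicative.toAdd a.1)) * 1
    rcases Int.units_eq_one_or x.2 with hx | hx <;> simp [hx]
  · change a.2 * expTwoPi (extend L J (g (Multiplicative.toAdd a.1) : L) (A x.1)) *
        expTwoPi (extend L K (Multiplicative.toAdd a.1 : L) ((1 : ℤˣ) • x.1)) =
      a.2 * expTwoPi (extend L J (Multiplicative.toAdd a.1 : L) x.1) *
        expTwoPi (extend L K x.1 (x.2 • ((x.2 • (Multiplicative.toAdd a.1 : L) : L) : E)))
    have h := hK (Multiplicative.toAdd a.1 : L) x.1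
    rw [hA] at h
    have e : (x.2 • ((x.2 • (Multiplicative.toAdd a.1 : L) : L) : E)) =
        (Multiplicative.toAdd a.1 : L) := by
      rcases Int.units_eq_one_or x.2 with hx | hx <;> simp [hx]
    rw [e, one_smul, mul_assoc, mul_assoc, ← expTwoPi_add, ← expTwoPi_add]
    congr 2
    linarith

end isometryEnd

/-- The weak endomorphism of `𝒯 ⋊ {±1}` defined by an endomorphism of the lattice and a bilinear
form which measures the failure of that endomorphism to preserve `J`. -/
noncomputable def isometryEnd (g : L →ₗ[ℤ] L) (A : E →ₗ[ℝ] E) (hA : ∀ m : L, A m = g m)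
    (K : L →ₗ[ℤ] L →ₗ[ℤ] ℤ)
    (hK : ∀ x y, extend L K x y - extend L K y x = extend L J x y - extend L J (A x) (A y)) :
    TorusEnd J where
  map₀ := isometryEnd.map₀ A
  map₁ := isometryEnd.map₁ g
  κ := isometryEnd.κ K
  analytic₀ := isometryEnd.contMDiff_map₀ A
  analytic₁ := isometryEnd.contMDiff_map₁ g
  analyticκ := isometryEnd.contMDiff_κ K
  one₀ := PMSemidirect.ext (map_zero A) rfl
  one₁ := Prod.ext (map_zero g) rfl
  w1 a := PMSemidirect.ext (hA _) rfl
  w2 p q := by rw [isometryEnd.hom_κ, mul_one, isometryEnd.map₀_mul]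
  w3 a b := by rw [isometryEnd.κ_hom_hom, mul_one, isometryEnd.map₁_mul]
  w4 x y z := by
    rw [CrossedModule.IsCentral.act_eq _ _ (isometryEnd.hom_κ K x y), isometryEnd.κ_cocycle]
  w5 := isometryEnd.equivariance hA hK

/-- Central arrows pass unchanged through `isometryEnd`, so the constraint of the composite is the
exponential of the pulled-back form plus the second form. -/
theorem isometryEnd_mul_eq_one {g g' : L →ₗ[ℤ] L} {A A' : E →ₗ[ℝ] E}
    {hA : ∀ m : L, A m = g m} {hA' : ∀ m : L, A' m = g' m} {K K' : L →ₗ[ℤ] L →ₗ[ℤ] ℤ}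
    {hK : ∀ x y, extend L K x y - extend L K y x = extend L J x y - extend L J (A x) (A y)}
    {hK' : ∀ x y, extend L K' x y - extend L K' y x = extend L J x y - extend L J (A' x) (A' y)}
    (hg : ∀ m, g (g' m) = m) (hAA : ∀ x, A (A' x) = x)
    (hKK : ∀ x y, extend L K (A' x) (A' y) + extend L K' x y = 0) :
    isometryEnd g A hA K hK * isometryEnd g' A' hA' K' hK' = 1 := by
  refine CrossedModule.WeakEnd.ext (funext fun x => ?_) (funext fun a => ?_)
    (funext fun x => funext fun y => ?_)
  · exact PMSemidirect.ext (hAA _) rfl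
  · exact Prod.ext (hg _) rfl
  · have h1 : ∀ (z : Circle) p,
        CrossedModule.WeakEnd.arrow (isometryEnd g A hA K hK) p (1, z) = (1, z) := fun z p => by
      have h : (thetaPrime L J).hom ((1, z) : Arrows L) = 1 := thetaPrime_hom_eq_one.mpr rfl
      rw [CrossedModule.WeakEnd.arrow, h, CrossedModule.WeakEnd.κ_one_right, mul_one]
      exact Prod.ext (map_zero g) rfl
    have h2 : (isometryEnd g' A' hA' K' hK').κ x y =
      (1, expTwoPi (extend L K' x.1 (x.2 • y.1))) := rfl
    rw [CrossedModule.WeakEnd.mul_κ, h2, h1]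
    refine Prod.ext (mul_one _) ?_
    change expTwoPi (extend L K (A' x.1) (x.2 • A' y.1)) *
      expTwoPi (extend L K' x.1 (x.2 • y.1)) = 1
    have e : x.2 • A' y.1 = A' (x.2 • y.1) := by
      rcases Int.units_eq_one_or x.2 with hx | hx <;> simp [hx]
    rw [e, ← expTwoPi_add, hKK, expTwoPi_zero]

/-- Every isometry of the lattice lifts to a centre-preserving weak automorphism. -/
theorem autToIsometry_surjective (hIJ : ∀ m n, I m n = J m n + J n m) :
    Function.Surjective (autToIsometry hIJ) := by
  rintro ⟨g, hg⟩
  have := ZLattice.module_free ℝ L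
  have := ZLattice.module_finite ℝ L
  let G : L →ₗ[ℤ] L := g
  let G' : L →ₗ[ℤ] L := g.symm
  have hGG' : ∀ m, G (G' m) = m := g.apply_symm_apply
  have hG'G : ∀ m, G' (G m) = m := g.symm_apply_apply
  obtain ⟨A, hA⟩ := exists_linear_extension L ((L.subtype).comp G)
  obtain ⟨A', hA'⟩ := exists_linear_extension L ((L.subtype).comp G')
  have hA : ∀ m : L, A m = G m := hA
  have hA' : ∀ m : L, A' m = G' m := hA'
  -- Because I(m, m) = 2J(m, m), an isometry preserves J on the diagonal; thus J - g*J is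
  -- alternating.
  obtain ⟨K, hK⟩ := exists_antisymmetrization (J - J.compl₁₂ G G) fun m => by
    have := hg m m
    rw [hIJ, hIJ] at this
    change J m m - J (g m) (g m) = 0
    linarith
  have hK : ∀ m n, K m n - K n m = J m n - J (G m) (G n) := hK
  -- The sign and pull-back along g⁻¹ are dictated by the inverse: the constraint of the composite
  -- must vanish.
  let K' : L →ₗ[ℤ] L →ₗ[ℤ] ℤ := -(K.compl₁₂ G' G')
  have hAA' : ∀ x, A (A' x) = x := fun x => by
    have : A.comp A' = LinearMap.id := linearMap_ext_lattice L fun m => by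
      rw [LinearMap.comp_apply, hA', hA, hGG', LinearMap.id_apply]
    exact LinearMap.congr_fun this x
  have hA'A : ∀ x, A' (A x) = x := fun x => by
    have : A'.comp A = LinearMap.id := linearMap_ext_lattice L fun m => by
      rw [LinearMap.comp_apply, hA, hA', hG'G, LinearMap.id_apply]
    exact LinearMap.congr_fun this x
  have hKR : ∀ x y, extend L K x y - extend L K y x =
      extend L J x y - extend L J (A x) (A y) := fun x y => by
    have : extend L K - (extend L K).flip = extend L J - (extend L J).compl₁₂ A A :=
      bilin_ext_lattice L fun m n => by
        simp only [LinearMap.sub_apply, LinearMap.flip_apply, LinearMap.compl₁₂_apply, hA,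
          extend_apply]
        exact_mod_cast hK m n
    exact LinearMap.congr_fun₂ this x y
  have hKK' : ∀ x y, extend L K (A' x) (A' y) + extend L K' x y = 0 := fun x y => by
    have : (extend L K).compl₁₂ A' A' + extend L K' = 0 := bilin_ext_lattice L fun m n => by
      simp only [LinearMap.add_apply, LinearMap.compl₁₂_apply, hA', extend_apply,
        LinearMap.zero_apply]
      simp [K']
    exact LinearMap.congr_fun₂ this x y
  have hK'R : ∀ x y, extend L K' x y - extend L K' y x =
      extend L J x y - extend L J (A' x) (A' y) := fun x y => by
    have e1 := hKK' x y
    have e2 := hKK' y x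
    have e3 := hKR (A' x) (A' y)
    rw [hAA', hAA'] at e3
    linarith
  have hK'K : ∀ x y, extend L K' (A x) (A y) + extend L K x y = 0 := fun x y => by
    have := hKK' (A x) (A y)
    rw [hA'A, hA'A] at this
    linarith
  let φ : (TorusEnd J)ˣ :=
    { val := isometryEnd G A hA K hKR
      inv := isometryEnd G' A' hA' K' hK'R
      val_inv := isometryEnd_mul_eq_one hGG' hAA' hKK'
      inv_val := isometryEnd_mul_eq_one hG'G hA'A hK'K }
  refine ⟨⟨φ, fun a ha => ?_⟩, Subtype.ext (LinearEquiv.ext fun m => rfl)⟩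
  have h1 := thetaPrime_hom_eq_one.mp ha
  refine Prod.ext ?_ rfl
  change Multiplicative.ofAdd (G (Multiplicative.toAdd a.1)) = a.1
  rw [h1]
  exact map_zero G

end CategoricalTorus

/-! ### Weak automorphisms acting trivially on the lattice -/

namespace CrossedModule

variable {E₀ H₀ E₁ H₁ : Type*} [NormedAddCommGroup E₀] [NormedSpace ℝ E₀] [TopologicalSpace H₀]
  [NormedAddCommGroup E₁] [NormedSpace ℝ E₁] [TopologicalSpace H₁]
  {I₀ : ModelWithCorners ℝ E₀ H₀} {I₁ : ModelWithCorners ℝ E₁ H₁}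
  {G₀ G₁ : Type*} [Group G₀] [Group G₁] [TopologicalSpace G₀] [ChartedSpace H₀ G₀]
  [TopologicalSpace G₁] [ChartedSpace H₁ G₁] {Ψ : CrossedModule G₀ G₁} [Ψ.IsLie I₀ I₁]

/-- A weak endomorphism with a monoidal transformation from `Ad(u)` is `δ(η) ∘ Ad(u)` for some
pointed map `η`. -/
theorem WeakEnd.exists_eq_deltaFun_mul_adHom (f : WeakEnd I₀ I₁ Ψ) (u : G₀)
    (θ : PointedMap I₀ I₁ Ψ) (h₀ : ∀ x, f.map₀ x = u * x * u⁻¹ * Ψ.hom (θ.toFun x))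
    (h₁ : ∀ a, f.map₁ a = Ψ.act a u⁻¹ * θ.toFun (Ψ.hom a))
    (h₂ : ∀ y z, f.κ y z =
      (θ.toFun z)⁻¹ * (Ψ.act (θ.toFun y) (u * z * u⁻¹))⁻¹ * θ.toFun (y * z)) :
    ∃ η : PointedMap I₀ I₁ Ψ, f = η.deltaFun * (adHom I₀ I₁ Ψ u).val := by
  -- The transformation `θ` is indexed by the source `x`, whereas δ(η) evaluates `η` at u x u⁻¹;
  -- hence the conjugation.
  let η : PointedMap I₀ I₁ Ψ :=
    { toFun := fun x => θ.toFun (u⁻¹ * x * u)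
      analytic := θ.analytic.comp (WeakEnd.analytic_mul₀ I₀ I₁ Ψ
        (WeakEnd.analytic_mul₀ I₀ I₁ Ψ contMDiff_const contMDiff_id) contMDiff_const)
      map_one := by rw [mul_one, inv_mul_cancel, θ.map_one] }
  have hη : ∀ x, η.toFun (u * x * u⁻¹) = θ.toFun x := fun x =>
    congrArg θ.toFun (by group)
  refine ⟨η, WeakEnd.ext (funext fun x => ?_) (funext fun a => ?_)
    (funext fun y => funext fun z => ?_)⟩
  · change f.map₀ x = u * x * u⁻¹ * Ψ.hom (η.toFun (u * x * u⁻¹))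
    rw [hη, h₀]
  · change f.map₁ a = Ψ.act a u⁻¹ * η.toFun (Ψ.hom (Ψ.act a u⁻¹))
    rw [Ψ.hom_act, inv_inv, hη, h₁]
  · rw [PointedMap.deltaFun_mul_κ]
    change f.κ y z = (η.toFun (u * z * u⁻¹))⁻¹ * (Ψ.act (η.toFun (u * y * u⁻¹)) (u * z * u⁻¹))⁻¹ * 1 *
      η.toFun (u * (y * z) * u⁻¹)
    rw [hη, hη, hη, mul_one, h₂]

end CrossedModule

/-- The commutator pairing of a two-cocycle is multiplicative. -/
theorem cocycle_commutator_mul {A B : Type*} [AddCommGroup A] [CommGroup B] {k : A → A → B}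
    (hk : ∀ x y z, k x y * k (x + y) z = k y z * k x (y + z)) (x y z : A) :
    k (x + y) z * (k z (x + y))⁻¹ = k x z * (k z x)⁻¹ * (k y z * (k z y)⁻¹) := by
  have h1 := congrArg Additive.ofMul (hk x y z)
  have h2 := congrArg Additive.ofMul (hk z x y)
  have h3 := congrArg Additive.ofMul (hk x z y)
  apply Additive.ofMul.injective
  rw [add_comm z x] at h2
  rw [add_comm z y] at h3
  simp only [ofMul_mul, ofMul_inv] at h1 h2 h3 ⊢
  linear_combination (norm := abel) h1 + h2 - h3

namespace CategoricalTorus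

open PMSemidirect

variable {E : Type*} [NormedAddCommGroup E] [NormedSpace ℝ E] [FiniteDimensional ℝ E]
  {L : Submodule ℤ E} [DiscreteTopology L] [IsZLattice ℝ L] {I J : L →ₗ[ℤ] L →ₗ[ℤ] ℤ}

/-- An analytic two-cocycle of a vector space which is symmetric against a lattice is symmetric. -/
theorem cocycle_symmetric_of_lattice {k : E → E → Circle}
    (ha : ContMDiff 𝓘(ℝ, E × E) (𝓡 1) ω fun p : E × E => k p.1 p.2)
    (hk : ∀ x y z, k x y * k (x + y) z = k y z * k x (y + z))
    (hL : ∀ (m : L) (x : E), k m x = k x m) (x y : E) : k x y = k y x := by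
  -- The commutator pairing is multiplicative in both variables and trivial on L in the first,
  -- though its second variable is arbitrary in E.
  let c : E → E → Circle := fun x y => k x y * (k y x)⁻¹
  have c1 : ∀ x y z, c (x + y) z = c x z * c y z := cocycle_commutator_mul hk
  have ci : ∀ x y, c y x = (c x y)⁻¹ := fun x y => by
    simp only [c, mul_inv_rev, inv_inv]
  have c2 : ∀ x y z, c x (y + z) = c x y * c x z := fun x y z => by
    rw [ci, c1, mul_inv, ← ci, ← ci]
  have cL : ∀ (m : L) x, c m x = 1 := fun m x => by
    simp only [c]
    rw [hL, mul_inv_cancel]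
  have c0 : ∀ x, c 0 x = 1 := fun x => cL 0 x
  have n1 : ∀ (n : ℕ) x y, c (n • x) y = c x y ^ n := fun n x y => by
    induction n with
    | zero => rw [zero_smul, c0, pow_zero]
    | succ n ih => rw [succ_nsmul, c1, ih, pow_succ]
  have n2 : ∀ (n : ℕ) x y, c x (n • y) = c x y ^ n := fun n x y => by
    rw [ci, n1, ← inv_pow, ← ci]
  have hc : ContMDiff 𝓘(ℝ, E) (𝓡 1) ω fun x => c x y := by
    have h1 : ContMDiff 𝓘(ℝ, E) 𝓘(ℝ, E × E) ω fun x : E => (x, y) :=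
      (contDiff_id.prodMk contDiff_const).contMDiff
    have h2 : ContMDiff 𝓘(ℝ, E) 𝓘(ℝ, E × E) ω fun x : E => (y, x) :=
      (contDiff_const.prodMk contDiff_id).contMDiff
    exact (ha.comp h1).mul (ha.comp h2).inv
  obtain ⟨l, hl⟩ := exists_linear_of_map_two_smul (hc 0) fun v => by
    rw [two_smul, c1, sq]
  have l0 : ∀ m : L, l m = 0 := fun m => by
    have : (2 * Real.pi)⁻¹ * l m = 0 := by
      refine eq_zero_of_forall_div fun n => ?_
      have hn : ((n : ℝ) + 1) ≠ 0 := by positivity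
      have e : ∀ v : E, (n + 1) • (((n : ℝ) + 1)⁻¹ • v) = v := fun v => by
        rw [← Nat.cast_smul_eq_nsmul ℝ, smul_smul]
        push_cast
        rw [mul_inv_cancel₀ hn, one_smul]
      -- The factor 1/(n+1) is moved from the first variable to the second: c(m/(n+1), y) = c(m,
      -- y/(n+1)) = 1. So l(m)/(2π) is an integer divided by every positive integer, hence zero, and
      -- L spans E.
      have h : c (((n : ℝ) + 1)⁻¹ • (m : E)) y = 1 := by
        rw [← e y, n2, ← n1, e, cL]
      rw [hl, exp_eq_expTwoPi, expTwoPi_eq_one_iff, map_smul] at h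
      obtain ⟨j, hj⟩ := h
      refine ⟨j, ?_⟩
      rw [← hj, smul_eq_mul]
      field_simp
    exact (mul_eq_zero.mp this).resolve_left (by positivity)
  have hl0 : (l : E →ₗ[ℝ] ℝ) = 0 := linearMap_ext_lattice L l0
  have hx := hl x
  rw [← ContinuousLinearMap.coe_coe, hl0, LinearMap.zero_apply, Circle.exp_zero] at hx
  exact mul_inv_eq_one.mp hx

namespace TorusEnd

/-- Both φ and φ⁻¹ keep the identity component in itself, so neither can send the other component
into it. -/
theorem unit_map₀_snd (φ : (TorusEnd J)ˣ) (p : PMSemidirect E) : (φ.val.map₀ p).2 = p.2 := by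
  rcases eq_mk_or p with hp | hp
  · rw [hp, map₀_snd]; rfl
  · rcases eq_mk_or (φ.val.map₀ p) with h | h
    · exfalso
      have h1 := CrossedModule.WeakEnd.inv_map₀_map₀ φ p
      rw [h] at h1
      have h2 := TorusEnd.map₀_snd φ⁻¹.val (φ.val.map₀ p).1
      rw [h1, hp] at h2
      exact absurd h2 (show ¬((-1 : ℤˣ) = 1) by decide)
    · rw [h, hp]; rfl

section LatticeIdentity

variable {φ : (TorusEnd J)ˣ}

theorem linearPart_eq_id {f : TorusEnd J} (hg : ∀ m, f.latticePart m = m) (x : E) :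
    f.linearPart x = x := by
  have : f.linearPart = LinearMap.id := linearMap_ext_lattice L fun m => by
    rw [linearPart_coe, hg, LinearMap.id_apply]
  rw [this, LinearMap.id_apply]

/-- The translation part of a weak automorphism on the component of `(0, -1)`. -/
noncomputable def shift (f : TorusEnd J) : E := (f.map₀ (mk 0 (-1))).1

theorem map₀_sign : φ.val.map₀ (mk 0 (-1)) = mk (shift φ.val) (-1) :=
  PMSemidirect.ext rfl (unit_map₀_snd φ _)

/-- By constancy only the pairs built from 1 and s = (0, -1) matter. Normalisation settles all but
(s, s); there f₀(s) has sign -1, so it is an involution, and `w2` puts κ(s, s) in the kernel. -/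
theorem κ_fst_eq_one (p q : PMSemidirect E) : (φ.val.κ p q).1 = 1 := by
  have h : ∀ ε δ : ℤˣ, (φ.val.κ (mk 0 ε) (mk 0 δ)).1 = 1 := fun ε δ => by
    rcases Int.units_eq_one_or ε with rfl | rfl
    · rw [mk_zero_one, φ.val.κ_one_left]; rfl
    · rcases Int.units_eq_one_or δ with rfl | rfl
      · rw [mk_zero_one, φ.val.κ_one_right]; rfl
      · have := φ.val.w2 (mk 0 (-1)) (mk 0 (-1))
        rw [map₀_sign, mk_neg_one_mul_mk, mk_neg_one_mul_mk, sub_self, sub_self, neg_neg,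
          mk_zero_one, one_mul, φ.val.one₀] at this
        exact thetaPrime_hom_eq_one.mp this
  exact (κ_fst_const φ.val p.2 q.2 p.1 q.1).trans (h _ _)

theorem κ_eq (p q : PMSemidirect E) : φ.val.κ p q = (1, (φ.val.κ p q).2) :=
  Prod.ext (κ_fst_eq_one p q) rfl

theorem κ_snd_cocycle (x y z : PMSemidirect E) :
    (φ.val.κ x y).2 * (φ.val.κ (x * y) z).2 = (φ.val.κ y z).2 * (φ.val.κ x (y * z)).2 := by
  have h := φ.val.w4 x y z
  rw [CrossedModule.IsCentral.act_eq _ _ (thetaPrime_hom_eq_one.mpr (κ_fst_eq_one x y))] at h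
  exact congrArg Prod.snd h

theorem map₀_mk_neg_one (hg : ∀ m, TorusEnd.latticePart φ.val m = m) (x : E) :
    φ.val.map₀ (mk x (-1)) = mk (x + shift φ.val) (-1) := by
  have h := φ.val.w2 (mk x 1) (mk 0 (-1))
  rw [thetaPrime_hom_eq_one.mpr (κ_fst_eq_one _ _), mul_one, map₀_sign, map₀_mk_one,
    linearPart_eq_id hg, mk_one_mul_mk, mk_one_mul_mk, add_zero] at h
  exact h.symm

end LatticeIdentity

/-- A centre-preserving weak automorphism which acts trivially on the lattice is isomorphic to
`Ad(u)` for some object `u`. -/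
theorem exists_eq_deltaFun_mul_adHom (hIJ : ∀ m n, I m n = J m n + J n m)
    (hI : Function.Bijective I) (φ : (TorusEnd J)ˣ)
    (hf : ∀ a, (thetaPrime L J).hom a = 1 → φ.val.map₁ a = a)
    (hg : ∀ m, TorusEnd.latticePart φ.val m = m) :
    ∃ x, ∃ η : CrossedModule.PointedMap (model E) arrowsModel (thetaPrime L J),
      φ.val = η.deltaFun * (CrossedModule.adHom (model E) arrowsModel (thetaPrime L J) x).val := by
  let k : PMSemidirect E → PMSemidirect E → Circle := fun p q => (φ.val.κ p q).2
  have ka : ContMDiff ((model E).prod (model E)) (𝓡 1) ω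
      fun p : PMSemidirect E × PMSemidirect E => k p.1 p.2 :=
    _root_.contMDiff_snd.comp φ.val.analyticκ
  -- With trivial action on the lattice the two J-terms in `exp_mul_κ` agree and cancel, leaving
  -- symmetry against L.
  have hs : ∀ x y, k (mk x 1) (mk y 1) = k (mk y 1) (mk x 1) :=
    cocycle_symmetric_of_lattice (L := L) (k := fun x y => k (mk x 1) (mk y 1))
      (_root_.contMDiff_snd.comp (contMDiff_κ φ.val 1 1)) (κ_cocycle φ.val) fun m x => by
        have := exp_mul_κ hf m x
        rw [hg, linearPart_eq_id hg] at this
        exact mul_left_cancel this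
  obtain ⟨η, l, hη, hη1, hk⟩ := exists_normal_form ka κ_snd_cocycle (fun x => by
    simp only [k]; rw [φ.val.κ_one_right]; rfl) hs
  -- the difference between `φ₁` and `η` is a character of the lattice
  have hphase : ∀ m n : L, phase φ.val m * phase φ.val n * k (mk (m : E) 1) (mk (n : E) 1) =
      phase φ.val (m + n) := fun m n => by
    have h := φ.val.w3 (Multiplicative.ofAdd m, 1) (Multiplicative.ofAdd n, 1)
    have e : ((Multiplicative.ofAdd m, 1) * (Multiplicative.ofAdd n, 1) : Arrows L) =
      (Multiplicative.ofAdd (m + n), 1) := Prod.ext rfl (mul_one _)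
    rw [e] at h
    exact congrArg Prod.snd h
  obtain ⟨a, ha⟩ := exists_linear_of_character L
    (fun m => phase φ.val m * (η (mk (m : E) 1))⁻¹) fun m n => by
      have h1 := hk (mk (m : E) 1) (mk (n : E) 1)
      rw [mk_one_mul_mk, mk_snd, if_pos rfl, mul_one] at h1
      rw [← hphase, Submodule.coe_add, ← h1]
      have e : ∀ p q r s t : Circle, p * q * r * (s * t * r)⁻¹ = p * s⁻¹ * (q * t⁻¹) := by
        intro p q r s t
        rw [mul_inv, mul_inv, mul_assoc (p * q), mul_left_comm r, mul_inv_cancel, mul_one,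
          mul_mul_mul_comm]
      exact e _ _ _ _ _
  have hphase' : ∀ m : L, phase φ.val m = η (mk (m : E) 1) * expTwoPi (a m) := fun m => by
    rw [← ha, mul_comm, inv_mul_cancel_right]
  -- the equivariance condition at `(0, -1)`
  let l' : E →ₗ[ℝ] ℝ := (2 * Real.pi)⁻¹ • (l : E →ₗ[ℝ] ℝ)
  have hl' : ∀ x, Circle.exp (l x) = expTwoPi (l' x) := fun x => exp_eq_expTwoPi (l x)
  set F := shift φ.val with hF
  -- Collects the exponents left by `w5` at (0, -1): two from the phases at m and -m, one from the
  -- normal form, one from the action of f₀(0, -1).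
  let b : E →ₗ[ℝ] ℝ := (2 : ℝ) • a + l' + (extend L J).flip F
  have hb : ∀ m : L, ∃ n : ℤ, b m = n := fun m => by
    rw [← expTwoPi_eq_one_iff]
    have h := φ.val.w5 (Multiplicative.ofAdd m, 1) (mk 0 (-1))
    have e : (thetaPrime L J).act (Multiplicative.ofAdd m, 1) (mk 0 (-1)) =
        (Multiplicative.ofAdd (-m), 1) :=
      Prod.ext (by simp [thetaPrime_act]) (by simp [thetaPrime_act])
    rw [e, map₀_sign, map₁_eq hf, map₁_eq hf, hg, hg] at h
    have h2 : phase φ.val m * 1 * expTwoPi (extend L J m F) * k (mk (m : E) 1) (mk 0 (-1)) =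
      phase φ.val (-m) * 1 * k (mk 0 (-1)) (mk ((-m : L) : E) 1) := congrArg Prod.snd h
    have h3 := hk (mk (m : E) 1) (mk 0 (-1))
    have h4 := hk (mk 0 (-1)) (mk (-(m : E)) 1)
    rw [mk_one_mul_mk, add_zero, mk_snd, if_pos rfl, mul_one] at h3
    rw [mk_neg_one_mul_mk, zero_sub, neg_neg, mk_snd, if_neg (by decide), mk_fst, hl', map_neg,
      ← h3] at h4
    rw [hphase', hphase', mul_one, mul_one, Submodule.coe_neg, map_neg] at h2
    have e1 : b m = a m + a m + l' m + extend L J m F := by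
      simp only [b, LinearMap.add_apply, LinearMap.smul_apply, LinearMap.flip_apply, smul_eq_mul]
      ring
    rw [e1]
    simp only [expTwoPi_add, expTwoPi_neg] at h2 h4 ⊢
    have h2' := congrArg Additive.ofMul h2
    have h4' := congrArg Additive.ofMul h4
    apply Additive.ofMul.injective
    simp only [ofMul_mul, ofMul_inv, ofMul_one] at h2' h4' ⊢
    linear_combination (norm := abel) h2' + h4'
  -- Here unimodularity produces the lattice vector that corrects the shift.
  obtain ⟨q, hq⟩ := exists_eq_extend_of_integral hI b hb
  let p : L := -q
  -- Ad(u, 1) moves (x, -1) to (x + 2u, -1), whereas f₀ moves it to (x + F, -1). The lattice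
  -- component `p` of the transformation must bridge the difference, so 2u = F + p.
  let u : E := (2 : ℝ)⁻¹ • (F + p)
  -- Compatibility on arrows fixes `d`: Ad(u, 1) contributes e(-J(m, u)) to the phase, which has to
  -- become e(a(m)).
  let d : E →ₗ[ℝ] ℝ := a + (extend L J).flip u
  -- The condition for the constraint on pairs whose first sign is -1. The choice p = -q makes it a
  -- restatement of b = I(q, ·).
  have hd : ∀ x, l' x + (d x + d x) + extend L J (p : E) x = 0 := fun x => by
    have h1 := hq x
    rw [extend_eq_add_flip hIJ] at h1
    simp only [b, d, u, p, LinearMap.add_apply, LinearMap.smul_apply, LinearMap.flip_apply,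
      smul_eq_mul, map_add, map_smul, Submodule.coe_neg, map_neg, LinearMap.neg_apply] at h1 ⊢
    linarith
  have hu : u + u = F + p := by
    simp only [u]
    rw [← add_smul]; norm_num
  -- On two objects of sign -1 the transformation needs w² = e(-2J(p, u)); this is the evident root.
  let w : Circle := expTwoPi (-extend L J (p : E) u)
  let θ₂ : PMSemidirect E → Circle := fun r =>
    (if r.2 = 1 then 1 else w) * (η r * expTwoPi (d r.1))
  let θ : CrossedModule.PointedMap (model E) arrowsModel (thetaPrime L J) :=
    { toFun := fun r => (if r.2 = 1 then 1 else Multiplicative.ofAdd p, θ₂ r)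
      analytic := by
        refine contMDiff_of_slices (fun r : PMSemidirect E => r.2) PMSemidirect.continuous_snd
          fun ε => ⟨fun r => (if ε = 1 then 1 else Multiplicative.ofAdd p,
            (if ε = 1 then 1 else w) * (η r * expTwoPi (d r.1))), ?_, fun r hr => by rw [← hr]⟩
        refine ContMDiff.prodMk contMDiff_const (contMDiff_const.mul (hη.mul ?_))
        exact (contMDiff_expTwoPi_comp (LinearMap.toContinuousLinearMap d).contDiff).comp
          PMSemidirect.contMDiff_fst
      map_one := Prod.ext rfl (by
        change 1 * (η 1 * expTwoPi (d 0)) = 1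
        rw [hη1, map_zero, expTwoPi_zero, mul_one, mul_one]) }
  have θ1 : ∀ x, θ.toFun (mk x 1) = (1, η (mk x 1) * expTwoPi (d x)) := fun x =>
    Prod.ext rfl (one_mul _)
  have θ2 : ∀ x, θ.toFun (mk x (-1)) =
      (Multiplicative.ofAdd p, w * (η (mk x (-1)) * expTwoPi (d x))) := fun x => rfl
  have conj1 : ∀ x : E, mk u 1 * mk x 1 * (mk u 1)⁻¹ = mk x 1 := fun x =>
    PMSemidirect.ext (by simp) rfl
  have conj2 : ∀ x : E, mk u 1 * mk x (-1) * (mk u 1)⁻¹ = mk (x + (F + p)) (-1) := fun x =>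
    PMSemidirect.ext (by simp [← hu]; abel) rfl
  refine ⟨mk u 1, CrossedModule.WeakEnd.exists_eq_deltaFun_mul_adHom φ.val (mk u 1) θ (fun r => ?_) (fun c => ?_)
    fun y z => ?_⟩
  · rcases eq_mk_or r with hr | hr <;> rw [hr]
    · rw [conj1, θ1, map₀_mk_one, linearPart_eq_id hg, thetaPrime_hom_eq_one.mpr rfl, mul_one]
    · rw [conj2, θ2, map₀_mk_neg_one hg, thetaPrime_hom, mk_neg_one_mul_mk]
      refine PMSemidirect.ext ?_ rfl
      change r.1 + F = r.1 + (F + p) - p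
      abel
  · obtain ⟨m, z⟩ := c
    have e := map₁_eq hf (Multiplicative.toAdd m) z
    rw [hg, hphase'] at e
    refine e.trans ?_
    rw [thetaPrime_hom, θ1]
    refine Prod.ext ?_ ?_
    · change m = Multiplicative.ofAdd ((1 : ℤˣ) • Multiplicative.toAdd m) * 1
      rw [one_smul, mul_one, ofAdd_toAdd]
    · change η (mk ((Multiplicative.toAdd m : L) : E) 1) * expTwoPi (a (Multiplicative.toAdd m : L)) * z =
        z * expTwoPi (extend L J (Multiplicative.toAdd m : L) (-((1 : ℤˣ) • u))) *
          (η (mk ((Multiplicative.toAdd m : L) : E) 1) *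
            expTwoPi (a (Multiplicative.toAdd m : L) + extend L J (Multiplicative.toAdd m : L) u))
      rw [one_smul, map_neg, expTwoPi_neg, expTwoPi_add]
      apply Additive.ofMul.injective
      simp only [ofMul_mul, ofMul_inv]
      abel
  · have hkyz := hk y z
    rw [κ_eq]
    change (1, k y z) = _
    rcases eq_mk_or y with hy | hy <;> rcases eq_mk_or z with hz | hz <;> rw [hy, hz] at hkyz ⊢
    · rw [mk_one_mul_mk, mk_snd, if_pos rfl, mul_one] at hkyz
      rw [conj1, θ1, θ1, mk_one_mul_mk, θ1, thetaPrime_act_central, ← hkyz]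
      refine Prod.ext (by simp) ?_
      simp only [Prod.snd_mul, Prod.snd_inv, map_add, expTwoPi_add]
      apply Additive.ofMul.injective
      simp only [ofMul_mul, ofMul_inv]
      abel
    · rw [mk_one_mul_mk, mk_snd, if_pos rfl, mul_one] at hkyz
      rw [conj2, θ1, θ2, mk_one_mul_mk, θ2, thetaPrime_act_central, ← hkyz]
      refine Prod.ext (by simp) ?_
      simp only [Prod.snd_mul, Prod.snd_inv, map_add, expTwoPi_add]
      apply Additive.ofMul.injective
      simp only [ofMul_mul, ofMul_inv]
      abel
    · rw [mk_neg_one_mul_mk, mk_snd, if_neg (by decide), mk_fst, hl'] at hkyz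
      rw [conj1, θ1, θ2, mk_neg_one_mul_mk, θ2, thetaPrime_act]
      refine Prod.ext (by simp) ?_
      have h1 := congrArg expTwoPi (hd z.1)
      simp only [Prod.snd_mul, Prod.snd_inv, map_sub, expTwoPi_add, expTwoPi_sub, toAdd_ofAdd,
        mk_fst, expTwoPi_zero] at h1 ⊢
      have h1' := congrArg Additive.ofMul h1
      have h2' := congrArg Additive.ofMul hkyz
      apply Additive.ofMul.injective
      simp only [ofMul_mul, ofMul_inv, ofMul_one] at h1' h2' ⊢
      linear_combination (norm := abel) h2' + h1'
    · rw [mk_neg_one_mul_mk, mk_snd, if_neg (by decide), mk_fst, hl', neg_neg] at hkyz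
      rw [conj2, θ2, θ2, mk_neg_one_mul_mk, neg_neg, θ1, thetaPrime_act]
      refine Prod.ext (by simp) ?_
      have h1 := congrArg expTwoPi (hd z.1)
      simp only [w, Prod.snd_mul, Prod.snd_inv, map_sub, map_add, expTwoPi_add, expTwoPi_sub,
        toAdd_ofAdd, mk_fst, expTwoPi_zero, ← hu, expTwoPi_neg] at h1 ⊢
      have h1' := congrArg Additive.ofMul h1
      have h2' := congrArg Additive.ofMul hkyz
      apply Additive.ofMul.injective
      simp only [ofMul_mul, ofMul_inv, ofMul_one] at h1' h2' ⊢
      linear_combination (norm := abel) h2' + h1'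

end TorusEnd

end CategoricalTorus

/-! ### Identification of the outer automorphisms and conclusion -/

namespace CategoricalTorus

open PMSemidirect

variable {E : Type*} [NormedAddCommGroup E] [NormedSpace ℝ E] [FiniteDimensional ℝ E]
  {L : Submodule ℤ E} [DiscreteTopology L] [IsZLattice ℝ L] {I J : L →ₗ[ℤ] L →ₗ[ℤ] ℤ}

/-- A pointed `η` has trivial lattice component on the connected identity component, so δ(η) leaves
the lattice fixed and only the sign of `x` acts. -/
theorem latticePart_deltaFun_mul_adHom
    (η : CrossedModule.PointedMap (model E) arrowsModel (thetaPrime L J)) (x : PMSemidirect E)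
    (m : L) : TorusEnd.latticePart (η.deltaFun *
      (CrossedModule.adHom (model E) arrowsModel (thetaPrime L J) x).val) m = x.2 • m := by
  have h : ∀ y : E, (η.toFun (mk y 1)).1 = 1 := fun y => by
    have hc : Continuous fun y : E => (η.toFun (mk y 1)).1 :=
      _root_.continuous_fst.comp (η.analytic.comp (contMDiff_mk_const 1)).continuous
    rw [continuous_lattice_const hc y 0, mk_zero_one, η.map_one]; rfl
  change Multiplicative.toAdd (((thetaPrime L J).act (Multiplicative.ofAdd m, 1) x⁻¹).1 *
    (η.toFun ((thetaPrime L J).hom ((thetaPrime L J).act (Multiplicative.ofAdd m, 1) x⁻¹))).1) = _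
  rw [thetaPrime_hom, h, mul_one]
  rfl

/-- The case of trivial action on L is already inner; the case -id reduces to it by composing with
Ad(0, -1), which acts on L by -1. -/
theorem comap_plusMinus_eq_innPlus (hIJ : ∀ m n, I m n = J m n + J n m)
    (hI : Function.Bijective I) : (plusMinus I).comap (autToIsometry hIJ) =
      CrossedModule.innPlus (model E) arrowsModel (thetaPrime L J) := by
  ext φ
  constructor
  · have h1 : ∀ φ : AutPlus L J, (∀ m, TorusEnd.latticePart φ.1.val m = m) →
        φ ∈ CrossedModule.innPlus (model E) arrowsModel (thetaPrime L J) := fun φ hφ =>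
      (CrossedModule.mem_innPlus_iff _ _ _).mpr
        (TorusEnd.exists_eq_deltaFun_mul_adHom hIJ hI φ.1 φ.2 hφ)
    rintro (h | h)
    · exact h1 φ h
    · let s := CrossedModule.adPlus (model E) arrowsModel (thetaPrime L J) (mk 0 (-1))
      have hs : s ∈ CrossedModule.innPlus (model E) arrowsModel (thetaPrime L J) :=
        ⟨(thetaPrime L J).cls (mk 0 (-1)), rfl⟩
      refine (Subgroup.mul_mem_cancel_left _ hs).mp (h1 _ fun m => ?_)
      have h2 := TorusEnd.latticePart_mul s.1.val φ.1.val m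
      have h3 : TorusEnd.latticePart φ.1.val m = -m := h m
      have h4 : ∀ n, TorusEnd.latticePart s.1.val n = (-1 : ℤˣ) • n := fun n => rfl
      rw [h3, h4, Units.neg_smul, one_smul, neg_neg] at h2
      exact h2
  · intro h
    obtain ⟨x, η, hφ⟩ := (CrossedModule.mem_innPlus_iff _ _ _).mp h
    have h1 : ∀ m, (autToIsometry hIJ φ).1 m = x.2 • m := fun m => by
      rw [autToIsometry_apply, hφ, latticePart_deltaFun_mul_adHom]
    rcases Int.units_eq_one_or x.2 with hx | hx
    · exact Or.inl fun m => by rw [h1, hx, one_smul]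
    · exact Or.inr fun m => by rw [h1, hx, Units.neg_smul, one_smul]

/-- `π₀(𝒪ut⁺(𝒯 ⋊ {±1})) ≅ PO(L, I)`. -/
noncomputable def outEquivProjIsometry (hIJ : ∀ m n, I m n = J m n + J n m)
    (hI : Function.Bijective I) : OutPlusPi0 L J ≃* projIsometryGroup I :=
  (QuotientGroup.quotientMulEquivOfEq (by
    rw [← comap_plusMinus_eq_innPlus hIJ hI, ← MonoidHom.comap_ker, QuotientGroup.ker_mk']
    )).trans
    (QuotientGroup.quotientKerEquivOfSurjective
      ((QuotientGroup.mk' (plusMinus I)).comp (autToIsometry hIJ))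
      ((QuotientGroup.mk'_surjective _).comp (autToIsometry_surjective hIJ)))

end CategoricalTorus

theorem mainTheorem7 {E : Type*} [NormedAddCommGroup E] [NormedSpace ℝ E] [FiniteDimensional ℝ E]
    (L : Submodule ℤ E) [DiscreteTopology L] [IsZLattice ℝ L]
    (I J : L →ₗ[ℤ] L →ₗ[ℤ] ℤ) (hIJ : ∀ m n, I m n = J m n + J n m)
    (hI : Function.Bijective I) :
    -- exactness of the seven-term sequence
    ((thetaPrime L J).pi1Invariants = (pi1ToCross L J).ker ∧
      (pi1ToCross L J).range = (crossToCentre L J).ker ∧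
      (crossToCentre L J).range = (centreToTorus L J).ker ∧
      (centreToTorus L J).range = (torusToAut L J).ker ∧
      (torusToAut L J).range = (autToOut L J).ker ∧
      Function.Surjective (autToOut L J)) ∧
    -- first row: both groups are `U(1)`
    ((thetaPrime L J).pi1Invariants = ⊤ ∧
      ∃ u : Circle ≃* TorusPi1 L J, ∀ z, (u z : Arrows L) = (1, z)) ∧
    -- second row: `Cross(π₀, π₁) = {±1}`, which is `π₀(𝒵)` when the rank is positive
    ((∃ c : Cross L J ≃* ℤˣ, ∀ (χ : Cross L J) (x : E) (ε : ℤˣ),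
        (((χ.toFun ((thetaPrime L J).cls (PMSemidirect.mk x ε)) : Arrows L).2 : Circle) : ℂ) =
          (((if ε = 1 then 1 else c χ : ℤˣ) : ℤ) : ℂ)) ∧
      (Nontrivial E → Function.Bijective (crossToCentre L J))) ∧
    -- `π₀(𝒪ut⁺) ≅ PO(L, I)`, and the third row
    ∃ (Φ : OutPlusPi0 L J ≃* projIsometryGroup I)
      (e : TorusPi0 L J ≃* PMSemidirect (E ⧸ L)),
      (∀ φ : AutPlus L J, ∃ g : isometryGroup I,
        (∀ a : Arrows L, (φ.1.val.map₁ a).1 = Multiplicative.ofAdd (g.1 (Multiplicative.toAdd a.1))) ∧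
        Φ (QuotientGroup.mk φ) = QuotientGroup.mk g) ∧
      (∀ (x : E) (ε : ℤˣ), e ((thetaPrime L J).cls (PMSemidirect.mk x ε)) =
        PMSemidirect.mk (Submodule.Quotient.mk x) ε) ∧
      (Nontrivial E → Function.Injective ((torusToAut L J).comp e.symm.toMonoidHom)) ∧
      ((torusToAut L J).comp e.symm.toMonoidHom).range =
        (Φ.toMonoidHom.comp (autToOut L J)).ker ∧
      Function.Surjective (Φ.toMonoidHom.comp (autToOut L J)) := by
  refine ⟨⟨CrossedModule.pi1Invariants_eq_ker _ _ _, CrossedModule.range_pi1ToCross _ _ _,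
    CrossedModule.range_crossToPi0Centre _ _ _, CrossedModule.range_pi0Forget _ _ _,
    CrossedModule.range_pi0Ad _ _ _, CrossedModule.pi0Out_surjective _ _ _⟩,
    ⟨pi1Invariants_eq_top, circleEquivPi1 L J, fun z => rfl⟩,
    ⟨⟨(MulEquiv.ofBijective (signCross L J) signCross_bijective).symm, fun χ x ε => ?_⟩,
      fun _ => crossToCentre_bijective hIJ hI⟩,
    outEquivProjIsometry hIJ hI, pi0EquivTorus L J,
    fun φ => ⟨autToIsometry hIJ φ, TorusEnd.map₁_fst φ.1.val, rfl⟩,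
    pi0EquivTorus_cls,
    fun _ => (torusToAut_injective hIJ hI).comp (pi0EquivTorus L J).symm.injective, ?_,
    (outEquivProjIsometry hIJ hI).surjective.comp (CrossedModule.pi0Out_surjective _ _ _)⟩
  · obtain ⟨δ, rfl⟩ := (signCross_bijective (L := L) (J := J)).2 χ
    have e : (MulEquiv.ofBijective (signCross L J) signCross_bijective).symm (signCross L J δ) = δ :=
      (MulEquiv.ofBijective (signCross L J) signCross_bijective).symm_apply_apply δ
    rw [e]
    rfl
  -- Exactness in the middle of the third row is exactness at π₀(𝒜ut⁺): reparametrising the source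
  -- by an isomorphism keeps the range, and following with an isomorphism keeps the kernel.
  · ext c
    have h1 : c ∈ (torusToAut L J).range ↔ c ∈ (autToOut L J).ker := by
      rw [CrossedModule.range_pi0Ad]
    rw [MonoidHom.mem_ker, MonoidHom.comp_apply]
    refine Iff.trans ?_ (h1.trans ?_)
    · constructor
      · rintro ⟨y, rfl⟩
        exact ⟨(pi0EquivTorus L J).symm y, rfl⟩
      · rintro ⟨y, rfl⟩
        refine ⟨pi0EquivTorus L J y, ?_⟩
        change torusToAut L J ((pi0EquivTorus L J).symm (pi0EquivTorus L J y)) = _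
        rw [MulEquiv.symm_apply_apply]
    · rw [MonoidHom.mem_ker]
      exact (map_eq_one_iff (outEquivProjIsometry hIJ hI) (outEquivProjIsometry hIJ hI).injective).symm
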